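/- Let $n\ge 3$, $m>0$, $R_0=(m/2)^{1/(n-2)}$, and let $M=\{x\in\mathbb R^n: |x|\ge R_0\}$ carry the Schwarzschild metric $g_{Sch}=\bigl(1+\tfrac{m}{2|x|^{n-2}}\bigr)^{\frac{4}{n-2}}\delta$, where $\delta$ is the Euclidean metric. Let $r(x)$ be the $g_{Sch}$-distance from $x$ to the horizon $\partial M=\{|x|=R_0\}$, let $\partial_r$ be the outward radial vector field of unit $g_{Sch}$-length, and let $B_\rho=\{x\in M: r(x)\le\rho\}$. Put $s_0=(2m)^{1/(n-2)}$, let $F:[s_0,\infty)\to[0,\infty)$ be given by $F(s)=\int_{s_0}^s (1-2mt^{2-n})^{-1/2}\,dt$, let $h:[0,\infty)\to[s_0,\infty)$ be the inverse of $F$, and put $f(x)=h'(r(x))$. Let $\Sigma$ be a properly embedded free boundary minimal hypersurface of $(M,g_{Sch})$: a smooth embedded hypersurface with boundary that is closed as a subset of $M$, with $\partial\Sigma=\Sigma\cap\partial M$, with zero mean curvature with respect to $g_{Sch}$, and meeting $\partial M$ orthogonally along $\partial\Sigma$. Let $\Gamma$ be a nonempty closed (compact, without boundary) embedded minimal hypersurface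 of the Euclidean unit sphere $\mathbb S^{n-1}$, let $|\Gamma|$ be its $(n-2)$-dimensional Euclidean volume, and let $\Sigma_\Gamma=\{\lambda y: y\in\Gamma,\ \lambda>0\}\cap M$. Suppose that the $\Gamma$-density at infinity $$\Theta_\Gamma(\Sigma)=\lim_{\rho\to\infty}\frac{vol(\Sigma\cap B_\rho)}{vol(\Sigma_\Gamma\cap B_\rho)}$$ exists and is finite, where $vol$ is the $(n-1)$-dimensional volume of $g_{Sch}$. Then $0<|\Gamma|<\infty$, the $(n-2)$-dimensional $g_{Sch}$-volume $area(\partial\Sigma)$ is finite, the function $f\,h(r)^{1-n}\,|\partial_r^{\perp}|^2$ is integrable over $\Sigma$, and $$\Theta_\Gamma(\Sigma)=\frac{area(\partial\Sigma)}{2m|\Gamma|}+\frac{n-1}{|\Gamma|}\int_\Sigma\frac{f}{h^{n-1}(r)}\,|\partial_r^{\perp}|^2\,dv .$$ Here $\partial_r^\perp$ is the component of $\partial_r$ normal to $\Sigma$, $|\cdot|$ is its $g_{Sch}$-norm, and $dv$ is the volume element induced on $\Sigma$ by $g_{Sch}$. -/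

import Mathlib

open MeasureTheory Filter Topology Set
open scoped ContDiff ENNReal

noncomputable section

namespace Schwarzschild

/-- Euclidean `n`-space. -/
abbrev Euc (n : ℕ) : Type := EuclideanSpace ℝ (Fin n)

/-! ### Embedded submanifolds with boundary -/

/-- `p` is an interior point of the smooth embedded submanifold `S` of codimension `c`:
near `p`, the set `S` is the zero set of a smooth submersion onto `ℝ^c`. -/
def IsInteriorPoint {n : ℕ} (c : ℕ) (S : Set (Euc n)) (p : Euc n) : Prop :=
  p ∈ S ∧ ∃ V : Set (Euc n), IsOpen V ∧ p ∈ V ∧ ∃ Φ : Euc n → (Fin c → ℝ),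
    ContDiffOn ℝ ∞ Φ V ∧ Function.Surjective (fderiv ℝ Φ p) ∧
    S ∩ V = {x | x ∈ V ∧ Φ x = 0}

/-- `p` is a boundary point of the smooth embedded submanifold with boundary `S` of
codimension `c`: near `p`, the set `S` is `{Φ = 0, w ≥ 0}`, where `(Φ, w)` is a smooth
submersion to `ℝ^c × ℝ` and `w p = 0`. -/
def IsBoundaryPoint {n : ℕ} (c : ℕ) (S : Set (Euc n)) (p : Euc n) : Prop :=
  p ∈ S ∧ ∃ V : Set (Euc n), IsOpen V ∧ p ∈ V ∧
    ∃ (Φ : Euc n → (Fin c → ℝ)) (w : Euc n → ℝ),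
      ContDiffOn ℝ ∞ Φ V ∧ ContDiffOn ℝ ∞ w V ∧ w p = 0 ∧
      Function.Surjective (fun v : Euc n => (fderiv ℝ Φ p v, fderiv ℝ w p v)) ∧
      S ∩ V = {x | x ∈ V ∧ Φ x = 0 ∧ 0 ≤ w x}

/-- The manifold boundary of an embedded hypersurface with boundary. -/
def boundary {n : ℕ} (S : Set (Euc n)) : Set (Euc n) := {p | IsBoundaryPoint 1 S p}

/-- The tangent space of a submanifold, possibly with boundary: the span of the tangent cone
(at a boundary point this is the full tangent space and not only a half-space). -/
def tangentSpaceAt {n : ℕ} (S : Set (Euc n)) (p : Euc n) : Submodule ℝ (Euc n) :=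
  Submodule.span ℝ (tangentConeAt ℝ S p)

/-! ### Mean curvature with respect to a Riemannian metric on a domain of `ℝ^n` -/

/-- A field of bilinear forms on `ℝ^n`. -/
abbrev Metric (n : ℕ) : Type := Euc n → Euc n →L[ℝ] Euc n →L[ℝ] ℝ

/-- The Euclidean metric. -/
def euclideanMetric (n : ℕ) : Metric n := fun _ => innerSL ℝ

theorem euclideanMetric_apply {n : ℕ} (x v w : Euc n) :
    euclideanMetric n x v w = inner ℝ v w := rfl

/-- `G(∇_v N, w)` at `p`, for the Levi-Civita connection `∇` of `G`, in the standard coordinates: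
the last three terms are the Christoffel symbols of the first kind. -/
def covDerivInner {n : ℕ} (G : Metric n) (N : Euc n → Euc n) (p v w : Euc n) : ℝ :=
  G p (fderiv ℝ N p v) w +
    (1 / 2) * (fderiv ℝ G p v (N p) w + fderiv ℝ G p (N p) v w - fderiv ℝ G p w v (N p))

/-- `N` is smooth on `V` and restricts to a `G`-unit field normal to `S` along `S ∩ V`. -/
def IsUnitNormalOn {n : ℕ} (G : Metric n) (S V : Set (Euc n)) (N : Euc n → Euc n) : Prop :=
  ContDiffOn ℝ ∞ N V ∧ ∀ x ∈ S ∩ V, G x (N x) (N x) = 1 ∧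
    ∀ v ∈ tangentSpaceAt S x, G x (N x) v = 0

/-- At `p`, the mean curvature of the `k`-dimensional submanifold `S` in the direction of the unit
normal field `N`, that is (up to sign) the trace over a `G`-orthonormal basis of the tangent space
of the second fundamental form `G(∇_v N, w)`, is zero. -/
def MeanCurvatureVanishesAt {n : ℕ} (G : Metric n) (k : ℕ) (S : Set (Euc n))
    (N : Euc n → Euc n) (p : Euc n) : Prop :=
  ∀ e : Fin k → Euc n, (∀ i, e i ∈ tangentSpaceAt S p) →
    (∀ i j, G p (e i) (e j) = if i = j then 1 else 0) →
    ∑ i, covDerivInner G N p (e i) (e i) = 0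

/-! ### The Riemannian Schwarzschild manifold -/

/-- The radius `R₀` of the horizon. -/
def horizonRadius (n : ℕ) (m : ℝ) : ℝ := (m / 2) ^ (1 / ((n : ℝ) - 2))

/-- The underlying space `{|x| ≥ R₀}`. -/
def space (n : ℕ) (m : ℝ) : Set (Euc n) := {x | horizonRadius n m ≤ ‖x‖}

/-- The horizon `{|x| = R₀}`, which is the boundary of the Schwarzschild manifold. -/
def horizon (n : ℕ) (m : ℝ) : Set (Euc n) := {x | ‖x‖ = horizonRadius n m}

/-- The function `ψ` with `g_Sch = ψ² δ`. -/
def conformalFactor (n : ℕ) (m : ℝ) (x : Euc n) : ℝ :=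
  (1 + m / (2 * ‖x‖ ^ (n - 2))) ^ (2 / ((n : ℝ) - 2))

/-- The Schwarzschild metric `(1 + m / (2|x|^(n-2)))^(4/(n-2)) δ`. -/
def schwarzschildMetric (n : ℕ) (m : ℝ) : Metric n :=
  fun x => (conformalFactor n m x ^ 2) • innerSL ℝ

theorem schwarzschildMetric_apply {n : ℕ} (m : ℝ) (x v w : Euc n) :
    schwarzschildMetric n m x v w = conformalFactor n m x ^ 2 * inner ℝ v w := rfl

/-- The `k`-dimensional Riemannian volume of `g_Sch = ψ² δ` on `k`-dimensional submanifolds: the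
`k`-dimensional Hausdorff measure (normalised to agree with Lebesgue measure on `ℝ^k`) with
density `ψ^k`. -/
def vol (n : ℕ) (m : ℝ) (k : ℕ) : Measure (Euc n) :=
  (Measure.euclideanHausdorffMeasure k).withDensity
    (fun x => ENNReal.ofReal (conformalFactor n m x ^ k))

/-- The Schwarzschild length of a path `γ : [0,1] → ℝ^n`. -/
def length (n : ℕ) (m : ℝ) (γ : ℝ → Euc n) : ℝ :=
  ∫ t in (0 : ℝ)..1, √(schwarzschildMetric n m (γ t)
    (derivWithin γ (Icc 0 1) t) (derivWithin γ (Icc 0 1) t))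

/-- `r(x)`: the Schwarzschild distance from `x` to the horizon, the infimum of the lengths of the
`C¹` paths in the Schwarzschild manifold from the horizon to `x`. -/
def horizonDist (n : ℕ) (m : ℝ) (x : Euc n) : ℝ :=
  sInf {L | ∃ γ : ℝ → Euc n, ContDiffOn ℝ 1 γ (Icc 0 1) ∧ (∀ t ∈ Icc (0 : ℝ) 1, γ t ∈ space n m) ∧
    γ 0 ∈ horizon n m ∧ γ 1 = x ∧ L = length n m γ}

/-- `B_ρ`: the points at Schwarzschild distance at most `ρ` from the horizon. -/
def ball (n : ℕ) (m ρ : ℝ) : Set (Euc n) := {x | x ∈ space n m ∧ horizonDist n m x ≤ ρ}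

/-- `s₀ = (2m)^(1/(n-2))`. -/
def arealRadiusMin (n : ℕ) (m : ℝ) : ℝ := (2 * m) ^ (1 / ((n : ℝ) - 2))

/-- `F : [s₀, ∞) → [0, ∞)` with `F' (s) = 1 / √(1 - 2 m s^(2-n))` and `F s₀ = 0`. -/
def radialF (n : ℕ) (m s : ℝ) : ℝ :=
  ∫ t in (arealRadiusMin n m)..s, 1 / √(1 - 2 * m / t ^ (n - 2))

/-- `h : [0, ∞) → [s₀, ∞)`, the inverse of `F`. -/
def radialH (n : ℕ) (m r : ℝ) : ℝ :=
  Function.invFunOn (radialF n m) (Ici (arealRadiusMin n m)) r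

/-- The static potential `f(x) = h'(r(x))`. -/
def staticPotential (n : ℕ) (m : ℝ) (x : Euc n) : ℝ :=
  derivWithin (radialH n m) (Ici 0) (horizonDist n m x)

/-- `∂_r`: the outward radial vector of unit length for the Schwarzschild metric. -/
def radialUnit (n : ℕ) (m : ℝ) (x : Euc n) : Euc n :=
  (√(schwarzschildMetric n m x x x))⁻¹ • x

/-- `|∂_r^⊥|²`: the squared Schwarzschild norm of the component of `∂_r` normal to `S`. The metric
is conformal to the Euclidean one, hence has the same orthogonal projections. -/
def radialNormalSq (n : ℕ) (m : ℝ) (S : Set (Euc n)) (x : Euc n) : ℝ :=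
  schwarzschildMetric n m x
    ((tangentSpaceAt S x)ᗮ.starProjection (radialUnit n m x))
    ((tangentSpaceAt S x)ᗮ.starProjection (radialUnit n m x))

/-! ### Hypersurfaces and the density at infinity -/

/-- `S` is a properly embedded free boundary minimal hypersurface of the Schwarzschild manifold. -/
structure IsFreeBoundaryMinimal (n : ℕ) (m : ℝ) (S : Set (Euc n)) : Prop where
  subset_space : S ⊆ space n m
  isClosed : IsClosed S
  isHypersurface : ∀ p ∈ S, IsInteriorPoint 1 S p ∨ IsBoundaryPoint 1 S p
  boundary_eq : boundary S = S ∩ horizon n m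
  minimal : ∀ p ∈ S, ∀ (V : Set (Euc n)) (N : Euc n → Euc n), IsOpen V → p ∈ V →
    IsUnitNormalOn (schwarzschildMetric n m) S V N →
    MeanCurvatureVanishesAt (schwarzschildMetric n m) (n - 1) S N p
  /-- `S` meets the horizon orthogonally: the normal line of the horizon at `p`, which is spanned
  by the position vector, is tangent to `S`. -/
  orthogonal : ∀ p ∈ boundary S, p ∈ tangentSpaceAt S p

/-- `Γ` is a nonempty closed (compact without boundary) embedded minimal hypersurface of the
Euclidean unit sphere of `ℝ^n`. The normal fields are those tangent to the sphere; for them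
the second fundamental form in the sphere is computed by the Euclidean derivative. -/
structure IsClosedMinimalInSphere (n : ℕ) (Γ : Set (Euc n)) : Prop where
  nonempty : Γ.Nonempty
  isCompact : IsCompact Γ
  subset_sphere : Γ ⊆ Metric.sphere (0 : Euc n) 1
  isHypersurface : ∀ p ∈ Γ, IsInteriorPoint 2 Γ p
  minimal : ∀ p ∈ Γ, ∀ (V : Set (Euc n)) (N : Euc n → Euc n), IsOpen V → p ∈ V →
    IsUnitNormalOn (euclideanMetric n) Γ V N → (∀ x ∈ Γ ∩ V, inner ℝ (N x) x = 0) →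
    MeanCurvatureVanishesAt (euclideanMetric n) (n - 2) Γ N p

/-- `Σ_Γ`: the part of the cone over `Γ` in the Schwarzschild manifold. -/
def cone (n : ℕ) (m : ℝ) (Γ : Set (Euc n)) : Set (Euc n) :=
  {x | ∃ y ∈ Γ, ∃ l : ℝ, 0 < l ∧ x = l • y} ∩ space n m

/-- The `Γ`-density at infinity of `S` exists and equals `Θ` (possibly infinite). -/
def HasDensityAtInfinity (n : ℕ) (m : ℝ) (Γ S : Set (Euc n)) (Θ : ℝ≥0∞) : Prop :=
  Tendsto (fun ρ : ℝ => vol n m (n - 1) (S ∩ ball n m ρ) /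
    vol n m (n - 1) (cone n m Γ ∩ ball n m ρ)) atTop (𝓝 Θ)

/-- `|Γ|`: the Euclidean `(n-2)`-dimensional volume of a hypersurface of the unit sphere. -/
def sphereArea (n : ℕ) (Γ : Set (Euc n)) : ℝ≥0∞ :=
  (Measure.euclideanHausdorffMeasure (n - 2) : Measure (Euc n)) Γ

end Schwarzschild

end

/-! Write `d = n - 1`, `f` for the static potential, `ψ` for the conformal factor, `s = h(r)` for
the areal radius, `x^T` for the tangential part of the position vector `x`. The position field is
`h(r) ∂_r`, and its Schwarzschild covariant derivative is `f` times the identity, so its divergence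
along any hypersurface is `d f`. Hence minimality and the free boundary condition give, for a radial
multiple `Λ(|x|) x` that vanishes for large `|x|`, `∫_Σ (d Λ f + Λ' |x^T|² / |x|) dv = -Λ(R₀) s₀
area(∂Σ)`, with Euclidean norms; this is `integral_radialVariation`.

Put `q = s^(-d)`, which satisfies `q' = -d q f / |x|` as a function of `|x|`. For `Λ = (q - q(R))₊`
the integrand on `{|x| < R}` becomes `d (f q |∂_r^⊥|² - q(R) f)`, because `|∂_r^⊥|² = 1 - |x^T|² /
|x|²`. Therefore (`integral_indicator_eq`) `∫_{Σ, |x|<R} f q |∂_r^⊥|² = q(R) ∫_{Σ, |x|<R} f - (q(R₀)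
- q(R)) s₀ area(∂Σ) / d`. Let `R → ∞`. Since `f` and `q(R) R^d` tend to one, and the cone over `Γ`
has volume asymptotic to `|Γ| R^d / d`, the first term on the right tends to `Θ |Γ| / d`. Moreover
`q(R₀) s₀ = s₀^(2-n) = 1/(2m)` (`horizon_flux`). The integrand on the left is nonnegative, so
integrability comes with the limit (`integral_fluxDensity`).

All integrals are taken against Hausdorff measures. The calculus on `Σ` rests on one tool, the tube
formula `tendsto_tubeIntegral`: the measure on `{w = 0}` is the limit of `ε⁻¹ κ(w/ε)` times the
gradient weight times the measure one dimension higher. It follows from charts that are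
`K`-biLipschitz with `K` arbitrarily close to one (`exists_chart`). It is used three times: to
deduce the divergence theorem on `Σ` from that of `ℝ^n` (`integral_divergence_levelSet`), to produce
the boundary term at the horizon (`tendsto_integral_deriv_step`), and to compute the volume of the
cone (`tendsto_radialCone`). -/

noncomputable section

namespace Schwarzschild

/-! ### Hausdorff measure and Lipschitz maps -/

section Lipschitz

variable {X Y : Type*} [MetricSpace X] [MeasurableSpace X] [BorelSpace X]
  [MetricSpace Y] [MeasurableSpace Y] [BorelSpace Y]

theorem euclideanHausdorffMeasure_image_le {T : X → Y} {A : Set X} {K : NNReal}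
    (hT : LipschitzOnWith K T A) (k : ℕ) :
    (Measure.euclideanHausdorffMeasure k : Measure Y) (T '' A) ≤
      (K : ℝ≥0∞) ^ k * (Measure.euclideanHausdorffMeasure k : Measure X) A := by
  simp_rw [Measure.euclideanHausdorffMeasure_def, Measure.smul_apply, ENNReal.smul_def, smul_eq_mul]
  have h := hT.hausdorffMeasure_image_le (d := k) (by positivity)
  rw [ENNReal.rpow_natCast] at h
  calc _ ≤ _ := mul_le_mul_right h _
    _ = _ := by ring

/-- Change of variables inequality for the image of a Lipschitz map. -/
theorem setLIntegral_image_le_of_lipschitzOnWith {T : X → Y} {A : Set X} {K : NNReal}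
    (hT : LipschitzOnWith K T A) (hA : MeasurableSet A) (k : ℕ) (g : Y → ℝ≥0∞) :
    ∫⁻ y in T '' A, g y ∂(Measure.euclideanHausdorffMeasure k : Measure Y) ≤
      (K : ℝ≥0∞) ^ k *
        ∫⁻ x in A, g (T x) ∂(Measure.euclideanHausdorffMeasure k : Measure X) := by
  have hTm : AEMeasurable T ((Measure.euclideanHausdorffMeasure k : Measure X).restrict A) :=
    hT.continuousOn.aemeasurable hA
  have hle : (Measure.euclideanHausdorffMeasure k : Measure Y).restrict (T '' A) ≤
      (K : ℝ≥0∞) ^ k •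
        Measure.map T ((Measure.euclideanHausdorffMeasure k : Measure X).restrict A) := by
    refine Measure.le_iff.2 fun C hC => ?_
    rw [Measure.restrict_apply hC, Measure.smul_apply, Measure.map_apply_of_aemeasurable hTm hC,
      Measure.restrict_apply' hA, smul_eq_mul, inter_comm C, ← image_inter_preimage, inter_comm A]
    exact euclideanHausdorffMeasure_image_le (hT.mono inter_subset_right) k
  calc _ ≤ ∫⁻ y, g y ∂((K : ℝ≥0∞) ^ k •
        Measure.map T ((Measure.euclideanHausdorffMeasure k : Measure X).restrict A)) :=
        lintegral_mono' hle le_rfl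
    _ ≤ _ := by
        rw [lintegral_smul_measure, smul_eq_mul]
        gcongr
        exact lintegral_map_le _ _

end Lipschitz

/-! ### Tubes around the zero set of a function -/

/-- The model space `ℝ × ℝ^k` with its Euclidean norm. -/
abbrev HalfModel (k : ℕ) : Type := WithLp 2 (ℝ × EuclideanSpace ℝ (Fin k))

theorem euclideanHausdorffMeasure_halfModel (k : ℕ) :
    (Measure.euclideanHausdorffMeasure (k + 1) : Measure (HalfModel k)) = volume := by
  have h := InnerProductSpace.euclideanHausdorffMeasure_eq_volume (V := HalfModel k)
  have h2 : Module.finrank ℝ (HalfModel k) = k + 1 := by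
    rw [(WithLp.linearEquiv 2 ℝ (ℝ × EuclideanSpace ℝ (Fin k))).finrank_eq]
    simp [add_comm]
  rwa [h2] at h

theorem setLIntegral_halfModel (k : ℕ) {I : Set ℝ} {B : Set (EuclideanSpace ℝ (Fin k))}
    {a : ℝ → ℝ≥0∞} {b : EuclideanSpace ℝ (Fin k) → ℝ≥0∞} (ha : AEMeasurable a (volume.restrict I))
    (hb : AEMeasurable b (volume.restrict B)) :
    ∫⁻ z in {z : HalfModel k | z.fst ∈ I ∧ z.snd ∈ B}, a z.fst * b z.snd
      ∂(Measure.euclideanHausdorffMeasure (k + 1)) =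
    (∫⁻ s in I, a s) * ∫⁻ y in B, b y := by
  rw [euclideanHausdorffMeasure_halfModel, ← lintegral_prod_mul ha hb, Measure.prod_restrict]
  have h := (WithLp.volume_preserving_ofLp ℝ (EuclideanSpace ℝ (Fin k)))
  have h2 := h.setLIntegral_comp_preimage_emb (s := I ×ˢ B)
    (MeasurableEquiv.toLp 2 (ℝ × EuclideanSpace ℝ (Fin k))).symm.measurableEmbedding
    (fun z => a z.1 * b z.2)
  exact h2

/-- Near `p`, the function `w / a` and a map `f` to `ℝ^k` are the coordinates of a `K`-biLipschitz
chart of `{x ∈ X | 0 ≤ w x}` onto a set that contains a half-ball, and `W` is close to `a`. -/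
def HasTubeChart {n : ℕ} (X : Set (Euc n)) (w W : Euc n → ℝ) (k : ℕ) (K : NNReal)
    (p : Euc n) : Prop :=
  ∃ (U : Set (Euc n)) (f : Euc n → EuclideanSpace ℝ (Fin k)) (a r : ℝ), IsOpen U ∧ p ∈ U ∧
    ContinuousOn f U ∧ 0 < a ∧ 0 < r ∧
    (∀ x ∈ X ∩ U, 0 ≤ w x → a ≤ K * W x ∧ W x ≤ K * a) ∧
    (∀ x ∈ X ∩ U, ∀ y ∈ X ∩ U, 0 ≤ w x → 0 ≤ w y →
      dist x y ≤ K * dist (WithLp.toLp 2 (w x / a, f x) : HalfModel k)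
        (WithLp.toLp 2 (w y / a, f y)) ∧
      dist (WithLp.toLp 2 (w x / a, f x) : HalfModel k)
        (WithLp.toLp 2 (w y / a, f y)) ≤ K * dist x y) ∧
    ∀ y ∈ Metric.ball (f p) r, ∀ s ∈ Ico 0 r, ∃ x ∈ X ∩ U, f x = y ∧ w x = a * s

/-- The integral of `κ(w/ε) W g` over `{x ∈ X | 0 ≤ w x}`. -/
def tubeIntegral {n : ℕ} (X : Set (Euc n)) (w W : Euc n → ℝ) (k : ℕ) (κ : ℝ → ℝ≥0∞)
    (g : Euc n → ℝ) (ε : ℝ) : ℝ≥0∞ :=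
  ∫⁻ x in {x ∈ X | 0 ≤ w x}, κ (w x / ε) * (ENNReal.ofReal (W x) * ENNReal.ofReal (g x))
    ∂(Measure.euclideanHausdorffMeasure (k + 1))

theorem dist_halfModel {k : ℕ} (s t : ℝ) (y z : EuclideanSpace ℝ (Fin k)) :
    dist (WithLp.toLp 2 (s, y) : HalfModel k) (WithLp.toLp 2 (t, z)) =
      √((s - t) ^ 2 + dist y z ^ 2) := by
  rw [WithLp.prod_dist_eq_of_L2]
  simp [Real.dist_eq, sq_abs]

theorem measurableSet_sep_of_continuousOn {n : ℕ} {X : Set (Euc n)} {w : Euc n → ℝ}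
    (hX : MeasurableSet X) (hw : ContinuousOn w X) {I : Set ℝ} (hI : MeasurableSet I) :
    MeasurableSet {x ∈ X | w x ∈ I} := by
  have h : Measurable (X.domRestrict w) := (continuousOn_iff_continuous_domRestrict.1 hw).measurable
  have h2 := (MeasurableEmbedding.subtype_coe hX).measurableSet_image.2 (h hI)
  convert h2 using 1
  ext x
  simp [and_comm, Set.domRestrict]

/-- The rescaled profile lives on `[0, c]`, which lies inside `[0, r)`, so the truncation is
invisible and only the Jacobian of the scaling remains. -/
theorem lintegral_Ico_comp_div {κ : ℝ → ℝ≥0∞} (hκ : ∀ t ∉ Icc (0 : ℝ) 1, κ t = 0)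
    {r c : ℝ} (hc : 0 < c) (hcr : c < r) :
    ∫⁻ s in Ico 0 r, κ (s / c) = ENNReal.ofReal c * ∫⁻ t, κ t := by
  have h0 : ∫⁻ s in Ico 0 r, κ (s / c) = ∫⁻ s, κ (s / c) := by
    rw [← lintegral_indicator measurableSet_Ico]
    congr 1
    ext s
    by_cases hs : s ∈ Ico 0 r
    · simp [hs]
    · rw [indicator_of_notMem hs, hκ]
      contrapose! hs
      have h1 : 0 ≤ s := by
        have := mul_nonneg hs.1 hc.le
        rwa [div_mul_cancel₀ _ hc.ne'] at this
      have h2 : s ≤ c := (div_le_one hc).1 hs.2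
      exact ⟨h1, h2.trans_lt hcr⟩
  rw [h0]
  have he : MeasurableEmbedding fun s : ℝ => c⁻¹ * s :=
    (Homeomorph.mulLeft₀ _ (inv_ne_zero hc.ne')).measurableEmbedding
  have h := he.lintegral_map (μ := volume) κ
  rw [Real.map_volume_mul_left (inv_ne_zero hc.ne'), lintegral_smul_measure, inv_inv,
    abs_of_pos hc] at h
  simp_rw [div_eq_inv_mul]
  exact h.symm


/-- In the chart the region `{w ≥ 0}` is the cylinder `[0, r) × B` up to a factor `K` in distances,
and `w` is `a` times the height. On the cylinder the integral splits by Tonelli, and `G` at height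
at most `ε/a` is uniformly close to its value at the foot. The power `2k + 2` collects `k + 1` for
the transfer in dimension `k + 1`, `k` for the transfer in dimension `k`, and one for replacing `W`
by `a`. -/
theorem HasTubeChart.exists_estimates {n k : ℕ} {X : Set (Euc n)} {w W : Euc n → ℝ} {K : NNReal}
    {p : Euc n} (h : HasTubeChart X w W k K p) (hK : 1 ≤ K) (hX : MeasurableSet X)
    (hw : ContinuousOn w X) {κ : ℝ → ℝ≥0∞} (hκm : Measurable κ)
    (hκ : ∀ t ∉ Icc (0 : ℝ) 1, κ t = 0) (hκt : ∫⁻ t, κ t ≠ ⊤) :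
    ∃ U : Set (Euc n), IsOpen U ∧ p ∈ U ∧ ∀ G : Euc n → ℝ, Continuous G → HasCompactSupport G →
      tsupport G ⊆ U →
      ∫⁻ x in {x ∈ X | w x = 0}, ENNReal.ofReal (G x) ∂(Measure.euclideanHausdorffMeasure k) ≠ ⊤ ∧
      ∀ η : ℝ≥0∞, η ≠ 0 → ∀ᶠ ε in 𝓝[>] (0 : ℝ),
        tubeIntegral X w W k κ G ε ≤ ENNReal.ofReal ε * (K ^ (2 * k + 2) * ((∫⁻ t, κ t) *
          ∫⁻ x in {x ∈ X | w x = 0}, ENNReal.ofReal (G x)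
            ∂(Measure.euclideanHausdorffMeasure k)) + η) ∧
        ENNReal.ofReal ε * ((∫⁻ t, κ t) * ∫⁻ x in {x ∈ X | w x = 0}, ENNReal.ofReal (G x)
            ∂(Measure.euclideanHausdorffMeasure k)) ≤
          K ^ (2 * k + 2) * tubeIntegral X w W k κ G ε + ENNReal.ofReal ε * η := by
  obtain ⟨U, f, a, r, hU, hpU, hf, ha, hr, hW, hL, hsurj⟩ := h
  set B := Metric.ball (f p) r with hB
  have hU'o : IsOpen (U ∩ f ⁻¹' B) := hf.isOpen_inter_preimage hU Metric.isOpen_ball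
  refine ⟨U ∩ f ⁻¹' B, hU'o, ⟨hpU, Metric.mem_ball_self hr⟩, fun G hG hGc hGs => ?_⟩
  set U' := U ∩ f ⁻¹' B
  set Ψ : Euc n → HalfModel k := fun x => WithLp.toLp 2 (w x / a, f x) with hΨdef
  set A : Set (Euc n) := {x ∈ X | w x ∈ Ico 0 (a * r)} ∩ U' with hAdef
  set A₀ : Set (Euc n) := {x ∈ X | w x = 0} ∩ U' with hA₀def
  set D : Set (HalfModel k) := {z | z.fst ∈ Ico 0 r ∧ z.snd ∈ B} with hDdef
  have hAm : MeasurableSet A :=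
    (measurableSet_sep_of_continuousOn hX hw measurableSet_Ico).inter hU'o.measurableSet
  have hA₀m : MeasurableSet A₀ :=
    (measurableSet_sep_of_continuousOn hX hw (measurableSet_singleton (0 : ℝ))).inter
      hU'o.measurableSet
  have hDm : MeasurableSet D := by
    have h1 : Continuous fun z : HalfModel k => z.fst := by fun_prop
    have h2 : Continuous fun z : HalfModel k => z.snd := by fun_prop
    exact (h1.measurable measurableSet_Ico).inter (h2.measurable measurableSet_ball)
  have hlipA : ∀ x ∈ A, ∀ y ∈ A, dist x y ≤ K * dist (Ψ x) (Ψ y) ∧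
      dist (Ψ x) (Ψ y) ≤ K * dist x y := fun x hx y hy =>
    hL x ⟨hx.1.1, hx.2.1⟩ y ⟨hy.1.1, hy.2.1⟩ hx.1.2.1 hy.1.2.1
  have hΨ : LipschitzOnWith K Ψ A :=
    LipschitzOnWith.of_dist_le_mul fun x hx y hy => (hlipA x hx y hy).2
  have hΨD : ∀ x ∈ A, Ψ x ∈ D := fun x hx =>
    ⟨⟨div_nonneg hx.1.2.1 ha.le, by
      simpa [hΨdef, div_lt_iff₀ ha, mul_comm] using hx.1.2.2⟩, hx.2.2⟩
  have hex : ∀ z : HalfModel k, ∃ x, z ∈ D → x ∈ A ∧ Ψ x = z := by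
    intro z
    by_cases hz : z ∈ D
    · obtain ⟨x, hx, hfx, hwx⟩ := hsurj z.snd hz.2 z.fst hz.1
      refine ⟨x, fun _ => ⟨⟨⟨hx.1, ?_⟩, hx.2, ?_⟩, ?_⟩⟩
      · rw [hwx]
        exact ⟨mul_nonneg ha.le hz.1.1, mul_lt_mul_of_pos_left hz.1.2 ha⟩
      · change f x ∈ B
        rw [hfx]; exact hz.2
      · simp only [hΨdef, hfx, hwx, mul_div_cancel_left₀ _ ha.ne']
        rfl
    · exact ⟨0, fun h => absurd h hz⟩
  -- `θ` is the inverse of `Ψ`: it exists by the surjectivity clause of the chart, and the lower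
  -- distance bound makes it a two-sided inverse.
  choose θ hθ using hex
  have hθΨ : ∀ x ∈ A, θ (Ψ x) = x := fun x hx => by
    have h1 := hθ (Ψ x) (hΨD x hx)
    have h2 := (hlipA _ h1.1 x hx).1
    rw [h1.2, dist_self, mul_zero] at h2
    exact dist_le_zero.1 h2
  have hθl : LipschitzOnWith K θ D := LipschitzOnWith.of_dist_le_mul fun z hz z' hz' => by
    have := (hlipA _ (hθ z hz).1 _ (hθ z' hz').1).1
    rwa [(hθ z hz).2, (hθ z' hz').2] at this
  have himθ : θ '' D = A := by
    ext x
    exact ⟨fun ⟨z, hz, h⟩ => h ▸ (hθ z hz).1, fun hx => ⟨Ψ x, hΨD x hx, hθΨ x hx⟩⟩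
  have himΨ : Ψ '' A = D := by
    ext z
    exact ⟨fun ⟨x, hx, h⟩ => h ▸ hΨD x hx, fun hz => ⟨θ z, hθ z hz⟩⟩
  have hσ : ∀ z ∈ D, w (θ z) / a = z.fst := fun z hz =>
    congrArg (fun z : HalfModel k => z.fst) (hθ z hz).2
  have hfθ : ∀ z ∈ D, f (θ z) = z.snd := fun z hz =>
    congrArg (fun z : HalfModel k => z.snd) (hθ z hz).2
  -- The foot of the cylinder, which corresponds to `{w = 0}`.
  set ι : EuclideanSpace ℝ (Fin k) → HalfModel k := fun y => WithLp.toLp 2 (0, y) with hι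
  have hιD : ∀ y ∈ B, ι y ∈ D := fun y hy => ⟨⟨le_rfl, hr⟩, hy⟩
  have hdι : ∀ y z, dist (ι y) (ι z) = dist y z := fun y z => by
    rw [hι, dist_halfModel]; simp
  set θ₀ : EuclideanSpace ℝ (Fin k) → Euc n := fun y => θ (ι y) with hθ₀
  have hθ₀l : LipschitzOnWith K θ₀ B := LipschitzOnWith.of_dist_le_mul fun y hy z hz => by
    rw [← hdι]
    exact hθl.dist_le_mul _ (hιD y hy) _ (hιD z hz)
  have hA₀A : A₀ ⊆ A := fun x hx => ⟨⟨hx.1.1, hx.1.2.symm ▸ ⟨le_rfl, mul_pos ha hr⟩⟩, hx.2⟩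
  have hΨ₀ : ∀ x ∈ A₀, Ψ x = ι (f x) := fun x hx => by
    simp [hΨdef, hι, hx.1.2]
  have hfl : LipschitzOnWith K f A₀ := LipschitzOnWith.of_dist_le_mul fun x hx y hy => by
    rw [← hdι, ← hΨ₀ x hx, ← hΨ₀ y hy]
    exact (hlipA x (hA₀A hx) y (hA₀A hy)).2
  have hθ₀A : ∀ y ∈ B, θ₀ y ∈ A₀ := fun y hy => by
    have h1 := hθ _ (hιD y hy)
    refine ⟨⟨h1.1.1.1, ?_⟩, h1.1.2⟩
    have h2 := hσ _ (hιD y hy)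
    have h3 : (ι y).fst = 0 := rfl
    rw [h3, div_eq_zero_iff] at h2
    exact h2.resolve_right ha.ne'
  have hθ₀f : ∀ x ∈ A₀, θ₀ (f x) = x := fun x hx => by
    rw [hθ₀]
    simp only [← hΨ₀ x hx]
    exact hθΨ x (hA₀A hx)
  have himf : f '' A₀ = B := by
    ext y
    exact ⟨fun ⟨x, hx, h⟩ => h ▸ hx.2.2, fun hy => ⟨θ₀ y, hθ₀A y hy, hfθ _ (hιD y hy)⟩⟩
  have himθ₀ : θ₀ '' B = A₀ := by
    ext x
    exact ⟨fun ⟨y, hy, h⟩ => h ▸ hθ₀A y hy, fun hx => ⟨f x, hx.2.2, hθ₀f x hx⟩⟩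
  set g : Euc n → ℝ≥0∞ := fun x => ENNReal.ofReal (G x) with hg
  have hg0 : ∀ x ∉ U', g x = 0 := fun x hx => by
    rw [hg]
    simp [image_eq_zero_of_notMem_tsupport fun hx' => hx (hGs hx')]
  have hgm : Measurable g := hG.measurable.ennreal_ofReal
  set b : EuclideanSpace ℝ (Fin k) → ℝ≥0∞ := fun y => g (θ₀ y) with hb
  have hbm : AEMeasurable b (volume.restrict B) :=
    hgm.comp_aemeasurable (hθ₀l.continuousOn.aemeasurable measurableSet_ball)
  set I₀ := ∫⁻ x in {x ∈ X | w x = 0}, g x ∂(Measure.euclideanHausdorffMeasure k) with hI₀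
  have hI₀A : I₀ = ∫⁻ x in A₀, g x ∂(Measure.euclideanHausdorffMeasure k) := by
    rw [hA₀def, inter_comm, ← setLIntegral_indicator hU'o.measurableSet]
    refine lintegral_congr fun x => ?_
    by_cases hx : x ∈ U' <;> simp [hx, hg0]
  set β := ∫⁻ y in B, b y with hβ
  have hβI : β ≤ K ^ k * I₀ := by
    have := setLIntegral_image_le_of_lipschitzOnWith hfl hA₀m k b
    rw [himf, EuclideanSpace.euclideanHausdorffMeasure_eq_volume] at this
    rw [hI₀A]
    refine this.trans_eq ?_
    congr 1
    refine setLIntegral_congr_fun hA₀m fun x hx => ?_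
    simp only [hb, hθ₀f x hx]
  have hIβ : I₀ ≤ K ^ k * β := by
    have := setLIntegral_image_le_of_lipschitzOnWith hθ₀l measurableSet_ball k g
    rwa [himθ₀, EuclideanSpace.euclideanHausdorffMeasure_eq_volume, ← hI₀A] at this
  have hBfin : volume B ≠ ⊤ := measure_ball_lt_top.ne
  obtain ⟨C, hC⟩ := hG.bounded_above_of_compact_support hGc
  have hβfin : β ≠ ⊤ := by
    refine ne_top_of_le_ne_top (b := ENNReal.ofReal C * volume B)
      (ENNReal.mul_ne_top ENNReal.ofReal_ne_top hBfin) ?_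
    rw [← setLIntegral_const]
    exact lintegral_mono fun y => ENNReal.ofReal_le_ofReal ((le_abs_self _).trans (hC _))
  refine ⟨ne_top_of_le_ne_top (ENNReal.mul_ne_top (by simp) hβfin) hIβ, fun η hη => ?_⟩
  set κ' := ∫⁻ t, κ t with hκ'
  -- The oscillation `η₀` of `G` on the tube costs at most `K^(k+2) κ' volume(B) η₀` in either
  -- inequality.
  obtain ⟨η₀, hη₀, hη₀C⟩ : ∃ η₀ : NNReal, 0 < η₀ ∧ K ^ (k + 2) * κ' * volume B * η₀ ≤ η := by
    have hCt : K ^ (k + 2) * κ' * volume B ≠ ⊤ :=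
      ENNReal.mul_ne_top (ENNReal.mul_ne_top (by simp) hκt) hBfin
    obtain ⟨e, he, heC⟩ := ENNReal.exists_nnreal_pos_mul_lt hCt hη
    exact ⟨e, he, by rw [mul_comm]; exact heC.le⟩
  obtain ⟨δ, hδ, hGδ⟩ := Metric.uniformContinuous_iff.1
    (hGc.uniformContinuous_of_continuous hG) η₀ hη₀
  have hev1 : ∀ᶠ ε in 𝓝[>] (0 : ℝ), ε / a < r :=
    nhdsWithin_le_nhds (((continuous_id.div_const a).tendsto' 0 0 (by simp)).eventually
      (gt_mem_nhds hr))
  have hev2 : ∀ᶠ ε in 𝓝[>] (0 : ℝ), K * (ε / a) < δ :=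
    nhdsWithin_le_nhds ((((continuous_id.div_const a).const_mul (K : ℝ)).tendsto' 0 0
      (by simp)).eventually (gt_mem_nhds hδ))
  filter_upwards [hev1, hev2, self_mem_nhdsWithin] with ε hε1 hε2 hε
  have hε0 : 0 < ε := hε
  set c := ε / a with hc
  have hc0 : 0 < c := div_pos hε0 ha
  have hac : ENNReal.ofReal a * ENNReal.ofReal c = ENNReal.ofReal ε := by
    rw [← ENNReal.ofReal_mul ha.le, hc, mul_div_cancel₀ _ ha.ne']
  have hκw : ∀ x, κ (w x / ε) = κ (w x / a / c) := fun x => by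
    rw [hc, div_div, mul_div_cancel₀ _ ha.ne']
  have hJ : tubeIntegral X w W k κ G ε = ∫⁻ x in A, κ (w x / a / c) *
      (ENNReal.ofReal (W x) * g x) ∂(Measure.euclideanHausdorffMeasure (k + 1)) := by
    have hsub : A ⊆ {x ∈ X | 0 ≤ w x} := fun x hx => ⟨hx.1.1, hx.1.2.1⟩
    have hAA : A = A ∩ {x ∈ X | 0 ≤ w x} := (inter_eq_left.2 hsub).symm
    rw [hAA, ← setLIntegral_indicator hAm, tubeIntegral]
    refine setLIntegral_congr_fun
      (measurableSet_sep_of_continuousOn hX hw measurableSet_Ici) fun x hx => ?_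
    by_cases hxA : x ∈ A
    · simp only [hxA, indicator_of_mem, hκw, hg]
    · rw [indicator_of_notMem hxA]
      by_cases hxU : x ∈ U'
      · rw [hκw, hκ, zero_mul]
        intro hmem
        refine hxA ⟨⟨hx.1, hx.2, ?_⟩, hxU⟩
        have h1 : w x / a ≤ c := (div_le_one hc0).1 hmem.2
        have h2 := h1.trans_lt hε1
        rwa [div_lt_iff₀ ha, mul_comm] at h2
      · have : ENNReal.ofReal (G x) = 0 := hg0 x hxU
        simp [this]
  have hclose : ∀ z ∈ D, κ (z.fst / c) ≠ 0 →
      g (θ z) ≤ b z.snd + η₀ ∧ b z.snd ≤ g (θ z) + η₀ := by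
    intro z hz hne
    have hz1 : z.fst / c ∈ Icc (0 : ℝ) 1 := by
      by_contra h
      exact hne (hκ _ h)
    have h1 : z.fst ≤ c := (div_le_one hc0).1 hz1.2
    -- A point and its foot are at most `K` times the height apart, and the height is at most `c`
    -- wherever the profile is nonzero.
    have h2 : dist (θ z) (θ₀ z.snd) < δ := by
      refine lt_of_le_of_lt (hθl.dist_le_mul _ hz _ (hιD _ hz.2)) (lt_of_le_of_lt ?_ hε2)
      have h3 : dist z (ι z.snd) = z.fst := by
        have : z = WithLp.toLp 2 (z.fst, z.snd) := rfl
        conv_lhs => rw [this]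
        rw [hι, dist_halfModel]
        simp [Real.sqrt_sq hz.1.1]
      rw [h3]
      gcongr
    have h4 := hGδ h2
    rw [Real.dist_eq, abs_lt] at h4
    have hη₀' : (η₀ : ℝ≥0∞) = ENNReal.ofReal η₀ := by simp
    simp only [hb, hg, hη₀']
    constructor
    · refine (ENNReal.ofReal_le_ofReal ?_).trans ENNReal.ofReal_add_le
      linarith
    · refine (ENNReal.ofReal_le_ofReal ?_).trans ENNReal.ofReal_add_le
      linarith
  have hκc : ∫⁻ s in Ico 0 r, κ (s / c) = ENNReal.ofReal c * κ' :=
    lintegral_Ico_comp_div hκ hc0 hε1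
  have hκcm : Measurable fun s : ℝ => κ (s / c) := hκm.comp (measurable_id.div_const c)
  have hK1 : (1 : ℝ≥0∞) ≤ K := by exact_mod_cast hK
  constructor
  · calc tubeIntegral X w W k κ G ε
        ≤ ∫⁻ x in A, κ (w x / a / c) * (K * ENNReal.ofReal a * g x)
          ∂(Measure.euclideanHausdorffMeasure (k + 1)) := by
          rw [hJ]
          refine setLIntegral_mono' hAm fun x hx => ?_
          gcongr
          have := (hW x ⟨hx.1.1, hx.2.1⟩ hx.1.2.1).2
          calc ENNReal.ofReal (W x) ≤ ENNReal.ofReal (K * a) := ENNReal.ofReal_le_ofReal this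
            _ = K * ENNReal.ofReal a := by rw [ENNReal.ofReal_mul (by simp)]; simp
      _ ≤ K ^ (k + 1) * ∫⁻ z in D, κ (w (θ z) / a / c) * (K * ENNReal.ofReal a * g (θ z))
          ∂(Measure.euclideanHausdorffMeasure (k + 1)) := by
          have := setLIntegral_image_le_of_lipschitzOnWith hθl hDm (k + 1)
            (fun x => κ (w x / a / c) * (K * ENNReal.ofReal a * g x))
          rwa [himθ] at this
      _ ≤ K ^ (k + 1) * ∫⁻ z in D, κ (z.fst / c) * (K * ENNReal.ofReal a * (b z.snd + η₀))
          ∂(Measure.euclideanHausdorffMeasure (k + 1)) := by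
          refine mul_le_mul_right (setLIntegral_mono' hDm fun z hz => ?_) _
          rw [hσ z hz]
          by_cases hne : κ (z.fst / c) = 0
          · simp [hne]
          · gcongr
            exact (hclose z hz hne).1
      _ = K ^ (k + 1) * (ENNReal.ofReal c * κ' *
            (K * ENNReal.ofReal a * (β + η₀ * volume B))) := by
          rw [setLIntegral_halfModel k hκcm.aemeasurable
            (b := fun y => K * ENNReal.ofReal a * (b y + η₀))
            ((hbm.add_const _).const_mul _), hκc]
          congr 2
          rw [lintegral_const_mul'' _ (hbm.add_const _), lintegral_add_left' hbm,
            setLIntegral_const]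
      _ = ENNReal.ofReal ε * (K ^ (k + 2) * κ' * β + K ^ (k + 2) * κ' * volume B * η₀) := by
          rw [← hac]; ring
      _ ≤ _ := by
          refine mul_le_mul_right (add_le_add ?_ hη₀C) _
          calc K ^ (k + 2) * κ' * β ≤ K ^ (k + 2) * κ' * (K ^ k * I₀) := by gcongr
            _ = _ := by ring
  · have hDκ : ENNReal.ofReal c * κ' * β ≤
        K ^ (k + 1) * (∫⁻ x in A, κ (w x / a / c) * g x
          ∂(Measure.euclideanHausdorffMeasure (k + 1))) + η₀ * (ENNReal.ofReal c * κ' * volume B) :=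
      calc ENNReal.ofReal c * κ' * β = ∫⁻ z in D, κ (z.fst / c) * b z.snd
            ∂(Measure.euclideanHausdorffMeasure (k + 1)) := by
            rw [setLIntegral_halfModel k hκcm.aemeasurable hbm, hκc]
        _ ≤ ∫⁻ z in D, (κ (z.fst / c) * g (θ z) + κ (z.fst / c) * η₀)
            ∂(Measure.euclideanHausdorffMeasure (k + 1)) := by
            refine setLIntegral_mono' hDm fun z hz => ?_
            rw [← mul_add]
            by_cases hne : κ (z.fst / c) = 0
            · simp [hne]
            · gcongr
              exact (hclose z hz hne).2
        _ = (∫⁻ z in Ψ '' A, κ (z.fst / c) * g (θ z)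
              ∂(Measure.euclideanHausdorffMeasure (k + 1))) +
            ENNReal.ofReal c * κ' * (η₀ * volume B) := by
            have hm : Measurable fun z : HalfModel k => κ (z.fst / c) * (η₀ : ℝ≥0∞) := by
              have h1 : Continuous fun z : HalfModel k => z.fst := by fun_prop
              exact (hκcm.comp h1.measurable).mul_const _
            rw [lintegral_add_right _ hm, himΨ,
              setLIntegral_halfModel k hκcm.aemeasurable (b := fun _ => (η₀ : ℝ≥0∞))
              aemeasurable_const, hκc, setLIntegral_const]
        _ ≤ _ := by
            refine add_le_add ?_ (by rw [mul_left_comm])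
            refine (setLIntegral_image_le_of_lipschitzOnWith hΨ hAm (k + 1) _).trans_eq ?_
            congr 1
            refine setLIntegral_congr_fun hAm fun x hx => ?_
            simp only [hθΨ x hx]
            rfl
    calc ENNReal.ofReal ε * (κ' * I₀) ≤ ENNReal.ofReal ε * (κ' * (K ^ k * β)) := by gcongr
      _ = K ^ k * ENNReal.ofReal a * (ENNReal.ofReal c * κ' * β) := by rw [← hac]; ring
      _ ≤ K ^ k * ENNReal.ofReal a * (K ^ (k + 1) * (∫⁻ x in A, κ (w x / a / c) * g x
          ∂(Measure.euclideanHausdorffMeasure (k + 1))) +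
            η₀ * (ENNReal.ofReal c * κ' * volume B)) := by gcongr
      _ = K ^ (2 * k + 1) * (ENNReal.ofReal a * (∫⁻ x in A, κ (w x / a / c) * g x
          ∂(Measure.euclideanHausdorffMeasure (k + 1)))) +
            ENNReal.ofReal ε * (K ^ k * κ' * volume B * η₀) := by
          rw [← hac]; ring
      _ ≤ K ^ (2 * k + 1) * (K * tubeIntegral X w W k κ G ε) + ENNReal.ofReal ε * η := by
          refine add_le_add (mul_le_mul_right ?_ _) (mul_le_mul_right (le_trans ?_ hη₀C) _)
          · rw [hJ, ← lintegral_const_mul' _ _ ENNReal.ofReal_ne_top,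
              ← lintegral_const_mul' _ _ (by simp)]
            refine setLIntegral_mono' hAm fun x hx => ?_
            have h1 : ENNReal.ofReal a ≤ K * ENNReal.ofReal (W x) := by
              have := (hW x ⟨hx.1.1, hx.2.1⟩ hx.1.2.1).1
              calc ENNReal.ofReal a ≤ ENNReal.ofReal (K * W x) := ENNReal.ofReal_le_ofReal this
                _ = _ := by rw [ENNReal.ofReal_mul (by simp)]; simp
            calc ENNReal.ofReal a * (κ (w x / a / c) * g x)
                ≤ K * ENNReal.ofReal (W x) * (κ (w x / a / c) * g x) := by gcongr
              _ = _ := by ring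
          · have : k ≤ k + 2 := by omega
            gcongr
      _ = _ := by ring

theorem tubeIntegral_eq_sum {n k N : ℕ} {X : Set (Euc n)} {w W : Euc n → ℝ} {κ : ℝ → ℝ≥0∞}
    (hX : MeasurableSet X) (hw : ContinuousOn w X)
    (hW : AEMeasurable W ((Measure.euclideanHausdorffMeasure (k + 1)).restrict X))
    (hκm : Measurable κ) {G : Euc n → ℝ} (hG : Continuous G) (hG0 : ∀ x, 0 ≤ G x)
    {χ : Fin N → C(Euc n, ℝ)} (hχ0 : ∀ i x, 0 ≤ χ i x) {ε : ℝ}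
    (hsum : ∀ x ∈ X, 0 ≤ w x → G x ≠ 0 → κ (w x / ε) ≠ 0 → ∑ i, χ i x = 1) :
    tubeIntegral X w W k κ G ε = ∑ i, tubeIntegral X w W k κ (fun x => G x * χ i x) ε := by
  have hset : MeasurableSet {x ∈ X | 0 ≤ w x} :=
    measurableSet_sep_of_continuousOn hX hw measurableSet_Ici
  have hle : (Measure.euclideanHausdorffMeasure (k + 1) : Measure (Euc n)).restrict
      {x ∈ X | 0 ≤ w x} ≤ (Measure.euclideanHausdorffMeasure (k + 1)).restrict X :=
    Measure.restrict_mono (sep_subset _ _) le_rfl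
  have hwm : AEMeasurable w ((Measure.euclideanHausdorffMeasure (k + 1)).restrict
      {x ∈ X | 0 ≤ w x}) := (hw.mono (sep_subset _ _)).aemeasurable hset
  simp only [tubeIntegral]
  rw [← lintegral_finsetSum']
  · refine setLIntegral_congr_fun hset fun x hx => ?_
    by_cases hGx : G x = 0
    · simp [hGx]
    by_cases hκx : κ (w x / ε) = 0
    · simp [hκx]
    rw [← Finset.mul_sum, ← Finset.mul_sum, ← ENNReal.ofReal_sum_of_nonneg
      (fun i _ => mul_nonneg (hG0 x) (hχ0 i x)), ← Finset.mul_sum, hsum x hx.1 hx.2 hGx hκx,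
      mul_one]
  · intro i _
    refine (hκm.comp_aemeasurable (hwm.div_const ε)).mul ((hW.mono_measure hle).ennreal_ofReal.mul ?_)
    have hm : Measurable fun x => G x * χ i x := (hG.mul (χ i).continuous).measurable
    exact hm.ennreal_ofReal.aemeasurable

/-- On the compact part of `{w ≥ 0}` outside `O` the function `w` has a positive minimum; any
smaller `ε` works. -/
theorem eventually_mem_of_isCompact {n : ℕ} {C O : Set (Euc n)} {w : Euc n → ℝ}
    (hC : IsCompact C) (hw : ContinuousOn w C) (hO : IsOpen O)
    (h0 : ∀ x ∈ C, w x = 0 → x ∈ O) :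
    ∀ᶠ ε in 𝓝[>] (0 : ℝ), ∀ x ∈ C, 0 ≤ w x → w x ≤ ε → x ∈ O := by
  have hC' : IsCompact ((C ∩ w ⁻¹' Ici 0) \ O) :=
    (hC.of_isClosed_subset (hw.preimage_isClosed_of_isClosed hC.isClosed isClosed_Ici)
      inter_subset_left).diff hO
  rcases ((C ∩ w ⁻¹' Ici 0) \ O).eq_empty_or_nonempty with he | hne
  · refine Eventually.of_forall fun ε x hx hx0 _ => ?_
    by_contra hxO
    exact (he ▸ ⟨⟨hx, hx0⟩, hxO⟩ : x ∈ (∅ : Set (Euc n)))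
  · obtain ⟨y, hy, hmin⟩ := hC'.exists_isMinOn hne
      (hw.mono (sdiff_subset.trans inter_subset_left))
    have hy0 : 0 < w y := lt_of_le_of_ne hy.1.2 fun h => hy.2 (h0 y hy.1.1 h.symm)
    filter_upwards [nhdsWithin_le_nhds (gt_mem_nhds hy0)] with ε hε x hx hx0 hxε
    by_contra hxO
    exact absurd (hmin ⟨⟨hx, hx0⟩, hxO⟩) (not_le.2 (lt_of_le_of_lt hxε hε))

/-- A partition of unity globalises the local estimates: finitely many charts cover the compact zero
set in the support of `G`, and thin tubes stay where the partition sums to one. -/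
theorem tubeIntegral_estimates {n k : ℕ} {X : Set (Euc n)} {w W : Euc n → ℝ} {κ : ℝ → ℝ≥0∞}
    (hX : MeasurableSet X) (hw : ContinuousOn w X)
    (hW : AEMeasurable W ((Measure.euclideanHausdorffMeasure (k + 1)).restrict X))
    (hκm : Measurable κ) (hκ : ∀ t ∉ Icc (0 : ℝ) 1, κ t = 0) (hκt : ∫⁻ t, κ t ≠ ⊤)
    {G : Euc n → ℝ} (hG : Continuous G) (hG0 : ∀ x, 0 ≤ G x)
    (hXG : IsCompact (X ∩ tsupport G)) {K : NNReal} (hK : 1 ≤ K)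
    (hchart : ∀ p ∈ X ∩ tsupport G, w p = 0 → HasTubeChart X w W k K p) :
    ∫⁻ x in {x ∈ X | w x = 0}, ENNReal.ofReal (G x) ∂(Measure.euclideanHausdorffMeasure k) ≠ ⊤ ∧
      ∀ η : ℝ≥0∞, η ≠ 0 → ∀ᶠ ε in 𝓝[>] (0 : ℝ),
        tubeIntegral X w W k κ G ε ≤ ENNReal.ofReal ε * (K ^ (2 * k + 2) * ((∫⁻ t, κ t) *
          ∫⁻ x in {x ∈ X | w x = 0}, ENNReal.ofReal (G x)
            ∂(Measure.euclideanHausdorffMeasure k)) + η) ∧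
        ENNReal.ofReal ε * ((∫⁻ t, κ t) * ∫⁻ x in {x ∈ X | w x = 0}, ENNReal.ofReal (G x)
            ∂(Measure.euclideanHausdorffMeasure k)) ≤
          K ^ (2 * k + 2) * tubeIntegral X w W k κ G ε + ENNReal.ofReal ε * η := by
  set C := X ∩ tsupport G with hC
  have hwC : ContinuousOn w C := hw.mono inter_subset_left
  set S₀ := C ∩ w ⁻¹' {0} with hS₀
  have hS₀c : IsCompact S₀ := hXG.of_isClosed_subset
    (hwC.preimage_isClosed_of_isClosed hXG.isClosed isClosed_singleton) inter_subset_left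
  have hex : ∀ p : S₀, _ := fun p => (hchart p p.2.1 p.2.2).exists_estimates hK hX hw hκm hκ hκt
  choose U hUo hpU hU using hex
  obtain ⟨t, ht⟩ := hS₀c.elim_finite_subcover U hUo fun p hp => mem_iUnion.2 ⟨⟨p, hp⟩, hpU _⟩
  set N := t.card
  set e := t.equivFin
  have hcov : S₀ ⊆ ⋃ i : Fin N, U (e.symm i) := fun x hx => by
    obtain ⟨p, hp, hxp⟩ := mem_iUnion₂.1 (ht hx)
    exact mem_iUnion.2 ⟨e ⟨p, hp⟩, by simpa using hxp⟩
  -- The partition must sum to one on a neighbourhood of the zero set, since the tube has positive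
  -- thickness.
  obtain ⟨L, hLc, hSL, hLU⟩ := exists_compact_between hS₀c
    (isOpen_iUnion fun i : Fin N => hUo (e.symm i)) hcov
  obtain ⟨χ, hχs, hχ1, hχ0, hχc⟩ := exists_continuous_sum_one_of_isOpen_isCompact
    (fun i : Fin N => hUo (e.symm i)) hLc hLU
  have hχ1' : ∀ x ∈ L, ∑ i, χ i x = 1 := fun x hx => by simpa using hχ1 hx
  have hGi := fun i : Fin N => hU (e.symm i) (fun x => G x * χ i x) (hG.mul (χ i).continuous)
    ((hχc i).mul_left (f := G)) ((tsupport_mul_subset_right (f := G)).trans (hχs i))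
  have hI : ∫⁻ x in {x ∈ X | w x = 0}, ENNReal.ofReal (G x)
        ∂(Measure.euclideanHausdorffMeasure k) =
      ∑ i, ∫⁻ x in {x ∈ X | w x = 0}, ENNReal.ofReal (G x * χ i x)
        ∂(Measure.euclideanHausdorffMeasure k) := by
    have hm : ∀ i, Measurable fun x => ENNReal.ofReal (G x * χ i x) := fun i =>
      Measurable.ennreal_ofReal (hG.mul (χ i).continuous).measurable
    rw [← lintegral_finsetSum _ fun i _ => hm i]
    refine setLIntegral_congr_fun
      (measurableSet_sep_of_continuousOn hX hw (measurableSet_singleton (0 : ℝ))) fun x hx => ?_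
    rw [← ENNReal.ofReal_sum_of_nonneg (fun i _ => mul_nonneg (hG0 x) (hχ0 i x).1),
      ← Finset.mul_sum]
    by_cases hxG : x ∈ tsupport G
    · rw [hχ1' x (interior_subset (hSL ⟨⟨hx.1, hxG⟩, hx.2⟩)), mul_one]
    · rw [image_eq_zero_of_notMem_tsupport hxG, zero_mul]
  refine ⟨hI ▸ ENNReal.sum_ne_top.2 fun i _ => (hGi i).1, fun η hη => ?_⟩
  have hη' : η / (N + 1) ≠ 0 := (ENNReal.div_pos hη (by simp)).ne'
  have hev := eventually_mem_of_isCompact hXG hwC isOpen_interior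
    fun x hx h0 => hSL ⟨hx, h0⟩
  have hNη : (N : ℝ≥0∞) * (η / (N + 1)) ≤ η := by
    rw [← mul_div_assoc, mul_comm, mul_div_assoc]
    refine mul_le_of_le_one_right' (ENNReal.div_le_of_le_mul ?_)
    rw [one_mul]
    exact le_self_add
  filter_upwards [hev, eventually_all.2 fun i => (hGi i).2 _ hη', self_mem_nhdsWithin]
    with ε hε hest hε0
  have hε0' : 0 < ε := hε0
  have hJ : tubeIntegral X w W k κ G ε =
      ∑ i, tubeIntegral X w W k κ (fun x => G x * χ i x) ε := by
    refine tubeIntegral_eq_sum hX hw hW hκm hG hG0 (fun i x => (hχ0 i x).1)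
      fun x hx hx0 hGx hκx => hχ1' x (interior_subset (hε x ⟨hx, subset_tsupport _ hGx⟩ hx0 ?_))
    by_contra hcon
    exact hκx (hκ _ fun hmem => hcon ((div_le_one hε0').1 hmem.2))
  rw [hJ, hI]
  constructor
  · calc _ ≤ ∑ i : Fin N, ENNReal.ofReal ε * (K ^ (2 * k + 2) * ((∫⁻ t, κ t) *
          ∫⁻ x in {x ∈ X | w x = 0}, ENNReal.ofReal (G x * χ i x)
            ∂(Measure.euclideanHausdorffMeasure k)) + η / (N + 1)) :=
          Finset.sum_le_sum fun i _ => (hest i).1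
      _ ≤ _ := by
          rw [← Finset.mul_sum, Finset.sum_add_distrib, ← Finset.mul_sum, ← Finset.mul_sum]
          gcongr
          simpa using hNη
  · calc _ = ∑ i : Fin N, ENNReal.ofReal ε * ((∫⁻ t, κ t) *
          ∫⁻ x in {x ∈ X | w x = 0}, ENNReal.ofReal (G x * χ i x)
            ∂(Measure.euclideanHausdorffMeasure k)) := by
          rw [← Finset.mul_sum, ← Finset.mul_sum]
      _ ≤ ∑ i : Fin N, (K ^ (2 * k + 2) * tubeIntegral X w W k κ (fun x => G x * χ i x) ε +
            ENNReal.ofReal ε * (η / (N + 1))) := Finset.sum_le_sum fun i _ => (hest i).2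
      _ ≤ _ := by
          rw [Finset.sum_add_distrib, ← Finset.mul_sum, ← Finset.mul_sum]
          gcongr
          simpa using hNη

/-- The tube formula: as `ε → 0`, the measures `ε⁻¹ κ(w/ε) W μHE[k+1]` on `{x ∈ X | 0 ≤ w x}`
converge to `μHE[k]` on `{x ∈ X | w x = 0}`, up to the factor `∫ κ`. -/
theorem tendsto_tubeIntegral {n k : ℕ} {X : Set (Euc n)} {w W : Euc n → ℝ} {κ : ℝ → ℝ≥0∞}
    (hX : MeasurableSet X) (hw : ContinuousOn w X)
    (hW : AEMeasurable W ((Measure.euclideanHausdorffMeasure (k + 1)).restrict X))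
    (hκm : Measurable κ) (hκ : ∀ t ∉ Icc (0 : ℝ) 1, κ t = 0) (hκt : ∫⁻ t, κ t ≠ ⊤)
    {G : Euc n → ℝ} (hG : Continuous G) (hG0 : ∀ x, 0 ≤ G x)
    (hXG : IsCompact (X ∩ tsupport G))
    (hchart : ∀ p ∈ X ∩ tsupport G, w p = 0 → ∀ K : NNReal, 1 < K → HasTubeChart X w W k K p) :
    ∫⁻ x in {x ∈ X | w x = 0}, ENNReal.ofReal (G x) ∂(Measure.euclideanHausdorffMeasure k) ≠ ⊤ ∧
    Tendsto (fun ε => tubeIntegral X w W k κ G ε / ENNReal.ofReal ε) (𝓝[>] 0)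
      (𝓝 ((∫⁻ t, κ t) * ∫⁻ x in {x ∈ X | w x = 0}, ENNReal.ofReal (G x)
            ∂(Measure.euclideanHausdorffMeasure k))) := by
  have hest := fun (K : NNReal) (hK : 1 < K) => tubeIntegral_estimates hX hw hW hκm hκ hκt hG hG0
    hXG hK.le fun p hp h0 => hchart p hp h0 K hK
  refine ⟨(hest 2 (by norm_num)).1, ?_⟩
  set I := (∫⁻ t, κ t) * ∫⁻ x in {x ∈ X | w x = 0}, ENNReal.ofReal (G x)
            ∂(Measure.euclideanHausdorffMeasure k) with hI
  have hIt : I ≠ ⊤ := ENNReal.mul_ne_top hκt (hest 2 (by norm_num)).1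
  set J := fun ε => tubeIntegral X w W k κ G ε / ENNReal.ofReal ε with hJ
  have hJε : ∀ ε : ℝ, 0 < ε → tubeIntegral X w W k κ G ε = ENNReal.ofReal ε * J ε := fun ε hε =>
    (ENNReal.mul_div_cancel (by simpa using hε) ENNReal.ofReal_ne_top).symm
  have hest' : ∀ K : NNReal, 1 < K → ∀ η : ℝ≥0∞, η ≠ 0 → ∀ᶠ ε in 𝓝[>] (0 : ℝ),
      J ε ≤ K ^ (2 * k + 2) * I + η ∧ I ≤ K ^ (2 * k + 2) * J ε + η := by
    intro K hK η hη
    filter_upwards [(hest K hK).2 η hη, self_mem_nhdsWithin] with ε hε hε0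
    have hε0' : 0 < ε := hε0
    have h1 : ENNReal.ofReal ε ≠ 0 := by simpa using hε0'
    rw [hJε ε hε0', mul_left_comm ((K : ℝ≥0∞) ^ _) (ENNReal.ofReal ε), ← mul_add] at hε
    exact ⟨(ENNReal.mul_le_mul_iff_right h1 ENNReal.ofReal_ne_top).1 hε.1,
      (ENNReal.mul_le_mul_iff_right h1 ENNReal.ofReal_ne_top).1 hε.2⟩
  -- The estimates are applied with `K = 1 + 1/(j+1)` and `η = 1/(j+1)`; letting `j → ∞` bounds the
  -- liminf and the limsup over `ε` by the same number.
  have hK1 : Tendsto (fun j : ℕ => (((1 + 1 / ((j : NNReal) + 1) : NNReal) : ℝ≥0∞)) ^ (2 * k + 2))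
      atTop (𝓝 1) := by
    have h1 : Tendsto (fun j : ℕ => (1 + 1 / ((j : NNReal) + 1) : NNReal)) atTop (𝓝 1) := by
      have := (tendsto_one_div_add_atTop_nhds_zero_nat (𝕜 := NNReal)).const_add 1
      simpa using this
    have := ENNReal.tendsto_coe.2 (h1.pow (2 * k + 2))
    simpa using this
  have hη0 : Tendsto (fun j : ℕ => ((1 / ((j : NNReal) + 1) : NNReal) : ℝ≥0∞)) atTop (𝓝 0) :=
    ENNReal.tendsto_coe.2 (tendsto_one_div_add_atTop_nhds_zero_nat (𝕜 := NNReal))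
  have hKj : ∀ j : ℕ, (1 : NNReal) < 1 + 1 / ((j : NNReal) + 1) := fun j =>
    lt_add_of_pos_right _ (by positivity)
  have hηj : ∀ j : ℕ, ((1 / ((j : NNReal) + 1) : NNReal) : ℝ≥0∞) ≠ 0 := fun j => by
    rw [Ne, ENNReal.coe_eq_zero]
    positivity
  refine tendsto_of_le_liminf_of_limsup_le ?_ ?_
  · have hlim := ENNReal.Tendsto.div (ENNReal.Tendsto.sub (tendsto_const_nhds (x := I)) hη0
      (Or.inl hIt)) (Or.inr one_ne_zero) hK1 (Or.inl ENNReal.one_ne_top)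
    rw [tsub_zero, div_one] at hlim
    refine le_of_tendsto' hlim fun j => le_liminf_of_le ?_ ?_
    · exact isCoboundedUnder_ge_of_le _ (x := ⊤) fun _ => le_top
    · filter_upwards [hest' _ (hKj j) _ (hηj j)] with ε hε
      refine ENNReal.div_le_of_le_mul ?_
      rw [tsub_le_iff_right, mul_comm]
      exact hε.2
  · have hlim := (ENNReal.Tendsto.mul_const (b := I) hK1 (Or.inl one_ne_zero)).add hη0
    rw [one_mul, add_zero] at hlim
    refine ge_of_tendsto' hlim fun j => limsup_le_of_le ?_ ?_
    · exact isCoboundedUnder_le_of_le _ (x := 0) fun _ => zero_le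
    · filter_upwards [hest' _ (hKj j) _ (hηj j)] with ε hε using hε.1

/-! ### Almost isometric charts -/

section Charts

variable {F : Type*} [NormedAddCommGroup F] [InnerProductSpace ℝ F] [FiniteDimensional ℝ F]

/-- A map whose derivative at `p` is a coisometry is complemented by a linear projection to an
almost isometric chart near `p`. -/
theorem exists_chart {n k : ℕ} (hn : Module.finrank ℝ F + k = n) {u : Euc n → F} {p : Euc n}
    {A : Euc n →L[ℝ] F} (hu : HasStrictFDerivAt u A p) {B : F → Euc n}
    (hAB : ∀ y, A (B y) = y) (hB : ∀ y v, inner ℝ (B y) v = inner ℝ y (A v))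
    {K : NNReal} (hK : 1 < K) {O : Set (Euc n)} (hO : O ∈ 𝓝 p) :
    ∃ (f : Euc n →L[ℝ] EuclideanSpace ℝ (Fin k)) (U : Set (Euc n)) (r : ℝ), IsOpen U ∧ p ∈ U ∧
      U ⊆ O ∧ 0 < r ∧
      (∀ x ∈ U, ∀ y ∈ U, dist x y ≤ K * √(dist (u x) (u y) ^ 2 + dist (f x) (f y) ^ 2) ∧
        √(dist (u x) (u y) ^ 2 + dist (f x) (f y) ^ 2) ≤ K * dist x y) ∧
      ∀ a ∈ Metric.ball (u p) r, ∀ b ∈ Metric.ball (f p) r, ∃ x ∈ U, u x = a ∧ f x = b := by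
  have hsurj : Function.Surjective (A : Euc n →ₗ[ℝ] F) := fun y => ⟨B y, hAB y⟩
  set T : Submodule ℝ (Euc n) := LinearMap.ker (A : Euc n →ₗ[ℝ] F) with hT
  have hTk : Module.finrank ℝ T = k := by
    have h1 := LinearMap.finrank_range_add_finrank_ker (A : Euc n →ₗ[ℝ] F)
    rw [LinearMap.range_eq_top.2 hsurj, finrank_top, finrank_euclideanSpace_fin] at h1
    have h2 : Module.finrank ℝ T = Module.finrank ℝ (LinearMap.ker (A : Euc n →ₗ[ℝ] F)) := rfl
    omega
  have hTm : ∀ v, v ∈ T ↔ A v = 0 := fun v => LinearMap.mem_ker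
  -- `f` is the orthogonal projection to the kernel of `A`, written in orthonormal coordinates.
  let ob : T ≃ₗᵢ[ℝ] EuclideanSpace ℝ (Fin k) :=
    ((stdOrthonormalBasis ℝ T).reindex (finCongr hTk)).repr
  let f : Euc n →L[ℝ] EuclideanSpace ℝ (Fin k) :=
    (ob.toContinuousLinearEquiv : T →L[ℝ] EuclideanSpace ℝ (Fin k)).comp T.orthogonalProjectionOnto
  have hf : ∀ v, ‖f v‖ = ‖T.orthogonalProjectionOnto v‖ := fun v => ob.norm_map _
  have hBA : ∀ v, v - B (A v) ∈ T := fun v => by rw [hTm, map_sub, hAB, sub_self]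
  have hBT : ∀ y, B y ∈ Tᗮ := fun y => by
    rw [Submodule.mem_orthogonal']
    intro v hv
    rw [hB, (hTm v).1 hv, inner_zero_right]
  have hnormB : ∀ y, ‖B y‖ ^ 2 = ‖y‖ ^ 2 := fun y => by
    rw [← real_inner_self_eq_norm_sq, hB, hAB, real_inner_self_eq_norm_sq]
  -- `B` is the adjoint of `A` and `A B = 1`, so `v = B (A v) + (v - B (A v))` is an orthogonal
  -- decomposition; thus `(A, f)` is a linear isometry.
  have hnorm : ∀ v, ‖A v‖ ^ 2 + ‖f v‖ ^ 2 = ‖v‖ ^ 2 := fun v => by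
    have h1 : (T.orthogonalProjectionOnto v : Euc n) = v - B (A v) :=
      Submodule.eq_starProjection_of_mem_orthogonal (hBA v) (by simpa using hBT (A v))
    have h2 : ‖f v‖ = ‖v - B (A v)‖ := by rw [hf, ← h1]; rfl
    have h3 : inner ℝ (B (A v)) (v - B (A v)) = 0 :=
      (Submodule.mem_orthogonal' _ _).1 (hBT _) _ (hBA v)
    have h4 : v = B (A v) + (v - B (A v)) := by abel
    conv_rhs => rw [h4]
    rw [h2, norm_add_sq_real, h3, hnormB]
    ring
  let e : F × EuclideanSpace ℝ (Fin k) →L[ℝ] WithLp 2 (F × EuclideanSpace ℝ (Fin k)) :=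
    (WithLp.prodContinuousLinearEquiv 2 ℝ F (EuclideanSpace ℝ (Fin k))).symm
  let L₀ : Euc n →L[ℝ] WithLp 2 (F × EuclideanSpace ℝ (Fin k)) :=
    e.comp (A.prod f)
  let Ψ : Euc n → WithLp 2 (F × EuclideanSpace ℝ (Fin k)) := fun x => WithLp.toLp 2 (u x, f x)
  have hΨ : HasStrictFDerivAt Ψ L₀ p :=
    (e.hasStrictFDerivAt (x := (u p, f p))).comp p
      (hu.prodMk f.hasStrictFDerivAt)
  have hL₀ : ∀ v, ‖L₀ v‖ = ‖v‖ := fun v => by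
    have h1 : L₀ v = WithLp.toLp 2 (A v, f v) := rfl
    rw [h1, WithLp.prod_norm_eq_of_L2]
    simp [hnorm v]
  let li : Euc n →ₗᵢ[ℝ] WithLp 2 (F × EuclideanSpace ℝ (Fin k)) := ⟨L₀, hL₀⟩
  have hfin : Module.finrank ℝ (Euc n) =
      Module.finrank ℝ (WithLp 2 (F × EuclideanSpace ℝ (Fin k))) := by
    rw [(WithLp.linearEquiv 2 ℝ (F × EuclideanSpace ℝ (Fin k))).finrank_eq]
    simp [hn]
  let Le := (li.toLinearIsometryEquiv hfin).toContinuousLinearEquiv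
  have hLe : (Le : Euc n →L[ℝ] WithLp 2 (F × EuclideanSpace ℝ (Fin k))) = L₀ := by
    ext v : 1
    rfl
  have hK0 : (0 : ℝ) < K := by positivity
  have hK1 : (1 : ℝ) < K := by exact_mod_cast hK
  -- An error of `1 - K⁻¹` relative to an isometry leaves the bounds `K⁻¹` below and `2 - K⁻¹ ≤ K`
  -- above.
  obtain ⟨s, hs, happ⟩ := hΨ.approximates_deriv_on_nhds (c := 1 - K⁻¹)
    (Or.inr (tsub_pos_of_lt (inv_lt_one_of_one_lt₀ hK)))
  have hc : ((1 - K⁻¹ : NNReal) : ℝ) = 1 - (K : ℝ)⁻¹ := by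
    rw [NNReal.coe_sub (inv_le_one_of_one_le₀ hK.le)]
    simp
  set U := interior (s ∩ O) with hU
  have hUn : U ∈ 𝓝 p := interior_mem_nhds.2 (inter_mem hs hO)
  have himg : Ψ '' U ∈ 𝓝 (Ψ p) := by
    have h1 : HasStrictFDerivAt Ψ (Le : Euc n →L[ℝ] _) p := hLe ▸ hΨ
    rw [← h1.map_nhds_eq_of_equiv]
    exact image_mem_map hUn
  obtain ⟨r, hr, hball⟩ := Metric.mem_nhds_iff.1 himg
  have hdist : ∀ (a a' : F) (b b' : EuclideanSpace ℝ (Fin k)),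
      dist (WithLp.toLp 2 (a, b) : WithLp 2 (F × EuclideanSpace ℝ (Fin k)))
        (WithLp.toLp 2 (a', b')) = √(dist a a' ^ 2 + dist b b' ^ 2) := fun a a' b b' => by
    rw [WithLp.prod_dist_eq_of_L2]
    rfl
  refine ⟨f, U, r / 2, isOpen_interior, mem_of_mem_nhds hUn,
    interior_subset.trans inter_subset_right, half_pos hr, fun x hx y hy => ?_,
    fun a ha b hb => ?_⟩
  · rw [← hdist]
    have h1 := happ x (interior_subset hx).1 y (interior_subset hy).1
    rw [hc] at h1
    have h2 : ‖L₀ (x - y)‖ = dist x y := by rw [hL₀, dist_eq_norm]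
    have h3 : ‖Ψ x - Ψ y‖ = dist (Ψ x) (Ψ y) := (dist_eq_norm _ _).symm
    have h4 := norm_sub_norm_le (Ψ x - Ψ y) (L₀ (x - y))
    have h5 := norm_sub_norm_le (L₀ (x - y)) (Ψ x - Ψ y)
    rw [norm_sub_rev (L₀ (x - y))] at h5
    rw [h2, h3] at h4 h5
    rw [← dist_eq_norm x y] at h1
    have hd := dist_nonneg (x := x) (y := y)
    change _ ≤ K * dist (Ψ x) (Ψ y) ∧ dist (Ψ x) (Ψ y) ≤ _
    have hKi : (K : ℝ) * (K : ℝ)⁻¹ = 1 := mul_inv_cancel₀ hK0.ne'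
    constructor
    · have h6 : (K : ℝ)⁻¹ * dist x y ≤ dist (Ψ x) (Ψ y) := by linarith
      calc dist x y = K * ((K : ℝ)⁻¹ * dist x y) := by rw [← mul_assoc, hKi, one_mul]
        _ ≤ _ := by gcongr
    · have h6 : dist (Ψ x) (Ψ y) ≤ (2 - (K : ℝ)⁻¹) * dist x y := by linarith
      refine h6.trans (mul_le_mul_of_nonneg_right ?_ hd)
      have h7 : 0 ≤ (K - 1) * (1 - (K : ℝ)⁻¹) :=
        mul_nonneg (by linarith) (sub_nonneg.2 (inv_le_one_of_one_le₀ hK1.le))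
      have h8 : (K - 1) * (1 - (K : ℝ)⁻¹) = K + (K : ℝ)⁻¹ - 2 := by
        linear_combination -hKi
      linarith
  · have hmem : (WithLp.toLp 2 (a, b) : WithLp 2 (F × EuclideanSpace ℝ (Fin k))) ∈
        Metric.ball (Ψ p) r := by
      rw [Metric.mem_ball] at ha hb ⊢
      rw [hdist, Real.sqrt_lt' hr]
      nlinarith [dist_nonneg (x := a) (y := u p), dist_nonneg (x := b) (y := f p)]
    obtain ⟨x, hxU, hx⟩ := hball hmem
    have hx' : (u x, f x) = (a, b) := congrArg WithLp.ofLp hx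
    exact ⟨x, hxU, (Prod.mk.inj hx').1, (Prod.mk.inj hx').2⟩

end Charts

theorem hasStrictFDerivAt_norm {n : ℕ} {p : Euc n} (hp : p ≠ 0) :
    HasStrictFDerivAt (fun x : Euc n => ‖x‖) (innerSL ℝ (‖p‖⁻¹ • p)) p := by
  have hp' : ‖p‖ ≠ 0 := norm_ne_zero_iff.2 hp
  have h := (hasStrictFDerivAt_norm_sq p).sqrt (by positivity)
  simp only [Real.sqrt_sq (norm_nonneg _)] at h
  have h2 : innerSL ℝ (‖p‖⁻¹ • p) = (1 / (2 * ‖p‖)) • 2 • innerSL ℝ p :=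
    ContinuousLinearMap.ext fun v => by
      simp
      field_simp
  rw [h2]
  exact h

/-- The tube chart for the zero set of a submersion. -/
theorem hasTubeChart_of_submersion {n k : ℕ} (hn : n = k + 1) {Φ W : Euc n → ℝ} {p N : Euc n}
    (hΦ : HasStrictFDerivAt Φ (innerSL ℝ N) p) (hN : N ≠ 0) (hp : Φ p = 0) {V : Set (Euc n)}
    (hV : V ∈ 𝓝 p) (hW : ContinuousAt W p) (hWp : W p = ‖N‖) {K : NNReal} (hK : 1 < K) :
    HasTubeChart V Φ W k K p := by
  have ha : 0 < ‖N‖ := norm_pos_iff.2 hN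
  have hK0 : (0 : ℝ) < K := by positivity
  have hK1 : (1 : ℝ) < K := by exact_mod_cast hK
  have hO : V ∩ {x | ‖N‖ < K * W x ∧ W x < K * ‖N‖} ∈ 𝓝 p := by
    refine inter_mem hV ?_
    have h1 : ∀ᶠ x in 𝓝 p, ‖N‖ < K * W x :=
      (hW.const_mul _).eventually (lt_mem_nhds (by simp only [hWp]; nlinarith))
    have h2 : ∀ᶠ x in 𝓝 p, W x < K * ‖N‖ := hW.eventually (gt_mem_nhds (by rw [hWp]; nlinarith))
    filter_upwards [h1, h2] with x h1 h2 using ⟨h1, h2⟩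
  have hu : HasStrictFDerivAt (fun x => Φ x / ‖N‖) (‖N‖⁻¹ • innerSL ℝ N) p := by
    have := hΦ.const_mul ‖N‖⁻¹
    simpa only [div_eq_inv_mul] using this
  obtain ⟨f, U, r, hU, hpU, hUO, hr, hL, hs⟩ := exists_chart (F := ℝ) (k := k)
    (by simp [hn, add_comm]) hu (B := fun y => (y * ‖N‖⁻¹) • N)
    (fun y => by simp; field_simp)
    (fun y v => by simp [inner_smul_left]; ring) hK hO
  refine ⟨U, f, ‖N‖, r, hU, hpU, f.continuous.continuousOn, ha, hr,
    fun x hx _ => ⟨(hUO hx.2).2.1.le, (hUO hx.2).2.2.le⟩, fun x hx y hy _ _ => ?_,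
    fun y hy s hs' => ?_⟩
  · rw [dist_halfModel]
    have := hL x hx.2 y hy.2
    simpa only [Real.dist_eq (Φ x / ‖N‖), sq_abs] using this
  · obtain ⟨x, hx, h1, h2⟩ := hs s (by
      rw [hp, zero_div, Metric.mem_ball, Real.dist_eq, sub_zero, abs_of_nonneg hs'.1]
      exact hs'.2) y hy
    refine ⟨x, ⟨(hUO hx).1, hx⟩, h2, ?_⟩
    rw [← h1, mul_div_cancel₀ _ ha.ne']

/-- The tube chart along the boundary of a hypersurface that meets the sphere of radius `R`
orthogonally. -/
theorem hasTubeChart_boundary {n k : ℕ} (hn : n = k + 2) {S : Set (Euc n)} {Φ W : Euc n → ℝ}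
    {p N : Euc n} {R : ℝ} (hR : 0 < R) (hpR : ‖p‖ = R)
    (hΦ : HasStrictFDerivAt Φ (innerSL ℝ N) p) (hN : N ≠ 0) (hp : Φ p = 0) (hNp : inner ℝ N p = 0)
    (hS : ∀ᶠ x in 𝓝 p, x ∈ S ↔ Φ x = 0 ∧ R ≤ ‖x‖) {K : NNReal} (hK : 1 < K)
    (hW : ∀ᶠ x in 𝓝 p, x ∈ S → 1 ≤ K * W x ∧ W x ≤ K) :
    HasTubeChart S (fun x => ‖x‖ - R) W k K p := by
  have ha : 0 < ‖N‖ := norm_pos_iff.2 hN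
  have hp0 : p ≠ 0 := norm_pos_iff.1 (hpR ▸ hR)
  let e : ℝ × ℝ →L[ℝ] WithLp 2 (ℝ × ℝ) := (WithLp.prodContinuousLinearEquiv 2 ℝ ℝ ℝ).symm
  have hu1 : HasStrictFDerivAt (fun x : Euc n => ‖x‖ - R) (innerSL ℝ (‖p‖⁻¹ • p)) p :=
    (hasStrictFDerivAt_norm hp0).sub_const R
  have hu2 : HasStrictFDerivAt (fun x => Φ x / ‖N‖) (‖N‖⁻¹ • innerSL ℝ N) p := by
    have := hΦ.const_mul ‖N‖⁻¹
    simpa only [div_eq_inv_mul] using this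
  have hu : HasStrictFDerivAt
      (fun x => (WithLp.toLp 2 (‖x‖ - R, Φ x / ‖N‖) : WithLp 2 (ℝ × ℝ)))
      (e.comp ((innerSL ℝ (‖p‖⁻¹ • p)).prod (‖N‖⁻¹ • innerSL ℝ N))) p :=
    (e.hasStrictFDerivAt (x := (‖p‖ - R, Φ p / ‖N‖))).comp p (hu1.prodMk hu2)
  have hpN : inner ℝ p N = 0 := by rw [real_inner_comm]; exact hNp
  -- The two unit covectors `p/‖p‖` and `N/‖N‖` are orthogonal because the hypersurface contains the
  -- radial direction, so the pair `(‖x‖ - R, Φ/‖N‖)` has a coisometry as derivative. On `S` the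
  -- second coordinate vanishes, which leaves a chart with height `‖x‖ - R`.
  obtain ⟨f, U, r, hU, hpU, hUO, hr, hL, hs⟩ := exists_chart (F := WithLp 2 (ℝ × ℝ)) (k := k)
    (by rw [(WithLp.linearEquiv 2 ℝ (ℝ × ℝ)).finrank_eq]; simp [hn, add_comm]) hu
    (B := fun y => y.fst • (‖p‖⁻¹ • p) + (y.snd * ‖N‖⁻¹) • N)
    (fun y => by
      have h1 : ‖p‖ ≠ 0 := norm_ne_zero_iff.2 hp0
      have h2 : inner ℝ (‖p‖⁻¹ • p) (y.fst • (‖p‖⁻¹ • p) + (y.snd * ‖N‖⁻¹) • N) = y.fst := by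
        simp only [inner_add_right, inner_smul_left, inner_smul_right, real_inner_self_eq_norm_sq,
          hpN, conj_trivial]
        field_simp
        ring
      have h3 : ‖N‖⁻¹ * inner ℝ N (y.fst • (‖p‖⁻¹ • p) + (y.snd * ‖N‖⁻¹) • N) = y.snd := by
        simp only [inner_add_right, inner_smul_right, real_inner_self_eq_norm_sq, hNp]
        field_simp
        ring
      change WithLp.toLp 2 (inner ℝ (‖p‖⁻¹ • p) (y.fst • (‖p‖⁻¹ • p) + (y.snd * ‖N‖⁻¹) • N),
        ‖N‖⁻¹ * inner ℝ N (y.fst • (‖p‖⁻¹ • p) + (y.snd * ‖N‖⁻¹) • N)) = y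
      rw [h2, h3]
      rfl)
    (fun y v => by
      change _ = inner ℝ y (WithLp.toLp 2 (inner ℝ (‖p‖⁻¹ • p) v, ‖N‖⁻¹ * inner ℝ N v))
      rw [WithLp.prod_inner_apply]
      simp only [inner_add_left, inner_smul_left, conj_trivial, RCLike.inner_apply]
      change _ = ‖p‖⁻¹ * inner ℝ p v * y.fst + ‖N‖⁻¹ * inner ℝ N v * y.snd
      ring) hK (hS.and hW)
  refine ⟨U, f, 1, r, hU, hpU, f.continuous.continuousOn, one_pos, hr,
    fun x hx _ => ?_, fun x hx y hy _ _ => ?_, fun y hy s hs' => ?_⟩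
  · have := (hUO hx.2).2 hx.1
    exact ⟨this.1, by simpa using this.2⟩
  · rw [dist_halfModel]
    have h1 := ((hUO hx.2).1.1 hx.1).1
    have h2 := ((hUO hy.2).1.1 hy.1).1
    have := hL x hx.2 y hy.2
    simp only [h1, h2, WithLp.prod_dist_eq_of_L2] at this
    simpa [Real.dist_eq, sq_abs, Real.sqrt_sq_eq_abs] using this
  · obtain ⟨x, hx, h1, h2⟩ := hs (WithLp.toLp 2 (s, 0)) (by
      rw [Metric.mem_ball, WithLp.prod_dist_eq_of_L2]
      simpa [hp, hpR, Real.dist_eq, Real.sqrt_sq_eq_abs, abs_of_nonneg hs'.1] using hs'.2) y hy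
    have h3 : (‖x‖ - R, Φ x / ‖N‖) = (s, 0) := congrArg WithLp.ofLp h1
    obtain ⟨h4, h5⟩ := Prod.mk.inj h3
    have h6 : Φ x = 0 := (div_eq_zero_iff.1 h5).resolve_right ha.ne'
    refine ⟨x, ⟨(hUO hx).1.2 ⟨h6, ?_⟩, hx⟩, h2, by rw [one_mul]; exact h4⟩
    linarith [hs'.1]

/-! ### Local structure of submanifolds -/

/-- Along `S` the function is constant, so zero is also a derivative within `S`; two derivatives
within `S` agree on the tangent cone. -/
theorem apply_eq_zero_of_mem_tangentSpaceAt {n : ℕ} {F : Type*} [NormedAddCommGroup F]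
    [NormedSpace ℝ F] {S : Set (Euc n)} {p : Euc n} {Φ : Euc n → F} {A : Euc n →L[ℝ] F}
    (hΦ : HasFDerivAt Φ A p) {c : F} (hp : Φ p = c) (hc : ∀ᶠ x in 𝓝[S] p, Φ x = c) {v : Euc n}
    (hv : v ∈ tangentSpaceAt S p) : A v = 0 := by
  have h1 : HasFDerivWithinAt Φ (0 : Euc n →L[ℝ] F) S p :=
    (hasFDerivWithinAt_const c p S).congr_of_eventuallyEq hc hp
  have h2 : tangentConeAt ℝ S p ⊆ LinearMap.ker (A : Euc n →ₗ[ℝ] F) := fun w hw =>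
    hΦ.hasFDerivWithinAt.unique_on h1 hw
  exact Submodule.span_le.2 h2 hv

/-- The implicit function theorem provides a curve in the zero set with velocity `v`, and its
difference quotients exhibit `v` in the tangent cone. -/
theorem mem_tangentSpaceAt_of_apply_eq_zero {n : ℕ} {F : Type*} [NormedAddCommGroup F]
    [NormedSpace ℝ F] [FiniteDimensional ℝ F] {S : Set (Euc n)} {p : Euc n} {Φ : Euc n → F}
    {A : Euc n →L[ℝ] F} (hΦ : HasStrictFDerivAt Φ A p) (hA : Function.Surjective A) (hp : Φ p = 0)
    (hS : ∀ᶠ x in 𝓝 p, Φ x = 0 → x ∈ S) {v : Euc n} (hv : A v = 0) :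
    v ∈ tangentSpaceAt S p := by
  have hr : LinearMap.range (A : Euc n →ₗ[ℝ] F) = ⊤ := LinearMap.range_eq_top.2 hA
  have hφ := hΦ.to_implicitFunction hr
  have hφ0 := hΦ.implicitFunction_apply_image hr
  set φ := hΦ.implicitFunction Φ A hr (Φ p)
  have hmap : ∀ᶠ z in 𝓝 (0 : LinearMap.ker (A : Euc n →ₗ[ℝ] F)), Φ (φ z) = Φ p :=
    ((Continuous.prodMk_right (Φ p)).tendsto 0).eventually (hΦ.map_implicitFunction_eq hr)
  let v' : LinearMap.ker (A : Euc n →ₗ[ℝ] F) := ⟨v, hv⟩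
  have hline : HasDerivAt (fun s : ℝ => s • v') v' 0 := by
    simpa using (hasDerivAt_id (0 : ℝ)).smul_const v'
  have hφ' : HasFDerivAt φ (LinearMap.ker (A : Euc n →ₗ[ℝ] F)).subtypeL ((0 : ℝ) • v') := by
    simpa using hφ.hasFDerivAt
  have hd : HasDerivAt (fun s : ℝ => φ (s • v')) v 0 := by
    have h := hφ'.comp_hasDerivAt (0 : ℝ) hline
    exact h
  have hcont : Tendsto (fun s : ℝ => s • v') (𝓝[≠] 0) (𝓝 0) := by
    simpa using hline.continuousAt.tendsto.mono_left nhdsWithin_le_nhds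
  have hcont2 : Tendsto (fun s : ℝ => φ (s • v')) (𝓝[≠] 0) (𝓝 p) := by
    have h := hd.continuousAt.tendsto.mono_left (nhdsWithin_le_nhds (s := {0}ᶜ))
    rwa [zero_smul, hφ0] at h
  refine Submodule.subset_span (mem_tangentConeAt_of_seq (𝓝[≠] (0 : ℝ)) (fun s => s⁻¹)
    (fun s => φ (s • v') - p) ?_ ?_ ?_)
  · simpa using hcont2.sub_const p
  · filter_upwards [hcont2.eventually hS, hcont.eventually hmap] with s h1 h2
    rw [add_sub_cancel]
    exact h1 (h2.trans hp)
  · have := hd.tendsto_slope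
    refine this.congr fun s => ?_
    simp [slope, hφ0]

/-- If a hypersurface with boundary lies outside the ball of radius `R`, has its boundary on the
sphere, and the position vector at `p` is tangent, then near `p` it is the part outside the ball of
a hypersurface without boundary. -/
theorem eventually_mem_iff_of_boundary {n : ℕ} {S : Set (Euc n)} {p : Euc n} {Φ w : Euc n → ℝ}
    {A₁ A₂ : Euc n →L[ℝ] ℝ} {R : ℝ} (hR : 0 < R) (hpR : ‖p‖ = R) (hΦ : HasStrictFDerivAt Φ A₁ p)
    (hw : HasStrictFDerivAt w A₂ p) (hsurj : Function.Surjective fun v => (A₁ v, A₂ v))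
    (hΦp : Φ p = 0) (hwp : w p = 0)
    (hS : ∀ᶠ x in 𝓝 p, x ∈ S ↔ Φ x = 0 ∧ 0 ≤ w x) (hSR : ∀ x ∈ S, R ≤ ‖x‖)
    (hbd : ∀ᶠ x in 𝓝 p, Φ x = 0 → w x = 0 → ‖x‖ = R) (hAp : A₁ p = 0) :
    ∀ᶠ x in 𝓝 p, x ∈ S ↔ Φ x = 0 ∧ R ≤ ‖x‖ := by
  set A : Euc n →L[ℝ] ℝ × ℝ := A₁.prod A₂ with hA
  set T : Submodule ℝ (Euc n) := LinearMap.ker (A : Euc n →ₗ[ℝ] ℝ × ℝ) with hT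
  have hcompl : IsCompl (LinearMap.ker (A : Euc n →ₗ[ℝ] ℝ × ℝ))
      (LinearMap.ker (T.orthogonalProjectionOnto : Euc n →ₗ[ℝ] T)) := by
    have h := T.isCompl_orthogonal
    convert h using 1
    exact Submodule.ker_orthogonalProjectionOnto
  let Le : Euc n ≃L[ℝ] (ℝ × ℝ) × T := A.equivProdOfSurjectiveOfIsCompl T.orthogonalProjectionOnto
    (LinearMap.range_eq_top.2 hsurj) 
    (LinearMap.range_eq_top.2 fun t => ⟨t, T.orthogonalProjectionOnto_mem_subspace_eq_self t⟩)
    hcompl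
  have hLe : ∀ v, Le v = ((A₁ v, A₂ v), T.orthogonalProjectionOnto v) := fun v => rfl
  let Ψ : Euc n → (ℝ × ℝ) × T := fun x => ((Φ x, w x), T.orthogonalProjectionOnto x)
  have hΨ : HasStrictFDerivAt Ψ (Le : Euc n →L[ℝ] (ℝ × ℝ) × T) p :=
    (hΦ.prodMk hw).prodMk T.orthogonalProjectionOnto.hasStrictFDerivAt
  -- In the coordinates `(Φ, w, projection to T)` the comparison of `w` with `‖x‖ - R` becomes a
  -- statement about `Q = ‖x‖²` on the slice `Φ = 0`.
  set g := hΨ.localInverse Ψ Le p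
  have hg := hΨ.to_localInverse
  have hgp : g (Ψ p) = p := hΨ.localInverse_apply_image
  have hgc : Tendsto g (𝓝 (Ψ p)) (𝓝 p) := hΨ.localInverse_tendsto
  set Q : (ℝ × ℝ) × T → ℝ := fun z => ‖g z‖ ^ 2 with hQdef
  set ℓ : (ℝ × ℝ) × T →L[ℝ] ℝ := (2 • innerSL ℝ p).comp (Le.symm : (ℝ × ℝ) × T →L[ℝ] Euc n)
    with hℓ
  have hQ : HasStrictFDerivAt Q ℓ (Ψ p) := by
    have h1 := hasStrictFDerivAt_norm_sq (g (Ψ p))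
    rw [hgp] at h1
    have h2 : HasStrictFDerivAt (fun x : Euc n => ‖x‖ ^ 2) (2 • innerSL ℝ p) (g (Ψ p)) := by
      rw [hgp]; exact h1
    exact h2.comp (Ψ p) hg
  have hright : ∀ᶠ z in 𝓝 (Ψ p), Ψ (g z) = z := hΨ.eventually_right_inverse
  have hleft : ∀ᶠ x in 𝓝 p, g (Ψ x) = x := hΨ.eventually_left_inverse
  have hΨp : Ψ p = (0, T.orthogonalProjectionOnto p) := by
    simp only [Ψ, hΦp, hwp]
    rfl
  have ha : ∀ᶠ z in 𝓝 (Ψ p), z.1 = 0 → Q z = R ^ 2 := by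
    filter_upwards [hright, hgc.eventually hbd] with z h1 h2 hz
    have h3 : (Φ (g z), w (g z)) = 0 := (congrArg Prod.fst h1).trans hz
    simp only [hQdef, h2 (congrArg Prod.fst h3) (congrArg Prod.snd h3)]
  have hb : ∀ᶠ z in 𝓝 (Ψ p), z.1.1 = 0 → 0 ≤ z.1.2 → R ^ 2 ≤ Q z := by
    filter_upwards [hright, hgc.eventually hS] with z h1 h2 hz hz'
    have h3 : (Φ (g z), w (g z)) = z.1 := congrArg Prod.fst h1
    have h4 : R ≤ ‖g z‖ := hSR _ (h2.2 ⟨(congrArg Prod.fst h3).trans hz,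
      hz'.trans_eq (congrArg Prod.snd h3).symm⟩)
    simp only [hQdef]
    gcongr
  have hline : ∀ v : (ℝ × ℝ) × T, Tendsto (fun s : ℝ => Ψ p + s • v) (𝓝 0) (𝓝 (Ψ p)) :=
    fun v => by
      have : Continuous fun s : ℝ => Ψ p + s • v := by fun_prop
      exact this.tendsto' 0 _ (by simp)
  -- `Q` is constantly `R²` on `{Φ = w = 0}`.
  have hℓT : ∀ t : T, ℓ (0, t) = 0 := by
    intro t
    have h1 : HasDerivAt (fun s : ℝ => Ψ p + s • ((0, t) : (ℝ × ℝ) × T)) (0, t) 0 := by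
      simpa using ((hasDerivAt_id (0 : ℝ)).smul_const ((0, t) : (ℝ × ℝ) × T)).const_add (Ψ p)
    have h2 : HasFDerivAt Q ℓ (Ψ p + (0 : ℝ) • ((0, t) : (ℝ × ℝ) × T)) := by
      simpa using hQ.hasFDerivAt
    have h3 := h2.comp_hasDerivAt (0 : ℝ) h1
    refine h3.unique ((hasDerivAt_const (0 : ℝ) (R ^ 2)).congr_of_eventuallyEq ?_)
    filter_upwards [(hline (0, t)).eventually ha] with s hs
    refine hs ?_
    rw [hΨp]
    simp
  set lam := ℓ ((0, 1), 0) with hlam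
  -- The radial derivative of `‖x‖²` at `p` is `2R²`, and `p` has no `Φ`-component; so all of it
  -- comes from the `w`-direction, and `lam ≠ 0`.
  have hlam1 : A₂ p * lam = 2 * R ^ 2 := by
    have h1 : Le p = A₂ p • (((0, 1), 0) : (ℝ × ℝ) × T) + (0, T.orthogonalProjectionOnto p) := by
      rw [hLe, hAp]
      ext <;> simp
    have h2 : ℓ (Le p) = 2 * R ^ 2 := by
      simp [hℓ, hpR]
    rw [h1, map_add, hℓT, map_smul, add_zero, smul_eq_mul] at h2
    exact h2
  have hlam0 : lam ≠ 0 := fun h => by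
    rw [h, mul_zero] at hlam1
    exact (by positivity : (2 * R ^ 2) ≠ 0) hlam1.symm
  -- With an error of half of `|lam|`, the difference `Q - R²` has the sign of `lam * w` on the
  -- slice.
  obtain ⟨s, hs, happ⟩ := hQ.approximates_deriv_on_nhds (c := ⟨|lam| / 2, by positivity⟩)
    (Or.inr (show (0 : ℝ) < |lam| / 2 by positivity))
  have hkey : ∀ᶠ z in 𝓝 (Ψ p), z.1.1 = 0 → |Q z - R ^ 2 - z.1.2 * lam| ≤ |lam| / 2 * |z.1.2| := by
    have hπ : Tendsto (fun z : (ℝ × ℝ) × T => ((0, z.2) : (ℝ × ℝ) × T)) (𝓝 (Ψ p)) (𝓝 (Ψ p)) := by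
      have : Continuous fun z : (ℝ × ℝ) × T => ((0, z.2) : (ℝ × ℝ) × T) := by fun_prop
      exact this.tendsto' _ _ (by rw [hΨp])
    filter_upwards [hs, hπ.eventually hs, hπ.eventually ha] with z h1 h2 h3 hz
    have h4 := happ z h1 (0, z.2) h2
    have h5 : z - (0, z.2) = z.1.2 • (((0, 1), 0) : (ℝ × ℝ) × T) := by
      ext <;> simp [hz]
    rw [h3 rfl, h5, map_smul, smul_eq_mul, norm_smul, Real.norm_eq_abs, Real.norm_eq_abs] at h4
    refine h4.trans_eq ?_
    simp only [Prod.norm_def, norm_zero, norm_one, zero_le_one, sup_of_le_right, sup_of_le_left,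
      mul_one]
    rfl
  -- Points of the slice with `w > 0` belong to `S`, hence lie outside the ball.
  have hpos : 0 < lam := by
    by_contra hneg
    have hneg' : lam < 0 := lt_of_le_of_ne (not_lt.1 hneg) hlam0
    have hl := (hline ((0, 1), 0)).mono_left (nhdsWithin_le_nhds (s := Ioi 0))
    obtain ⟨σ, h1, h2, hσ⟩ := ((hl.eventually hkey).and
      ((hl.eventually hb).and self_mem_nhdsWithin)).exists
    have hσ0 : 0 < σ := hσ
    have h3 : (Ψ p + σ • (((0, 1), 0) : (ℝ × ℝ) × T)).1 = (0, σ) := by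
      rw [hΨp]; simp
    rw [h3] at h1 h2
    have h4 := h1 rfl
    have h5 := h2 rfl hσ0.le
    rw [abs_le, abs_of_neg hneg', abs_of_pos hσ0] at h4
    nlinarith [h4.2, mul_neg_of_neg_of_pos hneg' hσ0]
  filter_upwards [hΨ.continuousAt.eventually hkey, hleft, hS] with x h1 h2 h3
  refine ⟨fun hx => ⟨(h3.1 hx).1, hSR x hx⟩, fun hx => h3.2 ⟨hx.1, ?_⟩⟩
  by_contra hneg
  have hneg' : w x < 0 := not_le.1 hneg
  have h4 := h1 hx.1
  simp only [hQdef, h2] at h4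
  change |‖x‖ ^ 2 - R ^ 2 - w x * lam| ≤ |lam| / 2 * |w x| at h4
  rw [abs_le, abs_of_pos hpos, abs_of_neg hneg'] at h4
  have h5 : R ^ 2 ≤ ‖x‖ ^ 2 := by gcongr; exact hx.2
  nlinarith [h4.2, mul_neg_of_neg_of_pos hneg' hpos]

theorem innerSL_gradient {n : ℕ} (Φ : Euc n → ℝ) (x : Euc n) :
    innerSL ℝ (gradient Φ x) = fderiv ℝ Φ x :=
  (InnerProductSpace.toDual ℝ (Euc n)).apply_symm_apply (fderiv ℝ Φ x)

theorem inner_gradient {n : ℕ} (Φ : Euc n → ℝ) (x v : Euc n) :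
    inner ℝ (gradient Φ x) v = fderiv ℝ Φ x v := by
  rw [← innerSL_gradient]
  rfl

theorem contDiffOn_gradient {n : ℕ} {Φ : Euc n → ℝ} {V : Set (Euc n)} (hV : IsOpen V)
    (hΦ : ContDiffOn ℝ ∞ Φ V) : ContDiffOn ℝ ∞ (gradient Φ) V :=
  (InnerProductSpace.toDual ℝ (Euc n)).symm.toContinuousLinearEquiv.contDiff.comp_contDiffOn
    (hΦ.fderiv_of_isOpen hV (by simp))

/-- `Φ` is a smooth defining function, with nonvanishing gradient on the open set `V`, of the
hypersurface `S` in the part of `V` outside the ball of radius `R`. -/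
structure IsDefining {n : ℕ} (R : ℝ) (S V : Set (Euc n)) (Φ : Euc n → ℝ) : Prop where
  isOpen : IsOpen V
  contDiffOn : ContDiffOn ℝ ∞ Φ V
  gradient_ne_zero : ∀ x ∈ V, gradient Φ x ≠ 0
  mem_iff : ∀ x ∈ V, x ∈ S ↔ Φ x = 0 ∧ R ≤ ‖x‖

namespace IsDefining

variable {n : ℕ} {R : ℝ} {S V : Set (Euc n)} {Φ : Euc n → ℝ}

theorem hasStrictFDerivAt (h : IsDefining R S V Φ) {x : Euc n} (hx : x ∈ V) :
    HasStrictFDerivAt Φ (innerSL ℝ (gradient Φ x)) x := by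
  rw [innerSL_gradient]
  exact (h.contDiffOn.contDiffAt (h.isOpen.mem_nhds hx)).hasStrictFDerivAt (by simp)

theorem inner_gradient_eq_zero (h : IsDefining R S V Φ) {x v : Euc n} (hx : x ∈ S) (hxV : x ∈ V)
    (hv : v ∈ tangentSpaceAt S x) : inner ℝ (gradient Φ x) v = 0 := by
  refine apply_eq_zero_of_mem_tangentSpaceAt (h.hasStrictFDerivAt hxV).hasFDerivAt
    ((h.mem_iff x hxV).1 hx).1 ?_ hv
  filter_upwards [self_mem_nhdsWithin, mem_nhdsWithin_of_mem_nhds (h.isOpen.mem_nhds hxV)]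
    with y hy hyV using ((h.mem_iff y hyV).1 hy).1

theorem mem_tangentSpaceAt (h : IsDefining R S V Φ) {x v : Euc n} (hx : x ∈ S) (hxV : x ∈ V)
    (hxR : R < ‖x‖) (hv : inner ℝ (gradient Φ x) v = 0) : v ∈ tangentSpaceAt S x := by
  refine mem_tangentSpaceAt_of_apply_eq_zero (h.hasStrictFDerivAt hxV) (fun c => ?_)
    ((h.mem_iff x hxV).1 hx).1 ?_ hv
  · have hN := norm_ne_zero_iff.2 (h.gradient_ne_zero x hxV)
    refine ⟨(c / ‖gradient Φ x‖ ^ 2) • gradient Φ x, ?_⟩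
    rw [innerSL_apply_apply, inner_smul_right, real_inner_self_eq_norm_sq]
    field_simp
  · have hR : ∀ᶠ y : Euc n in 𝓝 x, R < ‖y‖ := continuous_norm.continuousAt.eventually
      (lt_mem_nhds hxR)
    filter_upwards [h.isOpen.mem_nhds hxV, hR] with y hy hyR hy0
    exact (h.mem_iff y hy).2 ⟨hy0, hyR.le⟩

end IsDefining

/-- The component of the position vector that is tangent to `S`. -/
def tangentialPart {n : ℕ} (S : Set (Euc n)) (x : Euc n) : Euc n :=
  (tangentSpaceAt S x).starProjection x

/-- The normal line is spanned by the gradient. At points with `‖x‖ = R` the set is one-sided, and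
tangency of `x`, given by `hbd`, is all that the formula needs. -/
theorem IsDefining.tangentialPart_eq {n : ℕ} {R : ℝ} {S V : Set (Euc n)} {Φ : Euc n → ℝ}
    (h : IsDefining R S V Φ) {x : Euc n} (hx : x ∈ S) (hxV : x ∈ V)
    (hbd : ‖x‖ = R → x ∈ tangentSpaceAt S x) :
    tangentialPart S x =
      x - (inner ℝ (gradient Φ x) x / ‖gradient Φ x‖ ^ 2) • gradient Φ x := by
  rcases ((h.mem_iff x hxV).1 hx).2.eq_or_lt with hR | hR
  · have h1 := hbd hR.symm
    rw [h.inner_gradient_eq_zero hx hxV h1, tangentialPart,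
      Submodule.starProjection_eq_self_iff.2 h1]
    simp
  · have hN := norm_ne_zero_iff.2 (h.gradient_ne_zero x hxV)
    refine Submodule.eq_starProjection_of_mem_orthogonal (h.mem_tangentSpaceAt hx hxV hR ?_) ?_
    · rw [inner_sub_right, inner_smul_right, real_inner_self_eq_norm_sq]
      field_simp
      ring
    · rw [sub_sub_cancel]
      refine Submodule.smul_mem _ _ ((Submodule.mem_orthogonal' _ _).2 fun v hv => ?_)
      exact h.inner_gradient_eq_zero hx hxV hv

/-- If `B` is a right inverse of `A p`, then `A x ∘ B` is near the identity, hence invertible. -/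
theorem eventually_surjective {n : ℕ} {F : Type*} [NormedAddCommGroup F] [NormedSpace ℝ F]
    [FiniteDimensional ℝ F] {A : Euc n → Euc n →L[ℝ] F} {p : Euc n} (hA : ContinuousAt A p)
    (hs : Function.Surjective (A p)) : ∀ᶠ x in 𝓝 p, Function.Surjective (A x) := by
  obtain ⟨B, hB⟩ := (A p : Euc n →ₗ[ℝ] F).exists_rightInverse_of_surjective
    (LinearMap.range_eq_top.2 hs)
  let B' : F →L[ℝ] Euc n := LinearMap.toContinuousLinearMap B
  have h1 : ContinuousAt (fun x => (A x).comp B') p :=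
    hA.clm_comp continuousAt_const
  have h2 : (A p).comp B' = 1 := by
    ext v
    exact LinearMap.congr_fun hB v
  have h3 : {T : F →L[ℝ] F | IsUnit T} ∈ 𝓝 ((A p).comp B') := by
    rw [h2]
    exact Units.isOpen.mem_nhds isUnit_one
  filter_upwards [h1.eventually h3] with x hx y
  obtain ⟨u, hu⟩ := hx
  refine ⟨B' ((↑u⁻¹ : F →L[ℝ] F) y), ?_⟩
  have h4 : (u : F →L[ℝ] F) * (↑u⁻¹ : F →L[ℝ] F) = 1 := u.mul_inv
  rw [hu] at h4
  exact congrArg (fun T : F →L[ℝ] F => T y) h4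

theorem horizonRadius_pos {n : ℕ} {m : ℝ} (hm : 0 < m) : 0 < horizonRadius n m :=
  Real.rpow_pos_of_pos (half_pos hm) _

namespace IsFreeBoundaryMinimal

variable {n : ℕ} {m : ℝ} {S : Set (Euc n)}

theorem mem_tangentSpaceAt_of_norm_eq (hS : IsFreeBoundaryMinimal n m S) {x : Euc n} (hx : x ∈ S)
    (h : ‖x‖ = horizonRadius n m) : x ∈ tangentSpaceAt S x :=
  hS.orthogonal x (hS.boundary_eq ▸ ⟨hx, h⟩)

/-- At the horizon, orthogonality allows the condition `R ≤ ‖x‖` to replace the boundary inequality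
`0 ≤ w`, by `eventually_mem_iff_of_boundary`. Elsewhere the point is interior and the neighbourhood
is shrunk away from the horizon. -/
theorem exists_isDefining (hm : 0 < m) (hS : IsFreeBoundaryMinimal n m S) {p : Euc n}
    (hp : p ∈ S) : ∃ V Φ, p ∈ V ∧ IsDefining (horizonRadius n m) S V Φ ∧
      (horizonRadius n m < ‖p‖ → ∀ x ∈ V, horizonRadius n m < ‖x‖) := by
  set R := horizonRadius n m with hR
  have key : ∀ (V : Set (Euc n)) (Φ : Euc n → ℝ), IsOpen V → p ∈ V → ContDiffOn ℝ ∞ Φ V →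
      gradient Φ p ≠ 0 → (∀ᶠ x in 𝓝 p, x ∈ S ↔ Φ x = 0 ∧ R ≤ ‖x‖) →
      ∃ V Φ, p ∈ V ∧ IsDefining R S V Φ ∧ (R < ‖p‖ → ∀ x ∈ V, R < ‖x‖) := by
    intro V Φ hV hpV hΦ hN hiff
    have h0 : ∀ᶠ x in 𝓝 p, x ∈ V := hV.mem_nhds hpV
    have h1 : ∀ᶠ x in 𝓝 p, gradient Φ x ≠ 0 :=
      ((contDiffOn_gradient hV hΦ).continuousOn.continuousAt (hV.mem_nhds hpV)).eventually_ne hN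
    have h2 : ∀ᶠ x : Euc n in 𝓝 p, R < ‖p‖ → R < ‖x‖ := by
      by_cases h : R < ‖p‖
      · filter_upwards [continuous_norm.continuousAt.eventually (lt_mem_nhds h)] with x hx _
        exact hx
      · exact Eventually.of_forall fun x h' => absurd h' h
    obtain ⟨V', hV', hV'o, hpV'⟩ := eventually_nhds_iff.1
      ((h0.and h1).and (hiff.and h2))
    exact ⟨V', Φ, hpV', ⟨hV'o, hΦ.mono fun x hx => (hV' x hx).1.1, fun x hx => (hV' x hx).1.2,
      fun x hx => (hV' x hx).2.1⟩, fun h x hx => (hV' x hx).2.2 h⟩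
  have hRp : R ≤ ‖p‖ := hS.subset_space hp
  have hcoord : ∀ {V : Set (Euc n)} {Φ : Euc n → (Fin 1 → ℝ)}, IsOpen V → p ∈ V →
      ContDiffOn ℝ ∞ Φ V → ContDiffOn ℝ ∞ (fun x => Φ x 0) V ∧
        ∀ v, fderiv ℝ (fun x => Φ x 0) p v = fderiv ℝ Φ p v 0 := by
    intro V Φ hV hpV hΦ
    refine ⟨contDiffOn_pi.1 hΦ 0, fun v => ?_⟩
    have h1 : DifferentiableAt ℝ Φ p :=
      (hΦ.contDiffAt (hV.mem_nhds hpV)).differentiableAt (by simp)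
    rw [(hasFDerivAt_pi'.1 h1.hasFDerivAt 0).fderiv]
    rfl
  have hzero : ∀ y : Fin 1 → ℝ, y = 0 ↔ y 0 = 0 := fun y =>
    ⟨fun h => h ▸ rfl, fun h => funext fun i => by rw [Subsingleton.elim i 0]; exact h⟩
  rcases hRp.eq_or_lt with hpR | hpR
  · have hpb : p ∈ boundary S := hS.boundary_eq ▸ ⟨hp, hpR.symm⟩
    obtain ⟨-, V, hV, hpV, Φ, w, hΦ, hw, hwp, hsurj, hSV⟩ := hpb
    obtain ⟨hΦ0, hΦd⟩ := hcoord hV hpV hΦ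
    have hiff : ∀ᶠ x in 𝓝 p, x ∈ S ↔ Φ x 0 = 0 ∧ 0 ≤ w x := by
      filter_upwards [hV.mem_nhds hpV] with x hx
      have := Set.ext_iff.1 hSV x
      simp only [mem_inter_iff, hx, and_true, mem_ofPred_eq, true_and, hzero] at this
      exact this
    have hpp : Φ p 0 = 0 := (hiff.self_of_nhds.1 hp).1
    have hst := (hΦ0.contDiffAt (hV.mem_nhds hpV)).hasStrictFDerivAt (by simp)
    have hAp : fderiv ℝ (fun x => Φ x 0) p p = 0 := by
      refine apply_eq_zero_of_mem_tangentSpaceAt hst.hasFDerivAt hpp ?_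
        (hS.mem_tangentSpaceAt_of_norm_eq hp hpR.symm)
      filter_upwards [self_mem_nhdsWithin, mem_nhdsWithin_of_mem_nhds hiff] with x hx h
      exact (h.1 hx).1
    refine key V (fun x => Φ x 0) hV hpV hΦ0 ?_ ?_
    · intro h0
      obtain ⟨v, hv⟩ := hsurj (1, 0)
      have h1 := (inner_gradient (fun x => Φ x 0) p v).symm
      rw [h0, inner_zero_left, hΦd, (Prod.mk.inj hv).1] at h1
      exact one_ne_zero h1
    · refine eventually_mem_iff_of_boundary (horizonRadius_pos hm) hpR.symm hst
        ((hw.contDiffAt (hV.mem_nhds hpV)).hasStrictFDerivAt (by simp)) ?_ hpp hwp hiff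
        (fun x hx => hS.subset_space hx) ?_ hAp
      · intro c
        obtain ⟨v, hv⟩ := hsurj (fun _ => c.1, c.2)
        refine ⟨v, Prod.ext ?_ (Prod.mk.inj hv).2⟩
        simp only [hΦd, (Prod.mk.inj hv).1]
      · have hc : ContinuousAt (fun x => (fderiv ℝ Φ x).prod (fderiv ℝ w x)) p := by
          have h1 := (hΦ.continuousOn_fderiv_of_isOpen hV (by simp)).continuousAt (hV.mem_nhds hpV)
          have h2 := (hw.continuousOn_fderiv_of_isOpen hV (by simp)).continuousAt (hV.mem_nhds hpV)
          exact (ContinuousLinearMap.prodₗᵢ (𝕜 := ℝ) ℝ).continuous.continuousAt.comp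
            (h1.prodMk h2)
        -- Surjectivity of the differential is an open condition, so nearby points with `Φ = w = 0`
        -- are boundary points too, and the boundary lies on the horizon.
        filter_upwards [eventually_surjective hc hsurj, hiff, hV.mem_nhds hpV] with x h1 h2 h3 h4 h5
        have hx : x ∈ S := h2.2 ⟨h4, h5.ge⟩
        have hxb : x ∈ boundary S := ⟨hx, V, hV, h3, Φ, w, hΦ, hw, h5, h1, hSV⟩
        rw [hS.boundary_eq] at hxb
        exact hxb.2
  · have hpb : ¬ IsBoundaryPoint 1 S p := fun h => by
      have : p ∈ boundary S := h
      rw [hS.boundary_eq] at this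
      exact hpR.ne' this.2
    obtain ⟨-, V, hV, hpV, Φ, hΦ, hsurj, hSV⟩ := (hS.isHypersurface p hp).resolve_right hpb
    obtain ⟨hΦ0, hΦd⟩ := hcoord hV hpV hΦ
    refine key V (fun x => Φ x 0) hV hpV hΦ0 ?_ ?_
    · intro h0
      obtain ⟨v, hv⟩ := hsurj 1
      have h1 := (inner_gradient (fun x => Φ x 0) p v).symm
      rw [h0, inner_zero_left, hΦd, hv] at h1
      exact one_ne_zero h1
    · filter_upwards [hV.mem_nhds hpV, continuous_norm.continuousAt.eventually (lt_mem_nhds hpR)]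
        with x hx hxR
      have := Set.ext_iff.1 hSV x
      simp only [mem_inter_iff, hx, and_true, mem_ofPred_eq, true_and, hzero] at this
      rw [this]
      exact ⟨fun h => ⟨h, hxR.le⟩, fun h => h.1⟩

theorem continuousOn_tangentialPart (hm : 0 < m) (hS : IsFreeBoundaryMinimal n m S) :
    ContinuousOn (tangentialPart S) S := by
  intro p hp
  obtain ⟨V, Φ, hpV, hdef, -⟩ := hS.exists_isDefining hm hp
  have hN : ContinuousAt (gradient Φ) p := (contDiffOn_gradient hdef.isOpen
    hdef.contDiffOn).continuousOn.continuousAt (hdef.isOpen.mem_nhds hpV)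
  have hN0 : ‖gradient Φ p‖ ^ 2 ≠ 0 := by
    have := norm_ne_zero_iff.2 (hdef.gradient_ne_zero p hpV)
    positivity
  have hc : ContinuousAt (fun x => x - (inner ℝ (gradient Φ x) x / ‖gradient Φ x‖ ^ 2) •
      gradient Φ x) p :=
    continuousAt_id.sub (((hN.inner continuousAt_id).div (hN.norm.pow 2) hN0).smul hN)
  refine hc.continuousWithinAt.congr_of_eventuallyEq ?_
    (hdef.tangentialPart_eq hp hpV fun h => hS.mem_tangentSpaceAt_of_norm_eq hp h)
  filter_upwards [self_mem_nhdsWithin, mem_nhdsWithin_of_mem_nhds (hdef.isOpen.mem_nhds hpV)]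
    with x hx hxV
  exact hdef.tangentialPart_eq hx hxV fun h => hS.mem_tangentSpaceAt_of_norm_eq hx h

end IsFreeBoundaryMinimal

/-! ### The divergence theorem on level sets -/

/-- The divergence of a vector field on `ℝ^n`. -/
def divergence {n : ℕ} (Z : Euc n → Euc n) (x : Euc n) : ℝ :=
  LinearMap.trace ℝ (Euc n) (fderiv ℝ Z x : Euc n →ₗ[ℝ] Euc n)

theorem divergence_eq_sum {n : ℕ} {ι : Type*} [Fintype ι] (b : OrthonormalBasis ι ℝ (Euc n))
    (Z : Euc n → Euc n) (x : Euc n) :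
    divergence Z x = ∑ i, inner ℝ (b i) (fderiv ℝ Z x (b i)) :=
  LinearMap.trace_eq_sum_inner _ b

theorem continuous_divergence {n : ℕ} {Z : Euc n → Euc n} (hZ : ContDiff ℝ 1 Z) :
    Continuous (divergence Z) := by
  have h : divergence Z = fun x => ∑ i, inner ℝ (EuclideanSpace.basisFun (Fin n) ℝ i)
      (fderiv ℝ Z x (EuclideanSpace.basisFun (Fin n) ℝ i)) := funext fun x => divergence_eq_sum _ _ _
  rw [h]
  have := hZ.continuous_fderiv one_ne_zero
  fun_prop

theorem divergence_eq_zero_of_notMem_tsupport {n : ℕ} {Z : Euc n → Euc n} {x : Euc n}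
    (hx : x ∉ tsupport Z) : divergence Z x = 0 := by
  rw [divergence, fderiv_of_notMem_tsupport ℝ hx]
  exact map_zero _

theorem tsupport_divergence_subset {n : ℕ} (Z : Euc n → Euc n) :
    tsupport (divergence Z) ⊆ tsupport Z :=
  closure_minimal (fun _ hx => by_contra fun h => hx (divergence_eq_zero_of_notMem_tsupport h))
    (isClosed_tsupport Z)

theorem integral_divergence_eq_zero {n : ℕ} {Z : Euc n → Euc n} (hZ : ContDiff ℝ 1 Z)
    (hc : HasCompactSupport Z) : ∫ x, divergence Z x = 0 := by
  let b := EuclideanSpace.basisFun (Fin n) ℝ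
  have hf : ∀ i x, inner ℝ (b i) (fderiv ℝ Z x (b i)) =
      fderiv ℝ (fun x => inner ℝ (b i) (Z x)) x (b i) := fun i x => by
    have h1 := ((innerSL ℝ (b i)).hasFDerivAt.comp x
      (hZ.differentiable one_ne_zero x).hasFDerivAt).fderiv
    have h2 : (fun x => inner ℝ (b i) (Z x)) = (innerSL ℝ (b i)) ∘ Z := rfl
    rw [h2, h1]
    rfl
  have hg : ∀ i, ContDiff ℝ 1 (fun x => inner ℝ (b i) (Z x)) := fun i => contDiff_const.inner ℝ hZ
  have hgc : ∀ i, HasCompactSupport (fun x => inner ℝ (b i) (Z x)) := fun i =>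
    hc.comp_left (g := fun v => inner ℝ (b i) v) (inner_zero_right _)
  have hfc : ∀ i, Integrable (fun x => fderiv ℝ (fun x => inner ℝ (b i) (Z x)) x (b i)) := fun i => by
    have h1 := (hg i).continuous_fderiv one_ne_zero
    exact (h1.clm_apply continuous_const).integrable_of_hasCompactSupport
      (((hgc i).fderiv ℝ).comp_left (g := fun L : Euc n →L[ℝ] ℝ => L (b i)) rfl)
  simp_rw [divergence_eq_sum b, hf]
  rw [integral_finsetSum _ fun i _ => hfc i]
  refine Finset.sum_eq_zero fun i _ => ?_
  have h := integral_mul_fderiv_eq_neg_fderiv_mul_of_integrable (μ := volume) (v := b i)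
    (f := fun _ : Euc n => (1 : ℝ)) (g := fun x => inner ℝ (b i) (Z x)) (by simp)
    (by simpa using hfc i)
    (by simpa using (hg i).continuous.integrable_of_hasCompactSupport (hgc i))
    (fun x _ => differentiableAt_const _) (fun x _ => (hg i).differentiable one_ne_zero x)
  simpa using h

theorem contDiff_smul_of_tsupport_subset {n : ℕ} {r : WithTop ℕ∞} {V : Set (Euc n)} (hV : IsOpen V)
    {a : Euc n → ℝ} {Z : Euc n → Euc n} (ha : ContDiffOn ℝ r a V) (hZ : ContDiff ℝ r Z)
    (hsub : tsupport Z ⊆ V) : ContDiff ℝ r (fun x => a x • Z x) := by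
  refine contDiff_iff_contDiffAt.2 fun x => ?_
  by_cases hx : x ∈ tsupport Z
  · exact (ha.contDiffAt (hV.mem_nhds (hsub hx))).smul hZ.contDiffAt
  · have h : (fun x => a x • Z x) =ᶠ[𝓝 x] fun _ => 0 := by
      filter_upwards [(isClosed_tsupport Z).isOpen_compl.mem_nhds hx] with y hy
      rw [image_eq_zero_of_notMem_tsupport hy, smul_zero]
    exact contDiffAt_const.congr_of_eventuallyEq h

theorem divergence_smul {n : ℕ} {a : Euc n → ℝ} {Z : Euc n → Euc n} {x : Euc n}
    (ha : DifferentiableAt ℝ a x) (hZ : DifferentiableAt ℝ Z x) :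
    divergence (fun x => a x • Z x) x = a x * divergence Z x + fderiv ℝ a x (Z x) := by
  let b := EuclideanSpace.basisFun (Fin n) ℝ
  rw [divergence_eq_sum b, divergence_eq_sum b, fderiv_fun_smul ha hZ, Finset.mul_sum]
  have h : fderiv ℝ a x (Z x) = ∑ i, inner ℝ (b i) (Z x) * fderiv ℝ a x (b i) := by
    conv_lhs => rw [← b.sum_repr' (Z x)]
    simp [map_sum]
  rw [h, ← Finset.sum_add_distrib]
  refine Finset.sum_congr rfl fun i _ => ?_
  simp only [add_apply, smul_apply,
    ContinuousLinearMap.smulRight_apply, inner_add_right, inner_smul_right]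
  ring

/-- The divergence theorem on a level set, for a vector field tangent to all the level sets, when
the gradient of the defining function has length one along the level set. -/
theorem integral_divergence_levelSet {n k : ℕ} (hn : n = k + 1) {V : Set (Euc n)} (hV : IsOpen V)
    {Φ : Euc n → ℝ} (hΦ : ContDiffOn ℝ ∞ Φ V)
    (hN : ∀ x ∈ V, Φ x = 0 → ‖gradient Φ x‖ = 1) {Z : Euc n → Euc n} (hZ : ContDiff ℝ ∞ Z)
    (hZc : HasCompactSupport Z) (hZV : tsupport Z ⊆ V) (hZΦ : ∀ x ∈ V, fderiv ℝ Φ x (Z x) = 0) :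
    IntegrableOn (divergence Z) {x | x ∈ V ∧ Φ x = 0} (Measure.euclideanHausdorffMeasure k) ∧
    ∫ x in {x | x ∈ V ∧ Φ x = 0}, divergence Z x ∂Measure.euclideanHausdorffMeasure k = 0 := by
  have hdc : Continuous (divergence Z) := continuous_divergence (hZ.of_le (by simp))
  have hdV : ∀ x ∉ V, divergence Z x = 0 := fun x hx =>
    divergence_eq_zero_of_notMem_tsupport fun h => hx (hZV h)
  -- The bump is supported in `[1/4, 3/4]`, so the tube lies on the side `Φ > 0`, as the one-sided
  -- tube formula requires.
  let q : ContDiffBump (1 / 2 : ℝ) := ⟨1 / 8, 1 / 4, by norm_num, by norm_num⟩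
  have hq0 : ∀ t ∉ Icc (0 : ℝ) 1, q t = 0 := fun t ht => by
    refine q.zero_of_le_dist ?_
    rw [Real.dist_eq]
    by_contra! h
    have := abs_lt.1 h
    exact ht ⟨by change _ < (1 / 4 : ℝ) at h; rw [abs_lt] at h; linarith,
      by change _ < (1 / 4 : ℝ) at h; rw [abs_lt] at h; linarith⟩
  have hqI : ∫⁻ t, ENNReal.ofReal (q t) = ENNReal.ofReal (∫ t, q t) :=
    (ofReal_integral_eq_lintegral_ofReal q.integrable (ae_of_all _ fun t => q.nonneg)).symm
  have hqI0 : ∫⁻ t, ENNReal.ofReal (q t) ≠ 0 := by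
    rw [hqI, Ne, ENNReal.ofReal_eq_zero, not_le]
    exact q.integral_pos
  have hqIt : ∫⁻ t, ENNReal.ofReal (q t) ≠ ⊤ := hqI ▸ ENNReal.ofReal_ne_top
  have htube : ∀ G : Euc n → ℝ, Continuous G → (∀ x, 0 ≤ G x) → (tsupport G ⊆ tsupport Z) →
      (∫⁻ x in {x | x ∈ V ∧ Φ x = 0}, ENNReal.ofReal (G x)
        ∂Measure.euclideanHausdorffMeasure k) ≠ ⊤ ∧
      Tendsto (fun ε => (∫⁻ x, ENNReal.ofReal (q (Φ x / ε) * G x)) / ENNReal.ofReal ε)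
        (𝓝[>] 0) (𝓝 ((∫⁻ t, ENNReal.ofReal (q t)) *
          ∫⁻ x in {x | x ∈ V ∧ Φ x = 0}, ENNReal.ofReal (G x)
            ∂Measure.euclideanHausdorffMeasure k)) := by
    intro G hG hG0 hGZ
    have h := tendsto_tubeIntegral (k := k) (X := V) (w := Φ) (W := fun _ => 1)
      (κ := fun t => ENNReal.ofReal (q t)) hV.measurableSet hΦ.continuousOn aemeasurable_const
      q.continuous.measurable.ennreal_ofReal (fun t ht => by simp [hq0 t ht]) hqIt hG hG0
      (by rw [inter_eq_self_of_subset_right (hGZ.trans hZV)]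
          exact hZc.of_isClosed_subset (isClosed_tsupport G) hGZ)
      (fun p hp hp0 K hK => by
        have hN1 := hN p hp.1 hp0
        refine hasTubeChart_of_submersion (N := gradient Φ p) hn ?_ ?_ hp0 (hV.mem_nhds hp.1)
          continuousAt_const hN1.symm hK
        · rw [innerSL_gradient]
          exact (hΦ.contDiffAt (hV.mem_nhds hp.1)).hasStrictFDerivAt (by simp)
        · intro h0
          rw [h0, norm_zero] at hN1
          exact zero_ne_one hN1)
    refine ⟨h.1, h.2.congr' ?_⟩
    filter_upwards [self_mem_nhdsWithin] with ε hε
    congr 1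
    have hms : MeasurableSet {x | x ∈ V ∧ 0 ≤ Φ x} :=
      measurableSet_sep_of_continuousOn hV.measurableSet hΦ.continuousOn measurableSet_Ici
    rw [tubeIntegral, ← hn, ← lintegral_indicator hms]
    have hvol : (Measure.euclideanHausdorffMeasure n : Measure (Euc n)) = volume := EuclideanSpace.euclideanHausdorffMeasure_eq_volume n
    rw [hvol]
    refine lintegral_congr fun x => ?_
    by_cases hx : x ∈ {x | x ∈ V ∧ 0 ≤ Φ x}
    · rw [indicator_of_mem hx, ENNReal.ofReal_one, one_mul, ENNReal.ofReal_mul q.nonneg]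
    · rw [indicator_of_notMem hx]
      by_cases hxV : x ∈ V
      · rw [hq0, zero_mul, ENNReal.ofReal_zero]
        intro h'
        exact hx ⟨hxV, by have := mul_nonneg h'.1 (le_of_lt hε); rwa [div_mul_cancel₀ _ (ne_of_gt hε)] at this⟩
      · rw [image_eq_zero_of_notMem_tsupport fun h => hxV (hZV (hGZ h)), mul_zero,
          ENNReal.ofReal_zero]
  -- The tube formula concerns nonnegative functions, so the divergence is split into its positive
  -- and negative parts.
  have hpos := htube (fun x => max (divergence Z x) 0) (hdc.max continuous_const)
    (fun x => le_max_right _ _) (closure_minimal (fun x hx => by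
      refine by_contra fun h => hx ?_
      simp [divergence_eq_zero_of_notMem_tsupport h]) (isClosed_tsupport Z))
  have hneg := htube (fun x => max (-divergence Z x) 0) (hdc.neg.max continuous_const)
    (fun x => le_max_right _ _) (closure_minimal (fun x hx => by
      refine by_contra fun h => hx ?_
      simp [divergence_eq_zero_of_notMem_tsupport h]) (isClosed_tsupport Z))
  have hε : ∀ ε : ℝ, 0 < ε →
      ∫⁻ x, ENNReal.ofReal (q (Φ x / ε) * max (divergence Z x) 0) =
      ∫⁻ x, ENNReal.ofReal (q (Φ x / ε) * max (-divergence Z x) 0) := by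
    intro ε hε
    have hqΦ : ContDiffOn ℝ ∞ (fun x => q (Φ x / ε)) V := q.contDiff.comp_contDiffOn (hΦ.div_const ε)
    have hY : ContDiff ℝ ∞ (fun x => q (Φ x / ε) • Z x) :=
      contDiff_smul_of_tsupport_subset hV hqΦ hZ hZV
    -- `Z` is tangent to every level set, so the cutoff `q (Φ/ε)` has zero derivative along `Z`.
    have hYd : ∀ x, divergence (fun x => q (Φ x / ε) • Z x) x = q (Φ x / ε) * divergence Z x := by
      intro x
      by_cases hx : x ∈ tsupport Z
      · have hxV := hV.mem_nhds (hZV hx)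
        have hΦd : HasFDerivAt Φ (fderiv ℝ Φ x) x :=
          ((hΦ.contDiffAt hxV).differentiableAt (by simp)).hasFDerivAt
        have hqd : HasDerivAt q (deriv q (Φ x / ε)) (Φ x / ε) :=
          ((q.contDiff (n := 1)).differentiable one_ne_zero _).hasDerivAt
        have hd : HasFDerivAt (fun x => q (Φ x / ε)) (deriv q (Φ x / ε) • (ε⁻¹ • fderiv ℝ Φ x)) x := by
          have hd' : HasFDerivAt (fun x => Φ x / ε) (ε⁻¹ • fderiv ℝ Φ x) x := by
            simp only [div_eq_mul_inv]
            exact hΦd.mul_const ε⁻¹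
          exact HasDerivAt.comp_hasFDerivAt (h₂ := fun t => q t) (f := fun x => Φ x / ε) x hqd hd'
        rw [divergence_smul hd.differentiableAt (hZ.differentiable (by simp) x), hd.fderiv]
        simp [hZΦ x (hZV hx)]
      · rw [divergence_eq_zero_of_notMem_tsupport hx, mul_zero,
          divergence_eq_zero_of_notMem_tsupport]
        exact fun h => hx (tsupport_smul_subset_right _ _ h)
    have hYc : HasCompactSupport (fun x => q (Φ x / ε) • Z x) :=
      hZc.of_isClosed_subset (isClosed_tsupport _) (tsupport_smul_subset_right _ _)
    have h0 := integral_divergence_eq_zero (hY.of_le (by simp)) hYc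
    have hint : Integrable (divergence fun x => q (Φ x / ε) • Z x) :=
      (continuous_divergence (hY.of_le (by simp))).integrable_of_hasCompactSupport
        (hYc.of_isClosed_subset (isClosed_tsupport _) (tsupport_divergence_subset _))
    have h1 := (hasFiniteIntegral_iff_enorm.1 hint.2).ne
    have hle : ∀ {g : Euc n → ℝ}, (∀ x, g x ≤ ‖divergence (fun x => q (Φ x / ε) • Z x) x‖) →
        ∫⁻ x, ENNReal.ofReal (g x) ≠ ⊤ := fun hg =>
      ne_top_of_le_ne_top h1 (lintegral_mono fun x => by
        rw [← ofReal_norm]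
        exact ENNReal.ofReal_le_ofReal (hg x))
    rw [integral_eq_lintegral_pos_part_sub_lintegral_neg_part hint, sub_eq_zero] at h0
    have h2 := (ENNReal.toReal_eq_toReal_iff' (hle fun x => le_abs_self _)
      (hle fun x => neg_le_abs _)).1 h0
    simp_rw [hYd] at h2
    convert h2 using 2 <;> ext x
    · rw [mul_max_of_nonneg _ _ q.nonneg, mul_zero, ENNReal.ofReal_max, ENNReal.ofReal_zero, max_eq_left zero_le]
    · rw [mul_max_of_nonneg _ _ q.nonneg, mul_zero, mul_neg, ENNReal.ofReal_max, ENNReal.ofReal_zero, max_eq_left zero_le]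
  have hlim := tendsto_nhds_unique hpos.2 (hneg.2.congr' (by
    filter_upwards [self_mem_nhdsWithin] with ε h
    rw [hε ε h]))
  have hI := (ENNReal.mul_right_inj hqI0 hqIt).1 hlim
  simp only [ENNReal.ofReal_max, ENNReal.ofReal_zero, zero_le, max_eq_left] at hI hpos
  have hint : IntegrableOn (divergence Z) {x | x ∈ V ∧ Φ x = 0}
      (Measure.euclideanHausdorffMeasure k) := by
    refine ⟨hdc.aestronglyMeasurable, ?_⟩
    rw [hasFiniteIntegral_iff_norm]
    have h3 : ∀ x, ENNReal.ofReal ‖divergence Z x‖ =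
        ENNReal.ofReal (divergence Z x) + ENNReal.ofReal (-divergence Z x) := fun x => by
      rcases le_total 0 (divergence Z x) with h | h
      · rw [Real.norm_of_nonneg h, ENNReal.ofReal_of_nonpos (neg_nonpos.2 h), add_zero]
      · rw [Real.norm_of_nonpos h, ENNReal.ofReal_of_nonpos h, zero_add]
    simp_rw [h3]
    rw [lintegral_add_left hdc.measurable.ennreal_ofReal, ← hI]
    exact ENNReal.add_lt_top.2 ⟨hpos.1.lt_top, hpos.1.lt_top⟩
  refine ⟨hint, ?_⟩
  rw [integral_eq_lintegral_pos_part_sub_lintegral_neg_part hint, hI, sub_self]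

/-! ### Minimality and the first variation formula -/

theorem conformalFactor_pos {n : ℕ} {m : ℝ} (hm : 0 < m) (x : Euc n) :
    0 < conformalFactor n m x :=
  Real.rpow_pos_of_pos (by positivity) _

theorem contDiffAt_conformalFactor {n : ℕ} {m : ℝ} (hm : 0 < m) {x : Euc n} (hx : x ≠ 0) :
    ContDiffAt ℝ ∞ (conformalFactor n m) x := by
  have hx' : 2 * ‖x‖ ^ (n - 2) ≠ 0 := by
    have := norm_ne_zero_iff.2 hx
    positivity
  have h1 : (1 + m / (2 * ‖x‖ ^ (n - 2))) ≠ 0 := by positivity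
  exact (contDiffAt_const.add (contDiffAt_const.div (contDiffAt_const.mul
    ((contDiffAt_norm ℝ hx).pow _)) hx')).rpow_const_of_ne h1

theorem inner_fderiv_gradient {n : ℕ} {Φ : Euc n → ℝ} {x : Euc n} (h : ContDiffAt ℝ 2 Φ x)
    (v w : Euc n) :
    inner ℝ (fderiv ℝ (gradient Φ) x v) w = fderiv ℝ (fderiv ℝ Φ) x v w := by
  have hd : DifferentiableAt ℝ (fderiv ℝ Φ) x :=
    (h.fderiv_right (m := 1) (by norm_num)).differentiableAt one_ne_zero
  have hg : DifferentiableAt ℝ (gradient Φ) x :=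
    (((InnerProductSpace.toDual ℝ (Euc n)).symm.toContinuousLinearEquiv.contDiff
      (n := 1)).differentiable one_ne_zero _).comp x hd
  have h1 := (hg.hasFDerivAt.inner ℝ (hasFDerivAt_const w x)).fderiv
  have h2 : (fun x => inner ℝ (gradient Φ x) w) = fun x => fderiv ℝ Φ x w :=
    funext fun x => inner_gradient Φ x w
  rw [h2, (hd.hasFDerivAt.clm_apply (hasFDerivAt_const w x)).fderiv] at h1
  have h3 := congrArg (fun L : Euc n →L[ℝ] ℝ => L v) h1
  simp [fderivInnerCLM_apply] at h3
  exact h3.symm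

theorem inner_fderiv_gradient_comm {n : ℕ} {Φ : Euc n → ℝ} {x : Euc n} (h : ContDiffAt ℝ 2 Φ x)
    (v w : Euc n) :
    inner ℝ (fderiv ℝ (gradient Φ) x v) w = inner ℝ (fderiv ℝ (gradient Φ) x w) v := by
  rw [inner_fderiv_gradient h, inner_fderiv_gradient h]
  exact (h.isSymmSndFDerivAt (by simp)).eq v w

theorem hasFDerivAt_smul_vector {E F : Type*} [NormedAddCommGroup E] [NormedSpace ℝ E]
    [NormedAddCommGroup F] [NormedSpace ℝ F] {c : E → ℝ} {c' : E →L[ℝ] ℝ} {x : E}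
    (h : HasFDerivAt c c' x) (f : F) : HasFDerivAt (fun x => c x • f) (c'.smulRight f) x :=
  h.smul_const f

/-- A defining function can be normalized so that its gradient has length one along `S`. -/
theorem IsDefining.exists_normalized {n : ℕ} {R : ℝ} {S V : Set (Euc n)} {Φ : Euc n → ℝ}
    (h : IsDefining R S V Φ) {p : Euc n} (hpV : p ∈ V) (hp : p ∈ S) : ∃ V' Ψ, V' ⊆ V ∧ p ∈ V' ∧
      IsDefining R S V' Ψ ∧ ∀ x ∈ V', Ψ x = 0 → ‖gradient Ψ x‖ = 1 := by
  have hNc := contDiffOn_gradient h.isOpen h.contDiffOn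
  have hΨ : ContDiffOn ℝ ∞ (fun x => ‖gradient Φ x‖⁻¹ * Φ x) V := by
    refine ContDiffOn.mul (ContDiffOn.inv (hNc.norm ℝ h.gradient_ne_zero) fun x hx =>
      norm_ne_zero_iff.2 (h.gradient_ne_zero x hx)) h.contDiffOn
  have hz : ∀ x ∈ V, ‖gradient Φ x‖⁻¹ * Φ x = 0 ↔ Φ x = 0 := fun x hx => by
    have := norm_ne_zero_iff.2 (h.gradient_ne_zero x hx)
    simp [this]
  -- In the product rule the derivative of the normalising factor is multiplied by `Φ`, which
  -- vanishes here.
  have hg : ∀ x ∈ V, Φ x = 0 →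
      gradient (fun x => ‖gradient Φ x‖⁻¹ * Φ x) x = ‖gradient Φ x‖⁻¹ • gradient Φ x := by
    intro x hx h0
    have hV := h.isOpen.mem_nhds hx
    have h1 : DifferentiableAt ℝ (fun x => ‖gradient Φ x‖⁻¹) x :=
      (((hNc.norm ℝ h.gradient_ne_zero).inv fun x hx =>
        norm_ne_zero_iff.2 (h.gradient_ne_zero x hx)).contDiffAt hV).differentiableAt (by simp)
    have h2 : DifferentiableAt ℝ Φ x := (h.contDiffOn.contDiffAt hV).differentiableAt (by simp)
    refine ext_inner_right ℝ fun v => ?_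
    rw [inner_gradient, fderiv_fun_mul h1 h2, inner_smul_left, inner_gradient, h0]
    simp
  have hn : ∀ x ∈ V, Φ x = 0 → ‖gradient (fun x => ‖gradient Φ x‖⁻¹ * Φ x) x‖ = 1 := by
    intro x hx h0
    have := norm_ne_zero_iff.2 (h.gradient_ne_zero x hx)
    rw [hg x hx h0, norm_smul, norm_inv, norm_norm, inv_mul_cancel₀ this]
  have hp0 := ((h.mem_iff p hpV).1 hp).1
  have hev : ∀ᶠ x in 𝓝 p, gradient (fun x => ‖gradient Φ x‖⁻¹ * Φ x) x ≠ 0 := by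
    refine ((contDiffOn_gradient h.isOpen hΨ).continuousOn.continuousAt
      (h.isOpen.mem_nhds hpV)).eventually_ne ?_
    rw [← norm_ne_zero_iff, hn p hpV hp0]
    exact one_ne_zero
  obtain ⟨V', hV', hV'o, hpV'⟩ := eventually_nhds_iff.1 hev
  refine ⟨V' ∩ V, fun x => ‖gradient Φ x‖⁻¹ * Φ x, inter_subset_right, ⟨hpV', hpV⟩,
    ⟨hV'o.inter h.isOpen, hΨ.mono inter_subset_right, fun x hx => hV' x hx.1, fun x hx => ?_⟩,
    fun x hx h0 => hn x hx.2 ((hz x hx.2).1 h0)⟩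
  rw [hz x hx.2]
  exact h.mem_iff x hx.2

/-- The trace of the Hessian of a defining function over the tangent space, in terms of the
conformal factor, along a minimal hypersurface. -/
theorem IsFreeBoundaryMinimal.divergence_gradient {k : ℕ} {m : ℝ} (hm : 0 < m) {S V : Set (Euc (k + 1))}
    (hS : IsFreeBoundaryMinimal (k + 1) m S) {Φ : Euc (k + 1) → ℝ}
    (h : IsDefining (horizonRadius (k + 1) m) S V Φ)
    (hV : ∀ x ∈ V, horizonRadius (k + 1) m < ‖x‖)
    (hN : ∀ x ∈ V, Φ x = 0 → ‖gradient Φ x‖ = 1) {p : Euc (k + 1)} (hpV : p ∈ V) (hp : p ∈ S) :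
    divergence (gradient Φ) p - inner ℝ (fderiv ℝ (gradient Φ) p (gradient Φ p)) (gradient Φ p) =
      -(k * (fderiv ℝ (conformalFactor (k + 1) m) p (gradient Φ p) /
        conformalFactor (k + 1) m p)) := by
  set ψ := conformalFactor (k + 1) m with hψdef
  set N := gradient Φ with hNdef
  have hx0 : ∀ x ∈ V, x ≠ 0 := fun x hx =>
    norm_pos_iff.1 ((horizonRadius_pos hm).trans (hV x hx))
  have hψ0 : ∀ x, ψ x ≠ 0 := fun x => (conformalFactor_pos hm x).ne'
  have hψc : ContDiffOn ℝ ∞ ψ V := fun x hx =>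
    (contDiffAt_conformalFactor hm (hx0 x hx)).contDiffWithinAt
  have hNc : ContDiffOn ℝ ∞ N V := contDiffOn_gradient h.isOpen h.contDiffOn
  have hVp := h.isOpen.mem_nhds hpV
  have hN1 : ∀ x ∈ S ∩ V, ‖N x‖ = 1 := fun x hx => hN x hx.2 ((h.mem_iff x hx.2).1 hx.1).1
  have hunit : IsUnitNormalOn (schwarzschildMetric (k + 1) m) S V (fun x => (ψ x)⁻¹ • N x) := by
    refine ⟨(hψc.inv fun x _ => hψ0 x).smul hNc, fun x hx => ⟨?_, fun v hv => ?_⟩⟩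
    · rw [schwarzschildMetric_apply, inner_smul_left, inner_smul_right, real_inner_self_eq_norm_sq,
        hN1 x hx, ← hψdef]
      have := hψ0 x
      simp
      field_simp
    · rw [schwarzschildMetric_apply, inner_smul_left, h.inner_gradient_eq_zero hx.1 hx.2 hv]
      simp
  -- An orthonormal basis whose vector `b 0` is the normal; the other vectors span the tangent
  -- space.
  obtain ⟨b, hb⟩ := Orthonormal.exists_orthonormalBasis_extension_of_card_eq (𝕜 := ℝ)
    (E := Euc (k + 1)) (ι := Fin (k + 1)) (by simp) (v := fun _ => N p) (s := {0}) (by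
      refine ⟨fun _ => hN1 p ⟨hp, hpV⟩, fun i j hij => absurd (Subsingleton.elim i j) hij⟩)
  have hb0 : b 0 = N p := hb 0 rfl
  have hbN : ∀ i : Fin k, inner ℝ (N p) (b i.succ) = 0 := fun i => by
    rw [← hb0]
    exact b.orthonormal.2 (Fin.succ_ne_zero i).symm
  have hbT : ∀ i : Fin k, b i.succ ∈ tangentSpaceAt S p := fun i =>
    h.mem_tangentSpaceAt hp hpV (hV p hpV) (hbN i)
  have hmin := hS.minimal p hp V _ h.isOpen hpV hunit (fun i : Fin k => (ψ p)⁻¹ • b i.succ)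
    (fun i => Submodule.smul_mem _ _ (hbT i)) (fun i j => by
      rw [schwarzschildMetric_apply, inner_smul_left, inner_smul_right,
        orthonormal_iff_ite.1 b.orthonormal, ← hψdef]
      have := hψ0 p
      simp only [Fin.succ_inj]
      split_ifs
      · simp
        field_simp
      · simp)
  have hψd : HasFDerivAt ψ (fderiv ℝ ψ p) p :=
    ((hψc.contDiffAt hVp).differentiableAt (by simp)).hasFDerivAt
  have hNd : HasFDerivAt N (fderiv ℝ N p) p :=
    ((hNc.contDiffAt hVp).differentiableAt (by simp)).hasFDerivAt
  have hinvd : HasFDerivAt (fun x => (ψ x)⁻¹) (-(ψ p ^ 2)⁻¹ • fderiv ℝ ψ p) p :=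
    (hasDerivAt_inv (hψ0 p)).comp_hasFDerivAt p hψd
  have hN'd : fderiv ℝ (fun x => (ψ x)⁻¹ • N x) p = _ := (hinvd.smul hNd).fderiv
  have hGd : fderiv ℝ (schwarzschildMetric (k + 1) m) p = _ :=
    (hasFDerivAt_smul_vector (hψd.pow 2) (euclideanMetric (k + 1) p)).fderiv
  -- The conformal change of the second fundamental form: each principal direction acquires the same
  -- extra term `ψ⁻² dψ(N)` from the Christoffel symbols.
  have hterm : ∀ i : Fin k, covDerivInner (schwarzschildMetric (k + 1) m) (fun x => (ψ x)⁻¹ • N x) p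
      ((ψ p)⁻¹ • b i.succ) ((ψ p)⁻¹ • b i.succ) =
      (ψ p)⁻¹ * inner ℝ (b i.succ) (fderiv ℝ N p (b i.succ)) + (ψ p ^ 2)⁻¹ * fderiv ℝ ψ p (N p) := by
    intro i
    have h1 : inner ℝ (b i.succ) (b i.succ) = (1 : ℝ) := by
      rw [orthonormal_iff_ite.1 b.orthonormal, if_pos rfl]
    have h2 := hbN i
    have h3 := real_inner_comm (N p) (b i.succ)
    have h4 := real_inner_comm (fderiv ℝ N p (b i.succ)) (b i.succ)
    have h5 := hψ0 p
    rw [covDerivInner, schwarzschildMetric_apply, hGd, hN'd, ← hψdef]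
    simp only [add_apply, smul_apply, ContinuousLinearMap.smulRight_apply, map_smul,
      smul_eq_mul, inner_add_left, inner_smul_left, inner_smul_right, euclideanMetric_apply, h1, h2, h3,
      h4]
    simp
    field_simp
  simp_rw [hterm] at hmin
  rw [Finset.sum_add_distrib, ← Finset.mul_sum, Finset.sum_const, Finset.card_univ, nsmul_eq_mul] at hmin
  rw [divergence_eq_sum b, Fin.sum_univ_succ, hb0, real_inner_comm, add_sub_cancel_left]
  have h5 := hψ0 p
  simp only [Nat.add_sub_cancel, Fintype.card_fin] at hmin
  field_simp at hmin ⊢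
  rw [mul_zero] at hmin
  exact eq_neg_of_add_eq_zero_left hmin

theorem divergence_sub {n : ℕ} {Y Z : Euc n → Euc n} {x : Euc n} (hY : DifferentiableAt ℝ Y x)
    (hZ : DifferentiableAt ℝ Z x) :
    divergence (fun x => Y x - Z x) x = divergence Y x - divergence Z x := by
  rw [divergence, fderiv_fun_sub hY hZ]
  exact map_sub (LinearMap.trace ℝ (Euc n)) _ _

theorem divergence_id {n : ℕ} (x : Euc n) : divergence (fun x : Euc n => x) x = n := by
  rw [divergence_eq_sum (EuclideanSpace.basisFun (Fin n) ℝ), fderiv_fun_id]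
  simp

theorem contDiff_of_contDiffAt_tsupport {E F : Type*} [NormedAddCommGroup E] [NormedSpace ℝ E]
    [NormedAddCommGroup F] [NormedSpace ℝ F] {r : WithTop ℕ∞} {g : E → F}
    (h : ∀ x ∈ tsupport g, ContDiffAt ℝ r g x) : ContDiff ℝ r g := by
  refine contDiff_iff_contDiffAt.2 fun x => ?_
  by_cases hx : x ∈ tsupport g
  · exact h x hx
  · exact contDiffAt_const.congr_of_eventuallyEq (notMem_tsupport_iff_eventuallyEq.1 hx)

/-- The integrand of the first variation of the Schwarzschild area of `S` along the multiple `β` of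
the position field. -/
def firstVariation {n : ℕ} (m : ℝ) (k : ℕ) (S : Set (Euc n)) (β : Euc n → ℝ) (x : Euc n) : ℝ :=
  conformalFactor n m x ^ k * (k * β x * (1 + fderiv ℝ (conformalFactor n m) x x /
    conformalFactor n m x) + fderiv ℝ β x (tangentialPart S x))

/-- The coefficient `inner N N`, equal to one on `S`, makes the field orthogonal to the gradient off
`S` as well, as `integral_divergence_levelSet` demands; on `S` the field is `β ψ^k x^T`. Since `‖N‖
= 1` along `S`, its full divergence there agrees with the tangential one, and `divergence_gradient`
replaces the trace of the Hessian by the derivative of `ψ`. -/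
theorem IsFreeBoundaryMinimal.divergence_smul_eq {k : ℕ} {m : ℝ} (hm : 0 < m)
    {S V : Set (Euc (k + 1))}
    (hS : IsFreeBoundaryMinimal (k + 1) m S) {Φ : Euc (k + 1) → ℝ}
    (h : IsDefining (horizonRadius (k + 1) m) S V Φ)
    (hV : ∀ x ∈ V, horizonRadius (k + 1) m < ‖x‖)
    (hN : ∀ x ∈ V, Φ x = 0 → ‖gradient Φ x‖ = 1) {p : Euc (k + 1)} (hpV : p ∈ V) (hp : p ∈ S)
    {β : Euc (k + 1) → ℝ} (hβ : DifferentiableAt ℝ β p) :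
    divergence (fun x => (β x * conformalFactor (k + 1) m x ^ k) •
      (inner ℝ (gradient Φ x) (gradient Φ x) • x - inner ℝ (gradient Φ x) x • gradient Φ x)) p =
      firstVariation m k S β p := by
  have hH := hS.divergence_gradient hm h hV hN hpV hp
  set ψ := conformalFactor (k + 1) m with hψdef
  set N := gradient Φ with hNdef
  have hp0 : p ≠ 0 := norm_pos_iff.1 ((horizonRadius_pos hm).trans (hV p hpV))
  have hψ0 : ψ p ≠ 0 := (conformalFactor_pos hm p).ne'
  have hψd : HasFDerivAt ψ (fderiv ℝ ψ p) p :=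
    ((contDiffAt_conformalFactor hm hp0).differentiableAt (by simp)).hasFDerivAt
  have hVp := h.isOpen.mem_nhds hpV
  have hNd : HasFDerivAt N (fderiv ℝ N p) p :=
    (((contDiffOn_gradient h.isOpen h.contDiffOn).contDiffAt hVp).differentiableAt
      (by simp)).hasFDerivAt
  have hΦ2 : ContDiffAt ℝ 2 Φ p := contDiffAt_infty.1 (h.contDiffOn.contDiffAt hVp) 2
  have hN1 : ‖N p‖ = 1 := hN p hpV ((h.mem_iff p hpV).1 hp).1
  have hN2 : inner ℝ (N p) (N p) = (1 : ℝ) := by rw [real_inner_self_eq_norm_sq, hN1, one_pow]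
  have hT : tangentialPart S p = p - inner ℝ (N p) p • N p := by
    rw [h.tangentialPart_eq hp hpV fun h' => absurd h' (hV p hpV).ne', ← hNdef, hN1, one_pow,
      div_one]
  have hNNd := hNd.inner ℝ hNd
  have hNxd : HasFDerivAt (fun x => inner ℝ (N x) x) _ p := hNd.inner ℝ (hasFDerivAt_id p)
  -- Differentiate `‖N‖² = 1` along `S`.
  have htan : ∀ v ∈ tangentSpaceAt S p, inner ℝ (fderiv ℝ N p v) (N p) = (0 : ℝ) := by
    intro v hv
    have h1 := apply_eq_zero_of_mem_tangentSpaceAt (p := p) (S := S)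
      (hNNd.sub_const (1 : ℝ)) (sub_eq_zero.2 hN2)
      (by
        filter_upwards [self_mem_nhdsWithin, mem_nhdsWithin_of_mem_nhds hVp] with y hy hyV
        rw [real_inner_self_eq_norm_sq, hN y hyV ((h.mem_iff y hyV).1 hy).1, one_pow, sub_self]) hv
    have h2 := real_inner_comm (fderiv ℝ N p v) (N p)
    simp [fderivInnerCLM_apply] at h1
    linarith
  have hTmem : p - inner ℝ (N p) p • N p ∈ tangentSpaceAt S p := by
    rw [← hT]
    exact Submodule.starProjection_apply_mem _ _
  have h1 : inner ℝ (fderiv ℝ N p p) (N p) =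
      inner ℝ (N p) p * inner ℝ (fderiv ℝ N p (N p)) (N p) := by
    have h2 := htan _ hTmem
    rw [map_sub, map_smul, inner_sub_left, inner_smul_left, sub_eq_zero] at h2
    simpa using h2
  have h2 : inner ℝ (fderiv ℝ N p (N p)) p =
      inner ℝ (N p) p * inner ℝ (fderiv ℝ N p (N p)) (N p) := by
    rw [inner_fderiv_gradient_comm hΦ2, h1]
  have hA : DifferentiableAt ℝ (fun x => inner ℝ (N x) (N x) • x) p :=
    hNNd.differentiableAt.smul differentiableAt_id
  have hB : DifferentiableAt ℝ (fun x => inner ℝ (N x) x • N x) p :=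
    hNxd.differentiableAt.smul hNd.differentiableAt
  have hAd : divergence (fun x => inner ℝ (N x) (N x) • x) p =
      (k + 1) + 2 * (inner ℝ (N p) p * inner ℝ (fderiv ℝ N p (N p)) (N p)) := by
    rw [divergence_smul hNNd.differentiableAt differentiableAt_fun_id, divergence_id, hN2, hNNd.fderiv,
      ← h1]
    have h3 := real_inner_comm (fderiv ℝ N p p) (N p)
    simp [fderivInnerCLM_apply, h3]
    ring
  have hBd : divergence (fun x => inner ℝ (N x) x • N x) p =
      inner ℝ (N p) p * divergence N p +
        (1 + inner ℝ (N p) p * inner ℝ (fderiv ℝ N p (N p)) (N p)) := by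
    rw [divergence_smul hNxd.differentiableAt hNd.differentiableAt, ← h2]
    have h3 : fderiv ℝ (fun x => inner ℝ (N x) x) p = _ := hNxd.fderiv
    rw [h3]
    simp [fderivInnerCLM_apply, hN1]
  have hbd : HasFDerivAt (fun x => β x * ψ x ^ k) _ p := hβ.hasFDerivAt.mul (hψd.pow k)
  have hAB : DifferentiableAt ℝ (fun x => (inner ℝ (N x) (N x) : ℝ) • x - (inner ℝ (N x) x : ℝ) • N x) p :=
    hA.sub hB
  rw [divergence_smul hbd.differentiableAt hAB, divergence_sub hA hB, hAd, hBd,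
    firstVariation, ← hψdef, hT, hN2, one_smul]
  have h3 : fderiv ℝ (fun x => β x * ψ x ^ k) p = _ := hbd.fderiv
  have h4 : inner ℝ (fderiv ℝ N p (N p)) (N p) = divergence N p +
      k * (fderiv ℝ ψ p (N p) / ψ p) := by linarith
  rw [h3, h4]
  simp only [add_apply, smul_apply, map_sub, map_smul, smul_eq_mul, nsmul_eq_mul]
  -- The power rule brings in `ψ ^ (k - 1)` with truncated subtraction.
  rcases k with _ | k
  · simp
    exact Or.inr (by ring)
  · simp only [Nat.add_sub_cancel, pow_succ]
    field_simp
    push_cast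
    ring

theorem IsFreeBoundaryMinimal.exists_firstVariation_eq_zero {k : ℕ} {m : ℝ} (hm : 0 < m)
    {S : Set (Euc (k + 1))} (hS : IsFreeBoundaryMinimal (k + 1) m S) {p : Euc (k + 1)}
    (hpR : horizonRadius (k + 1) m < ‖p‖) :
    ∃ V : Set (Euc (k + 1)), IsOpen V ∧ p ∈ V ∧ ∀ β : Euc (k + 1) → ℝ, ContDiff ℝ ∞ β →
      HasCompactSupport β → tsupport β ⊆ V →
      IntegrableOn (firstVariation m k S β) S (Measure.euclideanHausdorffMeasure k) ∧
      ∫ x in S, firstVariation m k S β x ∂Measure.euclideanHausdorffMeasure k = 0 := by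
  have hzero : ∀ {β : Euc (k + 1) → ℝ} {x}, x ∉ tsupport β → firstVariation m k S β x = 0 := by
    intro β x hx
    rw [firstVariation, image_eq_zero_of_notMem_tsupport hx, fderiv_of_notMem_tsupport ℝ hx]
    simp
  have hSm : MeasurableSet S := hS.isClosed.measurableSet
  by_cases hp : p ∈ S
  · obtain ⟨V₀, Φ₀, hpV₀, hdef₀, hV₀⟩ := hS.exists_isDefining hm hp
    obtain ⟨V, Φ, hVV, hpV, hdef, hN⟩ := hdef₀.exists_normalized hpV₀ hp
    have hVR : ∀ x ∈ V, horizonRadius (k + 1) m < ‖x‖ := fun x hx => hV₀ hpR x (hVV hx)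
    refine ⟨V, hdef.isOpen, hpV, fun β hβ hβc hβV => ?_⟩
    have hNc := contDiffOn_gradient hdef.isOpen hdef.contDiffOn
    set Z : Euc (k + 1) → Euc (k + 1) := fun x => (β x * conformalFactor (k + 1) m x ^ k) •
      (inner ℝ (gradient Φ x) (gradient Φ x) • x - inner ℝ (gradient Φ x) x • gradient Φ x) with hZdef
    have hZsub : tsupport Z ⊆ tsupport β :=
      (tsupport_smul_subset_left _ _).trans (tsupport_mul_subset_left (f := β))
    have hψc : ContDiffOn ℝ ∞ (conformalFactor (k + 1) m) V := fun x hx =>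
      (contDiffAt_conformalFactor hm (norm_pos_iff.1
        ((horizonRadius_pos hm).trans (hVR x hx)))).contDiffWithinAt
    have hZV : ContDiffOn ℝ ∞ Z V := (hβ.contDiffOn.mul (hψc.pow k)).smul
      (((hNc.inner ℝ hNc).smul contDiffOn_id).sub ((hNc.inner ℝ contDiffOn_id).smul hNc))
    have hZ : ContDiff ℝ ∞ Z := contDiff_of_contDiffAt_tsupport fun x hx =>
      hZV.contDiffAt (hdef.isOpen.mem_nhds (hβV (hZsub hx)))
    have hdiv := integral_divergence_levelSet rfl hdef.isOpen hdef.contDiffOn hN hZ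
      (hβc.of_isClosed_subset (isClosed_tsupport Z) hZsub) (hZsub.trans hβV) (fun x _ => by
        rw [← inner_gradient, hZdef, inner_smul_right, inner_sub_right, inner_smul_right,
          inner_smul_right]
        ring)
    have hset : {x | x ∈ V ∧ Φ x = 0} = S ∩ V := by
      ext x
      constructor
      · exact fun hx => ⟨(hdef.mem_iff x hx.1).2 ⟨hx.2, (hVR x hx.1).le⟩, hx.1⟩
      · exact fun hx => ⟨hx.2, ((hdef.mem_iff x hx.2).1 hx.1).1⟩
    have hms : MeasurableSet (S ∩ V) := hSm.inter hdef.isOpen.measurableSet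
    have heq : EqOn (divergence Z) (firstVariation m k S β) (S ∩ V) := fun x hx =>
      hS.divergence_smul_eq hm hdef hVR hN hx.2 hx.1 (hβ.differentiable (by simp) x)
    rw [hset] at hdiv
    have hout : ∀ x ∈ S \ (S ∩ V), firstVariation m k S β x = 0 := fun x hx =>
      hzero fun h => hx.2 ⟨hx.1, hβV h⟩
    refine ⟨(hdiv.1.congr_fun heq hms).of_forall_sdiff_eq_zero hSm hout, ?_⟩
    rw [setIntegral_eq_of_subset_of_forall_sdiff_eq_zero hSm inter_subset_left hout,
      ← setIntegral_congr_fun hms heq, hdiv.2]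
  · refine ⟨Sᶜ, hS.isClosed.isOpen_compl, hp, fun β hβ hβc hβV => ?_⟩
    have h0 : EqOn (firstVariation m k S β) (fun _ => 0) S := fun x hx =>
      hzero fun h => hβV h hx
    exact ⟨integrableOn_zero.congr_fun h0.symm hSm, by
      rw [setIntegral_congr_fun hSm h0, integral_zero]⟩

/-- `firstVariation` is linear in `β`, so a smooth partition of unity on the support reduces the
claim to the local one. -/
theorem IsFreeBoundaryMinimal.integral_firstVariation {k : ℕ} {m : ℝ} (hm : 0 < m)
    {S : Set (Euc (k + 1))} (hS : IsFreeBoundaryMinimal (k + 1) m S)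
    {β : Euc (k + 1) → ℝ} (hβ : ContDiff ℝ ∞ β) (hβc : HasCompactSupport β)
    (hβR : ∀ x ∈ tsupport β, horizonRadius (k + 1) m < ‖x‖) :
    IntegrableOn (firstVariation m k S β) S (Measure.euclideanHausdorffMeasure k) ∧
    ∫ x in S, firstVariation m k S β x ∂Measure.euclideanHausdorffMeasure k = 0 := by
  choose! V hVo hpV hV using fun (p : Euc (k + 1)) (hp : p ∈ tsupport β) =>
    hS.exists_firstVariation_eq_zero hm (hβR p hp)
  obtain ⟨t, ht, htc⟩ := hβc.isCompact.elim_nhds_subcover V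
    fun p hp => (hVo p hp).mem_nhds (hpV p hp)
  obtain ⟨ρ, hρ⟩ := SmoothPartitionOfUnity.exists_isSubordinate (modelWithCornersSelf ℝ (Euc (k + 1)))
    (isClosed_tsupport β) (fun p : t => V p) (fun p => hVo p (ht p p.2))
    (fun x hx => by
      obtain ⟨p, hp, hx⟩ := mem_iUnion₂.1 (htc hx)
      exact mem_iUnion.2 ⟨⟨p, hp⟩, hx⟩)
  have hρd : ∀ i, ContDiff ℝ ∞ (ρ i) := fun i => (ρ i).contMDiff.contDiff
  have hρβ : ∀ i, ContDiff ℝ ∞ (fun x => ρ i x * β x) := fun i => (hρd i).mul hβ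
  have hi := fun i : t => hV i (ht i i.2) (fun x => ρ i x * β x) (hρβ i)
    (hβc.mul_left (f := ρ i)) ((tsupport_mul_subset_left (f := ρ i)).trans (hρ i))
  have hsum : ∀ x, ∑ i, ρ i x * β x = β x := fun x => by
    by_cases hx : x ∈ tsupport β
    · rw [← Finset.sum_mul, ← finsum_eq_sum_of_fintype, ρ.sum_eq_one hx, one_mul]
    · simp [image_eq_zero_of_notMem_tsupport hx]
  have hfv : firstVariation m k S β = fun x => ∑ i, firstVariation m k S (fun x => ρ i x * β x) x := by
    funext x
    have h1 : fderiv ℝ β x = ∑ i, fderiv ℝ (fun x => ρ i x * β x) x := by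
      rw [← fderiv_fun_sum fun i _ => (hρβ i).differentiable (by simp) x]
      congr 1
      funext y
      exact (hsum y).symm
    simp only [firstVariation]
    rw [← Finset.mul_sum, Finset.sum_add_distrib, h1, sum_apply,
      ← Finset.sum_mul, ← Finset.mul_sum, hsum]
  rw [hfv]
  refine ⟨integrable_finsetSum _ fun i _ => (hi i).1, ?_⟩
  rw [integral_finsetSum _ fun i _ => (hi i).1]
  exact Finset.sum_eq_zero fun i _ => (hi i).2

/-! ### The Schwarzschild metric in the radial coordinate -/

/-- The conformal factor as a function of the Euclidean radius. -/
def radialFactor (n : ℕ) (m R : ℝ) : ℝ := (1 + m / (2 * R ^ (n - 2))) ^ (2 / ((n : ℝ) - 2))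

theorem conformalFactor_eq {n : ℕ} {m : ℝ} (x : Euc n) :
    conformalFactor n m x = radialFactor n m ‖x‖ := rfl

/-- The areal radius as a function of the Euclidean radius. -/
def arealRadius (n : ℕ) (m R : ℝ) : ℝ := R * radialFactor n m R

/-- The static potential as a function of the Euclidean radius. -/
def lapse (n : ℕ) (m R : ℝ) : ℝ := (1 - m / (2 * R ^ (n - 2))) / (1 + m / (2 * R ^ (n - 2)))

/-- The distance to the horizon as a function of the Euclidean radius. -/
def radialDist (n : ℕ) (m R : ℝ) : ℝ := ∫ t in (horizonRadius n m)..R, radialFactor n m t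

section Radial

variable {n : ℕ} {m R : ℝ}

theorem natCast_sub_two (hn : 3 ≤ n) : ((n - 2 : ℕ) : ℝ) = (n : ℝ) - 2 := by
  rw [Nat.cast_sub (by omega)]
  norm_num

theorem sub_two_pos (hn : 3 ≤ n) : 0 < (n : ℝ) - 2 := by
  have : (3 : ℝ) ≤ n := by exact_mod_cast hn
  linarith

theorem horizonRadius_pow (hn : 3 ≤ n) (hm : 0 < m) : horizonRadius n m ^ (n - 2) = m / 2 := by
  rw [horizonRadius, ← Real.rpow_natCast, ← Real.rpow_mul (by positivity), natCast_sub_two hn,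
    one_div_mul_cancel (sub_two_pos hn).ne', Real.rpow_one]

theorem radialFactor_pos (hm : 0 < m) (hR : 0 ≤ R) : 0 < radialFactor n m R :=
  Real.rpow_pos_of_pos (by positivity) _

theorem one_le_radialFactor (hn : 3 ≤ n) (hm : 0 < m) (hR : 0 ≤ R) : 1 ≤ radialFactor n m R :=
  Real.one_le_rpow (le_add_of_nonneg_right (by positivity)) (div_nonneg two_pos.le (sub_two_pos hn).le)

theorem radialFactor_pow (hn : 3 ≤ n) (hm : 0 < m) (hR : 0 ≤ R) :
    radialFactor n m R ^ (n - 2) = (1 + m / (2 * R ^ (n - 2))) ^ 2 := by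
  rw [radialFactor, ← Real.rpow_natCast, ← Real.rpow_mul (by positivity), natCast_sub_two hn,
    div_mul_cancel₀ _ (sub_two_pos hn).ne', Real.rpow_two]

/-- The logarithmic derivative `R ψ'/ψ` is `f - 1`. This is the source of the divergence of the
position field and of the equation for the areal radius. -/
theorem hasDerivAt_radialFactor (hn : 3 ≤ n) (hm : 0 < m) (hR : 0 < R) :
    HasDerivAt (radialFactor n m) ((lapse n m R - 1) * radialFactor n m R / R) R := by
  have h0 : 2 * R ^ (n - 2) ≠ 0 := by positivity
  have h1 : 1 + m / (2 * R ^ (n - 2)) ≠ 0 := by positivity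
  have h2 : HasDerivAt (fun R : ℝ => 1 + m / (2 * R ^ (n - 2)))
      (-(m * (2 * ((n - 2 : ℕ) * R ^ (n - 2 - 1)))) / (2 * R ^ (n - 2)) ^ 2) R := by
    have := ((hasDerivAt_const R m).div ((hasDerivAt_pow (n - 2) R).const_mul 2) h0).const_add 1
    simpa using this
  have h3 := h2.rpow_const (p := 2 / ((n : ℝ) - 2)) (Or.inl h1)
  refine h3.congr_deriv ?_
  have h4 := (sub_two_pos hn).ne'
  rw [Real.rpow_sub_one h1, radialFactor, lapse, natCast_sub_two hn]
  obtain ⟨k, rfl⟩ : ∃ k, n = k + 3 := ⟨n - 3, by omega⟩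
  have h5 : k + 3 - 2 = k + 1 := by omega
  simp only [h5, Nat.add_sub_cancel] at h1 ⊢
  set A := (1 + m / (2 * R ^ (k + 1))) ^ (2 / (((k + 3 : ℕ) : ℝ) - 2)) with hA
  clear_value A
  have h7 : m + 2 * R ^ (k + 1) ≠ 0 := by positivity
  have h8 : 2 * R ^ (k + 1) + m ≠ 0 := by positivity
  field_simp
  ring

/-- With `dr = ψ dR` this reads `ds/dr = f`. -/
theorem hasDerivAt_arealRadius (hn : 3 ≤ n) (hm : 0 < m) (hR : 0 < R) :
    HasDerivAt (arealRadius n m) (lapse n m R * radialFactor n m R) R := by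
  refine ((hasDerivAt_id R).mul (hasDerivAt_radialFactor hn hm hR)).congr_deriv ?_
  simp only [id]
  field_simp
  ring

theorem lapse_pos (hn : 3 ≤ n) (hm : 0 < m) (hR : horizonRadius n m < R) : 0 < lapse n m R := by
  have h0 := horizonRadius_pos (n := n) hm
  have h1 : m / 2 < R ^ (n - 2) := by
    rw [← horizonRadius_pow hn hm]
    exact pow_lt_pow_left₀ hR h0.le (by omega)
  have h2 : m / (2 * R ^ (n - 2)) < 1 := by
    rw [div_lt_one (by have := h0.trans hR; positivity)]
    linarith
  have : 0 < R := h0.trans hR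
  exact div_pos (by linarith) (by positivity)

theorem lapse_nonneg (hn : 3 ≤ n) (hm : 0 < m) (hR : horizonRadius n m ≤ R) : 0 ≤ lapse n m R := by
  rcases hR.eq_or_lt with h | h
  · rw [lapse, ← h, horizonRadius_pow hn hm]
    have : m / (2 * (m / 2)) = 1 := by field_simp
    simp [this]
  · exact (lapse_pos hn hm h).le

theorem lapse_le_one (hm : 0 < m) (hR : 0 ≤ R) : lapse n m R ≤ 1 := by
  have : 0 ≤ m / (2 * R ^ (n - 2)) := by positivity
  rw [lapse, div_le_one (by positivity)]
  linarith

theorem arealRadius_pow (hn : 3 ≤ n) (hm : 0 < m) (hR : 0 ≤ R) :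
    arealRadius n m R ^ (n - 2) = R ^ (n - 2) * (1 + m / (2 * R ^ (n - 2))) ^ 2 := by
  rw [arealRadius, mul_pow, radialFactor_pow hn hm hR]

/-- With `y = m / (2 R^(n-2))` one has `s^(n-2) = R^(n-2) (1+y)²` and `2m = 4 y R^(n-2)`, and `1 -
4y/(1+y)²` is the square of `(1-y)/(1+y)`. -/
theorem sqrt_eq_lapse (hn : 3 ≤ n) (hm : 0 < m) (hR : horizonRadius n m ≤ R) :
    √(1 - 2 * m / arealRadius n m R ^ (n - 2)) = lapse n m R := by
  have h0 : 0 < R := (horizonRadius_pos hm).trans_le hR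
  have h1 : 1 - 2 * m / arealRadius n m R ^ (n - 2) = lapse n m R ^ 2 := by
    rw [arealRadius_pow hn hm h0.le, lapse]
    have : 0 < R ^ (n - 2) := by positivity
    field_simp
    ring
  rw [h1, Real.sqrt_sq (lapse_nonneg hn hm hR)]

theorem arealRadius_horizonRadius (hn : 3 ≤ n) (hm : 0 < m) :
    arealRadius n m (horizonRadius n m) = arealRadiusMin n m := by
  have h : m / (2 * (m / 2)) = 1 := by field_simp
  have h2 : (2 : ℝ) / (n - 2) = 2 * (1 / (n - 2)) := by ring
  rw [arealRadius, radialFactor, horizonRadius_pow hn hm, h, horizonRadius, arealRadiusMin, h2,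
    Real.rpow_mul (by norm_num), ← Real.mul_rpow (by positivity) (by positivity)]
  congr 1
  norm_num
  ring

theorem continuousOn_radialFactor (hn : 3 ≤ n) (hm : 0 < m) : ContinuousOn (radialFactor n m) (Ioi 0) :=
  fun _ hR => (hasDerivAt_radialFactor hn hm hR).continuousAt.continuousWithinAt

theorem continuousOn_arealRadius (hn : 3 ≤ n) (hm : 0 < m) : ContinuousOn (arealRadius n m) (Ioi 0) :=
  continuousOn_id.mul (continuousOn_radialFactor hn hm)

theorem strictMonoOn_arealRadius (hn : 3 ≤ n) (hm : 0 < m) :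
    StrictMonoOn (arealRadius n m) (Ici (horizonRadius n m)) := by
  have h0 := horizonRadius_pos (n := n) hm
  refine strictMonoOn_of_deriv_pos (convex_Ici _)
    ((continuousOn_arealRadius hn hm).mono fun R hR => h0.trans_le hR) fun R hR => ?_
  rw [interior_Ici] at hR
  rw [(hasDerivAt_arealRadius hn hm (h0.trans hR)).deriv]
  exact mul_pos (lapse_pos hn hm hR) (radialFactor_pos hm (h0.trans hR).le)

theorem le_arealRadius (hn : 3 ≤ n) (hm : 0 < m) (hR : 0 ≤ R) : R ≤ arealRadius n m R :=
  le_mul_of_one_le_right hR (one_le_radialFactor hn hm hR)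

theorem intervalIntegrable_radialFactor (hn : 3 ≤ n) (hm : 0 < m) {a b : ℝ} (ha : 0 < a)
    (hb : 0 < b) : IntervalIntegrable (radialFactor n m) volume a b :=
  ((continuousOn_radialFactor hn hm).mono fun _ ht =>
    (lt_min ha hb).trans_le ht.1).intervalIntegrable

theorem hasStrictDerivAt_radialDist (hn : 3 ≤ n) (hm : 0 < m) (hR : 0 < R) :
    HasStrictDerivAt (radialDist n m) (radialFactor n m R) R := by
  have hc : ContinuousOn (radialFactor n m) (Ioi 0) := continuousOn_radialFactor hn hm
  refine intervalIntegral.integral_hasStrictDerivAt_right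
    (intervalIntegrable_radialFactor hn hm (horizonRadius_pos hm) hR)
    (hc.stronglyMeasurableAtFilter isOpen_Ioi R hR) (hc.continuousAt (Ioi_mem_nhds hR))

theorem radialDist_horizonRadius : radialDist n m (horizonRadius n m) = 0 :=
  intervalIntegral.integral_same

theorem strictMonoOn_radialDist (hn : 3 ≤ n) (hm : 0 < m) :
    StrictMonoOn (radialDist n m) (Ici (horizonRadius n m)) := by
  have h0 := horizonRadius_pos (n := n) hm
  refine strictMonoOn_of_deriv_pos (convex_Ici _) (fun R hR => (hasStrictDerivAt_radialDist hn hm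
    (h0.trans_le hR)).hasDerivAt.continuousAt.continuousWithinAt) fun R hR => ?_
  rw [interior_Ici] at hR
  rw [(hasStrictDerivAt_radialDist hn hm (h0.trans hR)).hasDerivAt.deriv]
  exact radialFactor_pos hm (h0.trans hR).le

theorem sub_le_radialDist (hn : 3 ≤ n) (hm : 0 < m) (hR : horizonRadius n m ≤ R) :
    R - horizonRadius n m ≤ radialDist n m R := by
  have h0 := horizonRadius_pos (n := n) hm
  have h := intervalIntegral.integral_mono_on (f := fun _ => (1 : ℝ)) hR intervalIntegrable_const
    (intervalIntegrable_radialFactor hn hm h0 (h0.trans_le hR)) fun t ht =>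
    one_le_radialFactor hn hm (h0.le.trans ht.1)
  rw [intervalIntegral.integral_const, smul_eq_mul, mul_one] at h
  exact h

/-- Substitute the areal radius: `ds = f ψ dR`, and the integrand is `1/f`. -/
theorem radialF_arealRadius (hn : 3 ≤ n) (hm : 0 < m) (hR : horizonRadius n m ≤ R) :
    radialF n m (arealRadius n m R) = radialDist n m R := by
  have h0 := horizonRadius_pos (n := n) hm
  have hmono := strictMonoOn_arealRadius hn hm
  have hle : arealRadius n m (horizonRadius n m) ≤ arealRadius n m R :=
    hmono.monotoneOn (mem_Ici.2 le_rfl) hR hR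
  have him : arealRadius n m '' Ioo (horizonRadius n m) R =
      Ioo (arealRadius n m (horizonRadius n m)) (arealRadius n m R) := by
    refine Subset.antisymm ?_ ?_
    · rintro _ ⟨t, ht, rfl⟩
      exact ⟨hmono (mem_Ici.2 le_rfl) ht.1.le ht.1, hmono ht.1.le hR ht.2⟩
    · exact intermediate_value_Ioo hR ((continuousOn_arealRadius hn hm).mono fun t ht =>
        h0.trans_le ht.1)
  -- The integrand of `radialF` is singular at `s₀`, where `f` vanishes. On open intervals the
  -- change of variables for images applies and asks for no integrability.
  rw [radialF, ← arealRadius_horizonRadius hn hm, intervalIntegral.integral_of_le hle,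
    integral_Ioc_eq_integral_Ioo, ← him,
    integral_image_eq_integral_abs_deriv_smul measurableSet_Ioo
      (fun t ht => (hasDerivAt_arealRadius hn hm (h0.trans ht.1)).hasDerivWithinAt)
      (hmono.injOn.mono fun t ht => ht.1.le), radialDist, intervalIntegral.integral_of_le hR,
    integral_Ioc_eq_integral_Ioo]
  refine setIntegral_congr_fun measurableSet_Ioo fun t ht => ?_
  have h1 := lapse_pos hn hm ht.1
  have h2 := radialFactor_pos (n := n) hm (h0.trans ht.1).le
  simp only [smul_eq_mul]
  rw [sqrt_eq_lapse hn hm ht.1.le, abs_of_pos (mul_pos h1 h2)]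
  field_simp

theorem surjOn_arealRadius (hn : 3 ≤ n) (hm : 0 < m) :
    SurjOn (arealRadius n m) (Ici (horizonRadius n m)) (Ici (arealRadiusMin n m)) := by
  intro s hs
  have h0 := horizonRadius_pos (n := n) hm
  have h1 : horizonRadius n m ≤ max s (horizonRadius n m) := le_max_right _ _
  have h := intermediate_value_Icc h1 ((continuousOn_arealRadius hn hm).mono fun t ht =>
    h0.trans_le ht.1)
  obtain ⟨R, hR, hRs⟩ := h ⟨by rw [arealRadius_horizonRadius hn hm]; exact hs,
    (le_max_left _ _).trans (le_arealRadius hn hm (h0.le.trans h1))⟩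
  exact ⟨R, hR.1, hRs⟩

theorem radialH_radialDist (hn : 3 ≤ n) (hm : 0 < m) (hR : horizonRadius n m ≤ R) :
    radialH n m (radialDist n m R) = arealRadius n m R := by
  have hinj : InjOn (radialF n m) (Ici (arealRadiusMin n m)) := by
    intro s hs t ht hst
    obtain ⟨a, ha, rfl⟩ := surjOn_arealRadius hn hm hs
    obtain ⟨b, hb, rfl⟩ := surjOn_arealRadius hn hm ht
    rw [radialF_arealRadius hn hm ha, radialF_arealRadius hn hm hb] at hst
    rw [(strictMonoOn_radialDist hn hm).injOn ha hb hst]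
  have hmem : arealRadius n m R ∈ Ici (arealRadiusMin n m) := by
    rw [← arealRadius_horizonRadius hn hm]
    exact (strictMonoOn_arealRadius hn hm).monotoneOn (mem_Ici.2 le_rfl) hR hR
  rw [radialH, ← radialF_arealRadius hn hm hR]
  exact hinj.leftInvOn_invFunOn hmem

/-- Near an interior radius, `h` is the areal radius composed with the inverse of `radialDist`, so
`h' = f ψ / ψ`. The horizon itself is left out; it is a null set of `S`. -/
theorem derivWithin_radialH (hn : 3 ≤ n) (hm : 0 < m) (hR : horizonRadius n m < R) :
    derivWithin (radialH n m) (Ici 0) (radialDist n m R) = lapse n m R := by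
  have h0 := horizonRadius_pos (n := n) hm
  have hR0 := h0.trans hR
  have hψ := radialFactor_pos (n := n) hm hR0.le
  have hst := hasStrictDerivAt_radialDist hn hm hR0
  set L := hst.localInverse _ _ _ hψ.ne' with hL
  have hLd : HasStrictDerivAt L (radialFactor n m R)⁻¹ (radialDist n m R) :=
    hst.to_localInverse hψ.ne'
  have hLR : L (radialDist n m R) = R :=
    (hst.hasStrictFDerivAt_equiv hψ.ne').localInverse_apply_image
  have hright : ∀ᶠ y in 𝓝 (radialDist n m R), radialDist n m (L y) = y :=
    (hst.hasStrictFDerivAt_equiv hψ.ne').eventually_right_inverse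
  have hgt : ∀ᶠ y in 𝓝 (radialDist n m R), horizonRadius n m < L y :=
    hLd.hasDerivAt.continuousAt.eventually (by rw [hLR]; exact lt_mem_nhds hR)
  have heq : radialH n m =ᶠ[𝓝 (radialDist n m R)] arealRadius n m ∘ L := by
    filter_upwards [hright, hgt] with y h1 h2
    rw [Function.comp_apply, ← radialH_radialDist hn hm h2.le, h1]
  have hd : HasDerivAt (radialH n m) (lapse n m R) (radialDist n m R) := by
    refine HasDerivAt.congr_of_eventuallyEq ?_ heq
    have h1 := hasDerivAt_arealRadius hn hm hR0
    rw [← hLR] at h1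
    refine (h1.comp _ hLd.hasDerivAt).congr_deriv ?_
    rw [hLR]
    field_simp
  have hpos : 0 < radialDist n m R := by
    rw [← radialDist_horizonRadius (n := n) (m := m)]
    exact strictMonoOn_radialDist hn hm (mem_Ici.2 le_rfl) hR.le hR
  rw [derivWithin_of_mem_nhds (Ici_mem_nhds hpos), hd.deriv]

/-- The left side, times the dimension, is the Schwarzschild divergence of the position field along
a submanifold. -/
theorem fderiv_conformalFactor_self (hn : 3 ≤ n) (hm : 0 < m) {x : Euc n} (hx : x ≠ 0) :
    1 + fderiv ℝ (conformalFactor n m) x x / conformalFactor n m x = lapse n m ‖x‖ := by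
  have hx0 := norm_pos_iff.2 hx
  have h1 : HasFDerivAt (conformalFactor n m) _ x :=
    (hasDerivAt_radialFactor hn hm hx0).comp_hasFDerivAt x (hasStrictFDerivAt_norm hx).hasFDerivAt
  rw [h1.fderiv, conformalFactor_eq]
  have h2 := (radialFactor_pos (n := n) hm hx0.le).ne'
  simp
  field_simp
  ring

end Radial

/-! ### The distance to the horizon -/

section Distance

variable {n : ℕ} {m : ℝ}

theorem sqrt_schwarzschildMetric (hm : 0 < m) (x v : Euc n) :
    √(schwarzschildMetric n m x v v) = radialFactor n m ‖x‖ * ‖v‖ := by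
  rw [schwarzschildMetric_apply, real_inner_self_eq_norm_sq, ← mul_pow, conformalFactor_eq,
    Real.sqrt_sq (mul_nonneg (radialFactor_pos hm (norm_nonneg x)).le (norm_nonneg v))]

/-- By Cauchy–Schwarz, `radialDist` of the Euclidean radius grows along a path no faster than the
Schwarzschild speed. -/
theorem radialDist_le_length (hn : 3 ≤ n) (hm : 0 < m) {γ : ℝ → Euc n}
    (hγ : ContDiffOn ℝ 1 γ (Icc 0 1)) (hγs : ∀ t ∈ Icc (0 : ℝ) 1, γ t ∈ space n m)
    (hγ0 : γ 0 ∈ horizon n m) : radialDist n m ‖γ 1‖ ≤ length n m γ := by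
  have h0 := horizonRadius_pos (n := n) hm
  have hpos : ∀ t ∈ Icc (0 : ℝ) 1, 0 < ‖γ t‖ := fun t ht => h0.trans_le (hγs t ht)
  have hdist : ∀ {R}, 0 < R → HasDerivAt (radialDist n m) (radialFactor n m R) R := fun hR =>
    (hasStrictDerivAt_radialDist hn hm hR).hasDerivAt
  have hγc := hγ.continuousOn
  have hγ' : ContinuousOn (derivWithin γ (Icc 0 1)) (Icc 0 1) :=
    hγ.continuousOn_derivWithin (uniqueDiffOn_Icc zero_lt_one) le_rfl
  have h := intervalIntegral.sub_le_integral_of_hasDeriv_right_of_le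
    (g := fun t => radialDist n m ‖γ t‖)
    (g' := fun t => radialFactor n m ‖γ t‖ *
      innerSL ℝ (‖γ t‖⁻¹ • γ t) (derivWithin γ (Icc 0 1) t))
    (φ := fun t => radialFactor n m ‖γ t‖ * ‖derivWithin γ (Icc 0 1) t‖) zero_le_one
    (fun t ht => ContinuousAt.comp_continuousWithinAt (f := fun t => ‖γ t‖)
      (hdist (hpos t ht)).continuousAt (hγc.norm t ht))
    (fun t ht => by
      have ht' := Ioo_subset_Icc_self ht
      have hd : HasDerivAt γ (derivWithin γ (Icc 0 1) t) t :=
        ((hγ.differentiableOn one_ne_zero t ht').hasDerivWithinAt).hasDerivAt (Icc_mem_nhds ht.1 ht.2)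
      have hd2 := (hasStrictFDerivAt_norm (norm_pos_iff.1 (hpos t ht'))).hasFDerivAt.comp_hasDerivAt
        t hd
      exact ((hdist (hpos t ht')).comp t hd2).hasDerivWithinAt)
    (ContinuousOn.integrableOn_Icc (((continuousOn_radialFactor hn hm).comp hγc.norm
      fun t ht => hpos t ht).mul hγ'.norm))
    (fun t ht => by
      have ht' := Ioo_subset_Icc_self ht
      refine mul_le_mul_of_nonneg_left ?_ (radialFactor_pos hm (norm_nonneg _)).le
      rw [innerSL_apply_apply]
      refine (real_inner_le_norm _ _).trans_eq ?_
      rw [norm_smul, norm_inv, norm_norm, inv_mul_cancel₀ (hpos t ht').ne', one_mul])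
  have h00 : ‖γ 0‖ = horizonRadius n m := hγ0
  rw [h00, radialDist_horizonRadius, sub_zero] at h
  rw [length]
  simpa only [sqrt_schwarzschildMetric hm] using h

theorem horizonDist_eq (hn : 3 ≤ n) (hm : 0 < m) {x : Euc n} (hx : x ∈ space n m) :
    horizonDist n m x = radialDist n m ‖x‖ := by
  have h0 := horizonRadius_pos (n := n) hm
  have hxR : horizonRadius n m ≤ ‖x‖ := hx
  have hx0 : 0 < ‖x‖ := h0.trans_le hxR
  refine IsLeast.csInf_eq ⟨?_, ?_⟩
  · set R₀ := horizonRadius n m with hR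
    set e := ‖x‖⁻¹ • x with he
    have hen : ‖e‖ = 1 := by rw [he, norm_smul, norm_inv, norm_norm, inv_mul_cancel₀ hx0.ne']
    set c := ‖x‖ - R₀ with hc
    have hc0 : 0 ≤ c := sub_nonneg.2 hxR
    have hγn : ∀ t, 0 ≤ t → ‖(c * t + R₀) • e‖ = c * t + R₀ := fun t ht => by
      rw [norm_smul, hen, mul_one, Real.norm_of_nonneg (by positivity)]
    have hd : ∀ t, HasDerivAt (fun t : ℝ => (c * t + R₀) • e) (c • e) t := fun t => by
      have := (((hasDerivAt_id t).const_mul c).add_const R₀).smul_const e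
      simpa using this
    -- The radial segment attains the infimum.
    refine ⟨fun t => (c * t + R₀) • e, ?_, fun t ht => ?_, ?_, ?_, ?_⟩
    · exact (((contDiff_const.mul contDiff_id).add contDiff_const).smul contDiff_const).contDiffOn
    · change R₀ ≤ ‖(c * t + R₀) • e‖
      rw [hγn t ht.1]
      have := mul_nonneg hc0 ht.1
      linarith
    · change ‖(c * 0 + R₀) • e‖ = R₀
      rw [hγn 0 le_rfl, mul_zero, zero_add]
    · simp only [mul_one, hc, sub_add_cancel, he]
      rw [smul_smul, mul_inv_cancel₀ hx0.ne', one_smul]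
    · have h1 : length n m (fun t => (c * t + R₀) • e) =
          ∫ t in (0 : ℝ)..1, c * radialFactor n m (c * t + R₀) := by
        refine intervalIntegral.integral_congr fun t ht => ?_
        rw [uIcc_of_le zero_le_one] at ht
        simp only
        rw [sqrt_schwarzschildMetric hm, hγn t ht.1,
          ((hd t).hasDerivWithinAt).derivWithin (uniqueDiffOn_Icc zero_lt_one t ht), norm_smul, hen,
          Real.norm_of_nonneg hc0]
        ring
      have h2 := intervalIntegral.smul_integral_comp_mul_add (a := 0) (b := 1) (radialFactor n m) c R₀
      rw [h1, intervalIntegral.integral_const_mul, ← smul_eq_mul, h2, mul_zero, zero_add, mul_one, hc,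
        sub_add_cancel, radialDist]
  · rintro L ⟨γ, hγ, hγs, hγ0, hγ1, rfl⟩
    rw [← hγ1]
    exact radialDist_le_length hn hm hγ hγs hγ0

theorem ball_radialDist (hn : 3 ≤ n) (hm : 0 < m) {R : ℝ} (hR : horizonRadius n m ≤ R) :
    ball n m (radialDist n m R) = {x | horizonRadius n m ≤ ‖x‖ ∧ ‖x‖ ≤ R} := by
  ext x
  refine and_congr_right fun hx => ?_
  rw [horizonDist_eq hn hm hx]
  exact (strictMonoOn_radialDist hn hm).le_iff_le hx hR

theorem staticPotential_eq (hn : 3 ≤ n) (hm : 0 < m) {x : Euc n} (hx : horizonRadius n m < ‖x‖) :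
    staticPotential n m x = lapse n m ‖x‖ := by
  rw [staticPotential, horizonDist_eq hn hm (le_of_lt hx : x ∈ space n m), derivWithin_radialH hn hm hx]

theorem radialH_horizonDist (hn : 3 ≤ n) (hm : 0 < m) {x : Euc n} (hx : x ∈ space n m) :
    radialH n m (horizonDist n m x) = arealRadius n m ‖x‖ := by
  rw [horizonDist_eq hn hm hx, radialH_radialDist hn hm hx]

theorem radialNormalSq_eq (hm : 0 < m) {S : Set (Euc n)} {x : Euc n} (hx : x ≠ 0) :
    radialNormalSq n m S x = 1 - ‖tangentialPart S x‖ ^ 2 / ‖x‖ ^ 2 := by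
  have hx0 := norm_pos_iff.2 hx
  have hψ := radialFactor_pos (n := n) hm (norm_nonneg x)
  have h1 := Submodule.norm_sq_eq_add_norm_sq_starProjection x (tangentSpaceAt S x)
  rw [radialNormalSq, radialUnit, sqrt_schwarzschildMetric hm, map_smul, schwarzschildMetric_apply,
    inner_smul_left, inner_smul_right, real_inner_self_eq_norm_sq, tangentialPart, conformalFactor_eq,
    eq_sub_of_add_eq' h1.symm]
  simp
  field_simp

theorem norm_tangentialPart_le (S : Set (Euc n)) (x : Euc n) : ‖tangentialPart S x‖ ≤ ‖x‖ :=
  Submodule.norm_starProjection_apply_le _ _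

theorem inner_tangentialPart (S : Set (Euc n)) (x : Euc n) :
    inner ℝ x (tangentialPart S x) = ‖tangentialPart S x‖ ^ 2 := by
  rw [tangentialPart, ← real_inner_self_eq_norm_sq, real_inner_comm]
  conv_rhs => rw [Submodule.inner_starProjection_left_eq_right]
  rw [Submodule.starProjection_eq_self_iff.2 (Submodule.starProjection_apply_mem _ _),
    Submodule.inner_starProjection_left_eq_right]

end Distance

/-! ### Cones -/

/-- The Euclidean distance in polar coordinates. For radii near one it is almost the product
distance, which yields the charts of cones. -/
theorem dist_sq_smul_smul {n : ℕ} {v w : Euc n} (hv : ‖v‖ = 1) (hw : ‖w‖ = 1) (s t : ℝ) :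
    dist (s • v) (t • w) ^ 2 = (s - t) ^ 2 + s * t * dist v w ^ 2 := by
  rw [dist_eq_norm, dist_eq_norm, @norm_sub_sq_real, @norm_sub_sq_real, norm_smul, norm_smul, hv, hw,
    inner_smul_left, inner_smul_right]
  simp only [mul_one, Real.norm_eq_abs, sq_abs, conj_trivial]
  ring

/-- Near an interior point, a submanifold of codimension `c` has an almost isometric chart. -/
theorem IsInteriorPoint.exists_chart {n c k : ℕ} (hn : c + k = n) {Γ : Set (Euc n)} {p : Euc n}
    (hp : IsInteriorPoint c Γ p) {K : NNReal} (hK : 1 < K) :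
    ∃ (f : Euc n →L[ℝ] EuclideanSpace ℝ (Fin k)) (U : Set (Euc n)) (r : ℝ), IsOpen U ∧ p ∈ U ∧
      0 < r ∧ (∀ x ∈ Γ ∩ U, ∀ y ∈ Γ ∩ U, dist x y ≤ K * dist (f x) (f y) ∧
        dist (f x) (f y) ≤ K * dist x y) ∧
      ∀ b ∈ Metric.ball (f p) r, ∃ x ∈ Γ ∩ U, f x = b := by
  obtain ⟨hpΓ, V, hV, hpV, Φ, hΦ, hsurj, hΓV⟩ := hp
  have hΦp := (hΦ.contDiffAt (hV.mem_nhds hpV)).hasStrictFDerivAt (by simp)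
  set L := fderiv ℝ Φ p with hL
  set T : Submodule ℝ (Euc n) := LinearMap.ker (L : Euc n →ₗ[ℝ] Fin c → ℝ) with hT
  have hLP : ∀ v, L (Tᗮ.starProjection v) = L v := fun v => by
    have h1 : Tᗮ.starProjection v = v - T.starProjection v := by
      rw [eq_sub_iff_add_eq, add_comm]
      exact T.starProjection_add_starProjection_orthogonal v
    have h2 : L (T.starProjection v) = 0 :=
      LinearMap.mem_ker.1 (Submodule.starProjection_apply_mem T v)
    rw [h1, map_sub, h2, sub_zero]
  -- The differential of `Φ` is only surjective. Composed with the inverse of its restriction to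
  -- `Tᗮ` it becomes the orthogonal projection to `Tᗮ`, a coisometry.
  let L₁ : Tᗮ →ₗ[ℝ] Fin c → ℝ := (L : Euc n →ₗ[ℝ] Fin c → ℝ).comp Tᗮ.subtype
  have hbij : Function.Bijective L₁ := by
    refine ⟨(injective_iff_map_eq_zero L₁).2 fun v hv => ?_, fun y => ?_⟩
    · have h1 : (v : Euc n) ∈ T := LinearMap.mem_ker.2 hv
      have h2 := (Submodule.mem_orthogonal _ _).1 v.2 v h1
      exact Subtype.ext (inner_self_eq_zero.1 h2)
    · obtain ⟨v, rfl⟩ := hsurj y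
      exact ⟨⟨Tᗮ.starProjection v, Submodule.starProjection_apply_mem _ _⟩, hLP v⟩
  let Q : Tᗮ ≃L[ℝ] (Fin c → ℝ) := (LinearEquiv.ofBijective L₁ hbij).toContinuousLinearEquiv
  have hQ : ∀ v, Q.symm (L v) = Tᗮ.orthogonalProjectionOnto v := fun v => by
    rw [Q.symm_apply_eq]
    exact (hLP v).symm
  have hu : HasStrictFDerivAt (fun x => Q.symm (Φ x)) ((Q.symm : (Fin c → ℝ) →L[ℝ] Tᗮ).comp L) p :=
    (Q.symm : (Fin c → ℝ) →L[ℝ] Tᗮ).hasStrictFDerivAt.comp p hΦp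
  have hrank : Module.finrank ℝ Tᗮ = c := by
    rw [Q.toLinearEquiv.finrank_eq]
    simp
  obtain ⟨f, U, r, hU, hpU, hUV, hr, hd, hs⟩ := Schwarzschild.exists_chart (k := k)
    (by rw [hrank, hn]) hu (B := fun y => (y : Euc n))
    (fun y => by
      change Q.symm (L y) = y
      rw [hQ]
      exact Submodule.orthogonalProjectionOnto_mem_subspace_eq_self y)
    (fun y v => by
      change _ = inner ℝ y (Q.symm (L v))
      rw [hQ]
      have h2 := Submodule.starProjection_inner_eq_zero (K := Tᗮ) v y y.2
      rw [inner_sub_left, sub_eq_zero, real_inner_comm] at h2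
      rw [h2, real_inner_comm]
      rfl) hK (hV.mem_nhds hpV)
  have hzero : ∀ x ∈ U, x ∈ Γ ↔ Φ x = 0 := fun x hx => by
    have := Set.ext_iff.1 hΓV x
    simp only [mem_inter_iff, hUV hx, and_true, mem_ofPred_eq, true_and] at this
    exact this
  refine ⟨f, U, r, hU, hpU, hr, fun x hx y hy => ?_, fun b hb => ?_⟩
  · have h1 := hd x hx.2 y hy.2
    rw [(hzero x hx.2).1 hx.1, (hzero y hy.2).1 hy.1] at h1
    simpa [Real.sqrt_sq_eq_abs] using h1
  · obtain ⟨x, hx, h1, h2⟩ := hs 0 (by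
      rw [(hzero p hpU).1 hpΓ, map_zero]
      exact Metric.mem_ball_self hr) b hb
    have h3 : Φ x = 0 := by
      have := congrArg Q h1
      simpa using this
    exact ⟨x, ⟨(hzero x hx).2 h3, hx⟩, h2⟩

/-- A piece of the cone over a subset of the unit sphere. -/
def radialCone {n : ℕ} (Γ : Set (Euc n)) (a b : ℝ) : Set (Euc n) :=
  {x | a ≤ ‖x‖ ∧ ‖x‖ < b ∧ ‖x‖⁻¹ • x ∈ Γ}

/-- The chart is `(‖x‖ - 1, f (x/‖x‖))`, where `f` is a chart of `Γ` with a constant `K' < K`. For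
`1 ≤ ‖x‖ < 1 + δ` the radial scaling distorts distances by at most `1 + δ`. -/
theorem hasTubeChart_cone {n k : ℕ} (hn : 2 + k = n) {Γ : Set (Euc n)}
    (hΓs : Γ ⊆ Metric.sphere 0 1) {p : Euc n} (hp : IsInteriorPoint 2 Γ p) {a : ℝ}
    (ha : a ≤ 1) {K : NNReal} (hK : 1 < K) :
    HasTubeChart {x | a ≤ ‖x‖ ∧ ‖x‖⁻¹ • x ∈ Γ} (fun x => ‖x‖ - 1) (fun _ => 1) k K p := by
  obtain ⟨K', hK', hKK'⟩ := exists_between hK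
  obtain ⟨f, U, r, hU, hpU, hr, hd, hs⟩ := hp.exists_chart hn hK'
  have hp1 : ‖p‖ = 1 := by simpa using hΓs hp.1
  have hK'0 : (0 : ℝ) < K' := by exact_mod_cast zero_lt_one.trans hK'
  have hK'1 : (1 : ℝ) < K' := by exact_mod_cast hK'
  have hKK : (K' : ℝ) < K := by exact_mod_cast hKK'
  -- Chosen so that `(1 + δ) K' = K`.
  set δ : ℝ := K / K' - 1 with hδ
  have hδ0 : 0 < δ := by
    rw [hδ, sub_pos, one_lt_div hK'0]
    exact hKK
  have hδK : (1 + δ) * K' = K := by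
    rw [hδ]
    field_simp
    ring
  have hcont : ContinuousOn (fun x : Euc n => ‖x‖⁻¹ • x) {x | x ≠ 0} :=
    (continuousOn_id.norm.inv₀ fun x hx => norm_ne_zero_iff.2 hx).smul continuousOn_id
  set O : Set (Euc n) := {x | x ≠ 0} ∩ (fun x : Euc n => ‖x‖⁻¹ • x) ⁻¹' U with hO
  have hOo : IsOpen O := hcont.isOpen_inter_preimage isOpen_ne hU
  have hs1 : ∀ y ∈ Γ, ‖y‖ = 1 := fun y hy => by simpa using hΓs hy
  have hfp : (fun x : Euc n => f (‖x‖⁻¹ • x)) p = f p := by simp [hp1]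
  refine ⟨O ∩ {x | ‖x‖ < 1 + δ}, fun x => f (‖x‖⁻¹ • x), 1, min r δ,
    hOo.inter (isOpen_lt continuous_norm continuous_const), ⟨⟨?_, ?_⟩, ?_⟩,
    (f.continuous.comp_continuousOn hcont).mono fun x hx => hx.1.1, one_pos, lt_min hr hδ0,
    fun x _ _ => ⟨?_, ?_⟩, fun x hx y hy hx0 hy0 => ?_, fun y hy s hs' => ?_⟩
  · change p ≠ 0
    rw [← norm_ne_zero_iff, hp1]
    exact one_ne_zero
  · change ‖p‖⁻¹ • p ∈ U
    rwa [hp1, inv_one, one_smul]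
  · change ‖p‖ < 1 + δ
    linarith
  · rw [mul_one]
    exact_mod_cast hK.le
  · rw [mul_one]
    exact_mod_cast hK.le
  · rw [dist_halfModel, div_one, div_one]
    have hxn : ‖x‖ ≠ 0 := norm_ne_zero_iff.2 hx.2.1.1
    have hyn : ‖y‖ ≠ 0 := norm_ne_zero_iff.2 hy.2.1.1
    have h1 := hd _ ⟨hx.1.2, hx.2.1.2⟩ _ ⟨hy.1.2, hy.2.1.2⟩
    have h2 := dist_sq_smul_smul (hs1 _ hx.1.2) (hs1 _ hy.1.2) ‖x‖ ‖y‖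
    rw [smul_smul, smul_smul, mul_inv_cancel₀ hxn, mul_inv_cancel₀ hyn, one_smul, one_smul] at h2
    set D := dist (‖x‖⁻¹ • x) (‖y‖⁻¹ • y)
    set d := dist (f (‖x‖⁻¹ • x)) (f (‖y‖⁻¹ • y))
    have hD : 0 ≤ D := dist_nonneg
    have hd0 : 0 ≤ d := dist_nonneg
    have hx1 : ‖x‖ < 1 + δ := hx.2.2
    have hy1 : ‖y‖ < 1 + δ := hy.2.2
    have hst : ‖x‖ * ‖y‖ ≤ (1 + δ) ^ 2 := by
      rw [sq]
      exact mul_le_mul hx1.le hy1.le (norm_nonneg _) (by linarith)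
    have hst1 : 1 ≤ ‖x‖ * ‖y‖ := one_le_mul_of_one_le_of_one_le (by linarith) (by linarith)
    have hK1 : 1 ≤ (K : ℝ) ^ 2 := one_le_pow₀ (by exact_mod_cast hK.le)
    have hsub : ‖x‖ - 1 - (‖y‖ - 1) = ‖x‖ - ‖y‖ := by ring
    rw [hsub]
    constructor
    · rw [← abs_of_nonneg (dist_nonneg (x := x) (y := y)), ← Real.sqrt_sq_eq_abs,
        ← Real.sqrt_sq (NNReal.coe_nonneg K), ← Real.sqrt_mul (sq_nonneg _)]
      refine Real.sqrt_le_sqrt ?_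
      rw [h2, mul_add]
      refine add_le_add (le_mul_of_one_le_left (sq_nonneg _) hK1) ?_
      calc ‖x‖ * ‖y‖ * D ^ 2 ≤ (1 + δ) ^ 2 * (K' * d) ^ 2 :=
            mul_le_mul hst (pow_le_pow_left₀ hD h1.1 2) (sq_nonneg _) (sq_nonneg _)
        _ = K ^ 2 * d ^ 2 := by rw [← hδK]; ring
    · rw [← abs_of_nonneg (dist_nonneg (x := x) (y := y)), ← Real.sqrt_sq_eq_abs,
        ← Real.sqrt_sq (NNReal.coe_nonneg K), ← Real.sqrt_mul (sq_nonneg _)]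
      refine Real.sqrt_le_sqrt ?_
      rw [h2, mul_add]
      refine add_le_add (le_mul_of_one_le_left (sq_nonneg _) hK1) ?_
      calc d ^ 2 ≤ (K' * D) ^ 2 := pow_le_pow_left₀ hd0 h1.2 2
        _ = K' ^ 2 * (1 * D ^ 2) := by ring
        _ ≤ K ^ 2 * (‖x‖ * ‖y‖ * D ^ 2) := by
          refine mul_le_mul (pow_le_pow_left₀ hK'0.le hKK.le 2)
            (mul_le_mul_of_nonneg_right hst1 (sq_nonneg _)) (by positivity) (sq_nonneg _)
  · rw [hfp] at hy
    obtain ⟨e, he, hey⟩ := hs y (Metric.ball_subset_ball (min_le_left _ _) hy)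
    have he1 := hs1 e he.1
    have hs0 : 0 ≤ s := hs'.1
    have hsδ : s < δ := hs'.2.trans_le (min_le_right _ _)
    have hn1 : ‖(1 + s) • e‖ = 1 + s := by
      rw [norm_smul, he1, mul_one, Real.norm_of_nonneg (by linarith)]
    have hdir : ‖(1 + s) • e‖⁻¹ • (1 + s) • e = e := by
      rw [hn1, smul_smul, inv_mul_cancel₀ (by linarith), one_smul]
    refine ⟨(1 + s) • e, ⟨⟨?_, ?_⟩, ⟨?_, ?_⟩, ?_⟩, ?_, ?_⟩
    · rw [hn1]
      linarith
    · rw [hdir]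
      exact he.1
    · change (1 + s) • e ≠ 0
      rw [← norm_ne_zero_iff, hn1]
      linarith
    · change ‖(1 + s) • e‖⁻¹ • (1 + s) • e ∈ U
      rw [hdir]
      exact he.2
    · change ‖(1 + s) • e‖ < 1 + δ
      rw [hn1]
      linarith
    · simp only
      rw [hdir, hey]
    · change ‖(1 + s) • e‖ - 1 = 1 * s
      rw [hn1]
      ring

theorem isClosed_cone {n : ℕ} {Γ : Set (Euc n)} (hΓ : IsClosed Γ) {a : ℝ} (ha : 0 < a) :
    IsClosed {x : Euc n | a ≤ ‖x‖ ∧ ‖x‖⁻¹ • x ∈ Γ} := by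
  have h1 : IsClosed {x : Euc n | a ≤ ‖x‖} := isClosed_le continuous_const continuous_norm
  have h2 : ContinuousOn (fun x : Euc n => ‖x‖⁻¹ • x) {x | a ≤ ‖x‖} :=
    (continuousOn_id.norm.inv₀ fun x hx => (ha.trans_le hx).ne').smul continuousOn_id
  exact h2.preimage_isClosed_of_isClosed h1 hΓ

theorem radialCone_eq_inter {n : ℕ} (Γ : Set (Euc n)) (a b : ℝ) :
    radialCone Γ a b = {x : Euc n | a ≤ ‖x‖ ∧ ‖x‖⁻¹ • x ∈ Γ} ∩ {x | ‖x‖ < b} := by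
  ext x
  exact ⟨fun h => ⟨⟨h.1, h.2.2⟩, h.2.1⟩, fun h => ⟨h.1.1, h.2, h.1.2⟩⟩

theorem measurableSet_radialCone {n : ℕ} {Γ : Set (Euc n)} (hΓ : IsClosed Γ) {a : ℝ} (ha : 0 < a)
    (b : ℝ) : MeasurableSet (radialCone Γ a b) := by
  rw [radialCone_eq_inter]
  exact (isClosed_cone hΓ ha).measurableSet.inter
    (isOpen_lt continuous_norm continuous_const).measurableSet

open scoped Pointwise in
theorem smul_radialCone {n : ℕ} (Γ : Set (Euc n)) (a b : ℝ) {c : ℝ} (hc : 0 < c) :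
    c • radialCone Γ a b = radialCone Γ (c * a) (c * b) := by
  ext x
  rw [mem_smul_set_iff_inv_smul_mem₀ hc.ne']
  have h1 : ‖c⁻¹ • x‖ = c⁻¹ * ‖x‖ := by rw [norm_smul, norm_inv, Real.norm_of_nonneg hc.le]
  have h2 : ‖c⁻¹ • x‖⁻¹ • c⁻¹ • x = ‖x‖⁻¹ • x := by
    rw [h1, smul_smul, mul_inv, inv_inv, mul_right_comm, mul_inv_cancel₀ hc.ne', one_mul]
  simp only [radialCone, mem_ofPred_eq, h2]
  rw [h1, le_inv_mul_iff₀ hc, inv_mul_lt_iff₀ hc]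

open scoped Pointwise in
theorem euclideanHausdorffMeasure_radialCone_mul {n d : ℕ} (Γ : Set (Euc n)) (a b : ℝ) {c : ℝ}
    (hc : 0 < c) : (Measure.euclideanHausdorffMeasure d : Measure (Euc n))
      (radialCone Γ (c * a) (c * b)) =
      ENNReal.ofReal (c ^ d) * (Measure.euclideanHausdorffMeasure d : Measure (Euc n))
        (radialCone Γ a b) := by
  rw [← smul_radialCone _ _ _ hc, Measure.euclideanHausdorffMeasure_smul₀ d hc.ne', ENNReal.smul_def,
    smul_eq_mul, ENNReal.coe_pow, ENNReal.ofReal_pow hc.le]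
  congr 2
  exact (ofReal_norm c).symm.trans (by rw [Real.norm_of_nonneg hc.le])

theorem measure_radialCone_add {n : ℕ} {μ : Measure (Euc n)} {Γ : Set (Euc n)} (hΓ : IsClosed Γ)
    {a b c : ℝ} (hb : 0 < b) (hab : a ≤ b) (hbc : b ≤ c) :
    μ (radialCone Γ a c) = μ (radialCone Γ a b) + μ (radialCone Γ b c) := by
  rw [← measure_union _ (measurableSet_radialCone hΓ hb c)]
  · congr 1
    ext x
    simp only [radialCone, mem_union, mem_ofPred_eq]
    constructor
    · rintro ⟨h1, h2, h3⟩
      rcases lt_or_ge ‖x‖ b with h | h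
      · exact Or.inl ⟨h1, h, h3⟩
      · exact Or.inr ⟨h, h2, h3⟩
    · rintro (⟨h1, h2, h3⟩ | ⟨h1, h2, h3⟩)
      · exact ⟨h1, h2.trans_le hbc, h3⟩
      · exact ⟨hab.trans h1, h2, h3⟩
  · exact Set.disjoint_left.2 fun x hx hx' => (hx.2.1.trans_le hx'.1).false

namespace IsClosedMinimalInSphere

variable {k : ℕ} {Γ : Set (Euc (k + 2))}

/-- A chart maps a piece of `Γ` by a 2-Lipschitz map onto a set containing a ball of `ℝ^k`. -/
theorem sphereArea_pos (hΓ : IsClosedMinimalInSphere (k + 2) Γ) : 0 < sphereArea (k + 2) Γ := by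
  obtain ⟨p, hp⟩ := hΓ.nonempty
  obtain ⟨f, U, r, hU, hpU, hr, hd, hs⟩ := (hΓ.isHypersurface p hp).exists_chart
    (k := k) (by omega) one_lt_two
  have h1 : LipschitzOnWith 2 f (Γ ∩ U) := LipschitzOnWith.of_dist_le_mul fun x hx y hy =>
    (hd x hx y hy).2
  have h2 : Metric.ball (f p) r ⊆ f '' (Γ ∩ U) := fun b hb => by
    obtain ⟨x, hx, hxb⟩ := hs b hb
    exact ⟨x, hx, hxb⟩
  have h3 : 0 < (Measure.euclideanHausdorffMeasure k : Measure (EuclideanSpace ℝ (Fin k)))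
      (Metric.ball (f p) r) := by
    rw [EuclideanSpace.euclideanHausdorffMeasure_eq_volume k]
    exact Metric.measure_ball_pos _ _ hr
  have h4 := h3.trans_le ((measure_mono h2).trans (euclideanHausdorffMeasure_image_le h1 k))
  have h5 := (ENNReal.mul_pos_iff.1 h4).2
  exact h5.trans_le (measure_mono inter_subset_left)

/-- This is the tube formula for `w = ‖x‖ - 1`: with the indicator of `[0, 1)` as profile and a
cutoff `G` equal to one for `‖x‖ ≤ 2`, the tube integral for `ε < 1` is the volume of a conical
shell. -/
theorem tendsto_radialCone (hΓ : IsClosedMinimalInSphere (k + 2) Γ) :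
    sphereArea (k + 2) Γ ≠ ⊤ ∧
    Tendsto (fun ε : ℝ => (Measure.euclideanHausdorffMeasure (k + 1) : Measure (Euc (k + 2)))
      (radialCone Γ 1 (1 + ε)) / ENNReal.ofReal ε) (𝓝[>] 0) (𝓝 (sphereArea (k + 2) Γ)) := by
  set X : Set (Euc (k + 2)) := {x | 1 / 2 ≤ ‖x‖ ∧ ‖x‖⁻¹ • x ∈ Γ} with hX
  have hΓ1 : ∀ x ∈ Γ, ‖x‖ = 1 := fun x hx => by simpa using hΓ.subset_sphere hx
  have hXc : IsClosed X := isClosed_cone hΓ.isCompact.isClosed (by norm_num)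
  set G : Euc (k + 2) → ℝ := fun x => max 0 (min 1 (3 - ‖x‖)) with hG
  have hGc : Continuous G := by fun_prop
  have hG1 : ∀ x, ‖x‖ ≤ 2 → G x = 1 := fun x hx => by
    rw [hG]
    simp only
    rw [min_eq_left (by linarith), max_eq_right zero_le_one]
  have hGt : tsupport G ⊆ Metric.closedBall 0 3 := by
    refine closure_minimal (fun x hx => ?_) Metric.isClosed_closedBall
    by_contra h
    rw [mem_closedBall_zero_iff, not_le] at h
    refine hx ?_
    rw [hG]
    simp only
    rw [min_eq_right (by linarith), max_eq_left (by linarith)]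
  have hdir : ∀ x : Euc (k + 2), ‖x‖ = 1 → ‖x‖⁻¹ • x = x := fun x hx => by simp [hx]
  have hS0 : {x | x ∈ X ∧ ‖x‖ - 1 = 0} = Γ := by
    ext x
    constructor
    · rintro ⟨h1, h2⟩
      have := h1.2
      rwa [hdir x (by linarith)] at this
    · intro hx
      refine ⟨⟨?_, ?_⟩, ?_⟩
      · rw [hΓ1 x hx]
        norm_num
      · rwa [hdir x (hΓ1 x hx)]
      · rw [hΓ1 x hx, sub_self]
  have h := tendsto_tubeIntegral (k := k) (X := X) (w := fun x => ‖x‖ - 1) (W := fun _ => 1)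
    (κ := (Ico (0 : ℝ) 1).indicator 1) hXc.measurableSet (by fun_prop) aemeasurable_const
    (measurable_one.indicator measurableSet_Ico)
    (fun t ht => indicator_of_notMem (fun h => ht (Ico_subset_Icc_self h)) _)
    (by rw [lintegral_indicator_one measurableSet_Ico]; simp) hGc (fun x => le_max_left _ _)
    ((isCompact_closedBall 0 3).of_isClosed_subset (hXc.inter (isClosed_tsupport G))
      (inter_subset_right.trans hGt))
    (fun p hp hp0 K hK => by
      have hpΓ : p ∈ Γ := hS0 ▸ (⟨hp.1, hp0⟩ : p ∈ {x | x ∈ X ∧ ‖x‖ - 1 = 0})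
      exact hasTubeChart_cone (by omega) hΓ.subset_sphere (hΓ.isHypersurface p hpΓ) (by norm_num) hK)
  have hI : ∫⁻ x in Γ, ENNReal.ofReal (G x) ∂(Measure.euclideanHausdorffMeasure k : Measure _) =
      sphereArea (k + 2) Γ := by
    rw [setLIntegral_congr_fun (g := fun _ => 1) hΓ.isCompact.isClosed.measurableSet fun x hx => by
      simp [hG1 x (by rw [hΓ1 x hx]; norm_num)], setLIntegral_one]
    rfl
  rw [hS0, hI, lintegral_indicator_one measurableSet_Ico] at h
  refine ⟨h.1, ?_⟩
  have h2 := h.2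
  simp only [Real.volume_Ico, sub_zero, ENNReal.ofReal_one, one_mul] at h2
  refine h2.congr' ?_
  filter_upwards [Ioo_mem_nhdsGT (zero_lt_one (α := ℝ))] with ε hε
  congr 1
  rw [tubeIntegral]
  have hm : MeasurableSet {x | x ∈ X ∧ 0 ≤ ‖x‖ - 1} :=
    measurableSet_sep_of_continuousOn (w := fun x => ‖x‖ - 1) hXc.measurableSet (by fun_prop)
      measurableSet_Ici
  have hmc := measurableSet_radialCone hΓ.isCompact.isClosed one_pos (1 + ε)
  rw [← setLIntegral_one (radialCone Γ 1 (1 + ε)), ← lintegral_indicator hm,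
    ← lintegral_indicator hmc]
  refine lintegral_congr fun x => ?_
  by_cases hx : x ∈ radialCone Γ 1 (1 + ε)
  · have hx1 := hx.1
    have hx2 := hx.2.1
    have hx3 : x ∈ {x | x ∈ X ∧ 0 ≤ ‖x‖ - 1} := ⟨⟨by linarith, hx.2.2⟩, by linarith⟩
    have hx4 : (‖x‖ - 1) / ε ∈ Ico (0 : ℝ) 1 :=
      ⟨div_nonneg (by linarith) hε.1.le, (div_lt_one hε.1).2 (by linarith)⟩
    rw [indicator_of_mem hx, indicator_of_mem hx3, indicator_of_mem hx4, hG1 x (by linarith [hε.2])]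
    simp
  · rw [indicator_of_notMem hx]
    by_cases hx' : x ∈ {x | x ∈ X ∧ 0 ≤ ‖x‖ - 1}
    · rw [indicator_of_mem hx', indicator_of_notMem, zero_mul]
      intro h
      refine hx ⟨by linarith [hx'.2], ?_, hx'.1.2⟩
      have := (div_lt_one hε.1).1 h.2
      linarith
    · rw [indicator_of_notMem hx']

/-- Let `A(t)` be the measure of the shell from radius `1` to `t`. Cutting and scaling give `A(ab) =
A(a) + a^(k+1) A(b)`. Computing `A(R(1+ε))` in both orders gives `A(R) ((1+ε)^(k+1) - 1) = (R^(k+1)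
- 1) A(1+ε)`; divide by `ε` and let `ε → 0`. -/
theorem euclideanHausdorffMeasure_radialCone_one (hΓ : IsClosedMinimalInSphere (k + 2) Γ) {R : ℝ}
    (hR : 1 < R) :
    (Measure.euclideanHausdorffMeasure (k + 1) : Measure (Euc (k + 2))) (radialCone Γ 1 R) =
      ENNReal.ofReal ((R ^ (k + 1) - 1) * ((sphereArea (k + 2) Γ).toReal / (k + 1))) := by
  obtain ⟨hfin, hlim⟩ := hΓ.tendsto_radialCone
  set μ : Measure (Euc (k + 2)) := Measure.euclideanHausdorffMeasure (k + 1) with hμ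
  set A : ℝ → ℝ≥0∞ := fun t => μ (radialCone Γ 1 t) with hA
  have hadd : ∀ a b, 1 < a → 1 < b → A (a * b) = A a + ENNReal.ofReal (a ^ (k + 1)) * A b := by
    intro a b ha hb
    have h := euclideanHausdorffMeasure_radialCone_mul (d := k + 1) Γ 1 b (zero_lt_one.trans ha)
    rw [mul_one] at h
    simp only [hA]
    rw [← h, measure_radialCone_add hΓ.isCompact.isClosed (zero_lt_one.trans ha) ha.le
      (le_mul_of_one_le_right (zero_lt_one.trans ha).le hb.le)]
  have hmono : ∀ {a b}, a ≤ b → A a ≤ A b := fun hab =>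
    measure_mono fun x hx => ⟨hx.1, hx.2.1.trans_le hab, hx.2.2⟩
  have hev : ∀ᶠ ε : ℝ in 𝓝[>] 0, A (1 + ε) ≠ ⊤ := by
    filter_upwards [hlim.eventually (gt_mem_nhds hfin.lt_top)] with ε h1 h2
    rw [show μ (radialCone Γ 1 (1 + ε)) = ⊤ from h2, ENNReal.top_div_of_ne_top ENNReal.ofReal_ne_top]
      at h1
    exact h1.false
  -- Finiteness for a single `1 + ε` propagates to all its powers.
  have hAfin : ∀ a, A a ≠ ⊤ := by
    obtain ⟨ε, h1, h2⟩ := (hev.and self_mem_nhdsWithin).exists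
    have h2 : 0 < ε := h2
    have hpow : ∀ j : ℕ, A ((1 + ε) ^ (j + 1)) ≠ ⊤ := by
      intro j
      induction j with
      | zero => simpa using h1
      | succ j ih =>
        rw [pow_succ, hadd _ _ (one_lt_pow₀ (by linarith) (by omega)) (by linarith)]
        exact ENNReal.add_ne_top.2 ⟨ih, ENNReal.mul_ne_top ENNReal.ofReal_ne_top h1⟩
    intro a
    obtain ⟨j, hj⟩ := pow_unbounded_of_one_lt a (show 1 < 1 + ε by linarith)
    exact ne_top_of_le_ne_top (hpow j)
      (hmono (hj.le.trans (pow_le_pow_right₀ (by linarith) (by omega))))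
  have haddr : ∀ a b, 1 < a → 1 < b →
      (A (a * b)).toReal = (A a).toReal + a ^ (k + 1) * (A b).toReal := by
    intro a b ha hb
    rw [hadd a b ha hb, ENNReal.toReal_add (hAfin _)
      (ENNReal.mul_ne_top ENNReal.ofReal_ne_top (hAfin _)), ENNReal.toReal_mul,
      ENNReal.toReal_ofReal (by positivity)]
  have hlimr : Tendsto (fun ε : ℝ => (A (1 + ε)).toReal / ε) (𝓝[>] 0)
      (𝓝 (sphereArea (k + 2) Γ).toReal) := by
    refine ((ENNReal.tendsto_toReal hfin).comp hlim).congr' ?_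
    filter_upwards [self_mem_nhdsWithin] with ε hε
    rw [Function.comp_apply, ENNReal.toReal_div, ENNReal.toReal_ofReal (le_of_lt hε)]
  have hpow : Tendsto (fun ε : ℝ => ((1 + ε) ^ (k + 1) - 1) / ε) (𝓝[>] 0) (𝓝 ((k : ℝ) + 1)) := by
    have h1 : HasDerivAt (fun ε : ℝ => (1 + ε) ^ (k + 1)) ((k : ℝ) + 1) 0 := by
      refine (((hasDerivAt_id (0 : ℝ)).const_add 1).fun_pow (k + 1)).congr_deriv ?_
      simp
    refine ((hasDerivAt_iff_tendsto_slope_zero.1 h1).mono_left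
      (nhdsWithin_mono 0 fun x hx => ne_of_gt hx)).congr fun ε => ?_
    rw [zero_add, add_zero, one_pow, smul_eq_mul, inv_mul_eq_div]
  have hfun : Tendsto (fun ε : ℝ => (A R).toReal * (((1 + ε) ^ (k + 1) - 1) / ε)) (𝓝[>] 0)
      (𝓝 ((sphereArea (k + 2) Γ).toReal * (R ^ (k + 1) - 1))) := by
    refine (hlimr.mul_const (R ^ (k + 1) - 1)).congr' ?_
    filter_upwards [self_mem_nhdsWithin] with ε hε
    have hε : 0 < ε := hε
    have h1 := haddr R (1 + ε) hR (by linarith)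
    rw [mul_comm R, haddr (1 + ε) R (by linarith) hR] at h1
    field_simp
    linarith
  have heq := tendsto_nhds_unique hfun (hpow.const_mul (A R).toReal)
  change A R = _
  rw [← ENNReal.ofReal_toReal (hAfin R)]
  congr 1
  have : (k : ℝ) + 1 ≠ 0 := by positivity
  field_simp
  linarith

end IsClosedMinimalInSphere

/-! ### Volume growth -/

/-- Averages over large balls, of polynomial growth, do not change when the density tends to one. -/
theorem tendsto_setIntegral_closedBall_div_pow {n d : ℕ} (hd : d ≠ 0) {ν : Measure (Euc n)}
    (hν : ∀ R : ℝ, ν (Metric.closedBall 0 R) ≠ ⊤) {L : ℝ}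
    (hL : Tendsto (fun R : ℝ => ν.real (Metric.closedBall 0 R) / R ^ d) atTop (𝓝 L))
    {g : Euc n → ℝ} (hg : AEStronglyMeasurable g ν) {C : ℝ} (hC : ∀ᵐ x ∂ν, |g x| ≤ C)
    (hg1 : ∀ η : ℝ, 0 < η → ∃ R : ℝ, ∀ᵐ x ∂ν, R < ‖x‖ → |g x - 1| ≤ η) :
    Tendsto (fun R : ℝ => (∫ x in Metric.closedBall 0 R, g x ∂ν) / R ^ d) atTop (𝓝 L) := by
  have hgi : ∀ R : ℝ, IntegrableOn g (Metric.closedBall 0 R) ν := fun R =>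
    Measure.integrableOn_of_bounded (hν R) hg (ae_restrict_of_ae hC)
  have h1i : ∀ (c R : ℝ), IntegrableOn (fun _ => c) (Metric.closedBall (0 : Euc n) R) ν :=
    fun c R => integrableOn_const (hν R)
  rw [Metric.tendsto_atTop] at hL ⊢
  intro ε hε
  obtain ⟨R₂, hR₂⟩ := hL 1 one_pos
  have hL0 : 0 < |L| + 1 := by positivity
  set η : ℝ := ε / (4 * (|L| + 1)) with hη
  have hη0 : 0 < η := by positivity
  obtain ⟨R₁, hR₁⟩ := hg1 η hη0
  obtain ⟨R₃, hR₃⟩ := hL (ε / 4) (by positivity)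
  set M : ℝ := (|C| + 1) * ν.real (Metric.closedBall 0 R₁) with hM
  have hMlim : Tendsto (fun R : ℝ => M / R ^ d) atTop (𝓝 0) :=
    tendsto_const_nhds.div_atTop (tendsto_pow_atTop hd)
  obtain ⟨R₄, hR₄⟩ := Metric.tendsto_atTop.1 hMlim (ε / 4) (by positivity)
  refine ⟨max (max R₂ R₃) (max R₄ (max R₁ 1)), fun R hR => ?_⟩
  have hRR₂ : R₂ ≤ R := (le_max_left _ _).trans ((le_max_left _ _).trans hR)
  have hRR₃ : R₃ ≤ R := (le_max_right _ _).trans ((le_max_left _ _).trans hR)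
  have hRR₄ : R₄ ≤ R := (le_max_left _ _).trans ((le_max_right _ _).trans hR)
  have hRR₁ : R₁ ≤ R := (le_max_left _ _).trans ((le_max_right _ _).trans
    ((le_max_right _ _).trans hR))
  have hR1 : 1 ≤ R := (le_max_right _ _).trans ((le_max_right _ _).trans
    ((le_max_right _ _).trans hR))
  have hRd : 0 < R ^ d := by positivity
  have hsub : Metric.closedBall (0 : Euc n) R₁ ⊆ Metric.closedBall 0 R :=
    Metric.closedBall_subset_closedBall hRR₁
  -- Inside radius `R₁` the deviation of `g` from one is at most `|C| + 1`, a contribution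
  -- independent of `R`; outside it is at most `η`.
  have hdiff : |(∫ x in Metric.closedBall 0 R, g x ∂ν) - ν.real (Metric.closedBall 0 R)| ≤
      M + η * ν.real (Metric.closedBall 0 R) := by
    have h1 : (∫ x in Metric.closedBall 0 R, g x ∂ν) - ν.real (Metric.closedBall 0 R) =
        ∫ x in Metric.closedBall 0 R, (g x - 1) ∂ν := by
      rw [integral_sub (hgi R) (h1i 1 R), setIntegral_const, smul_eq_mul, mul_one]
    have hind : IntegrableOn ((Metric.closedBall (0 : Euc n) R₁).indicator fun _ => |C| + 1)
        (Metric.closedBall 0 R) ν := (h1i _ R).indicator measurableSet_closedBall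
    rw [h1, ← Real.norm_eq_abs]
    refine (norm_integral_le_of_norm_le (hind.add (h1i η R)) ?_).trans_eq ?_
    · filter_upwards [ae_restrict_of_ae hC, ae_restrict_of_ae hR₁] with x hx1 hx2
      rw [Pi.add_apply, Real.norm_eq_abs]
      by_cases hx : x ∈ Metric.closedBall (0 : Euc n) R₁
      · rw [indicator_of_mem hx]
        have h2 := abs_sub (g x) 1
        rw [abs_one] at h2
        linarith [le_abs_self C]
      · rw [indicator_of_notMem hx, zero_add]
        rw [mem_closedBall_zero_iff, not_le] at hx
        exact hx2 hx
    · refine (integral_add' hind (h1i η R)).trans ?_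
      rw [setIntegral_indicator measurableSet_closedBall, inter_eq_self_of_subset_right hsub,
        setIntegral_const, setIntegral_const, hM]
      simp only [smul_eq_mul]
      ring
  have h2 := hR₂ R hRR₂
  have h3 := hR₃ R hRR₃
  have h4 := hR₄ R hRR₄
  rw [Real.dist_eq] at h2 h3 h4 ⊢
  set N := ν.real (Metric.closedBall (0 : Euc n) R)
  set I := ∫ x in Metric.closedBall 0 R, g x ∂ν
  have h5 : |I / R ^ d - N / R ^ d| ≤ M / R ^ d + η * (N / R ^ d) := by
    rw [← sub_div, abs_div, abs_of_pos hRd, ← mul_div_assoc, ← add_div]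
    exact div_le_div_of_nonneg_right hdiff hRd.le
  have h6 : N / R ^ d ≤ |L| + 1 := by
    have := (abs_lt.1 h2).2
    linarith [le_abs_self L]
  have h7 : η * (N / R ^ d) ≤ ε / 4 := by
    calc η * (N / R ^ d) ≤ η * (|L| + 1) := mul_le_mul_of_nonneg_left h6 hη0.le
      _ = ε / 4 := by rw [hη]; field_simp
  have h8 : M / R ^ d < ε / 4 := by
    have := (abs_lt.1 h4).2
    linarith
  have h9 := abs_sub_le (I / R ^ d) (N / R ^ d) L
  linarith

theorem measurable_conformalFactor (n : ℕ) (m : ℝ) : Measurable (conformalFactor n m) := by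
  unfold conformalFactor
  fun_prop

theorem tendsto_radialFactor {n : ℕ} (hn : 3 ≤ n) (m : ℝ) :
    Tendsto (radialFactor n m) atTop (𝓝 1) := by
  have h1 : Tendsto (fun R : ℝ => 1 + m / (2 * R ^ (n - 2))) atTop (𝓝 (1 + 0)) :=
    (tendsto_const_nhds.div_atTop ((tendsto_pow_atTop (by omega)).const_mul_atTop two_pos)).const_add 1
  have h2 := h1.rpow_const (p := 2 / ((n : ℝ) - 2)) (Or.inl (by norm_num))
  rwa [add_zero, Real.one_rpow] at h2

theorem tendsto_lapse {n : ℕ} (hn : 3 ≤ n) (m : ℝ) : Tendsto (lapse n m) atTop (𝓝 1) := by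
  have h0 : Tendsto (fun R : ℝ => m / (2 * R ^ (n - 2))) atTop (𝓝 0) :=
    tendsto_const_nhds.div_atTop ((tendsto_pow_atTop (by omega)).const_mul_atTop two_pos)
  have h1 := (h0.const_sub 1).div (h0.const_add 1) (by norm_num)
  rwa [sub_zero, add_zero, div_one] at h1

theorem antitoneOn_radialFactor {n : ℕ} (hn : 3 ≤ n) {m : ℝ} (hm : 0 < m) :
    AntitoneOn (radialFactor n m) (Ioi 0) := by
  intro R hR R' hR' h
  have hR : 0 < R := hR
  refine Real.rpow_le_rpow (by have : (0 : ℝ) < R' := hR'; positivity) ?_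
    (div_nonneg two_pos.le (sub_two_pos hn).le)
  gcongr

theorem ae_forall_gt_of_tendsto {n : ℕ} {ν : Measure (Euc n)} {φ : ℝ → ℝ}
    (h : Tendsto φ atTop (𝓝 1)) (η : ℝ) (hη : 0 < η) :
    ∃ R : ℝ, ∀ᵐ x : Euc n ∂ν, R < ‖x‖ → |φ ‖x‖ - 1| ≤ η := by
  obtain ⟨R, hR⟩ := Metric.tendsto_atTop.1 h η hη
  exact ⟨R, ae_of_all _ fun x hx => (hR _ hx.le).le⟩

theorem tendsto_add_pow_sub_div_pow (a b : ℝ) {d : ℕ} (hd : d ≠ 0) :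
    Tendsto (fun R : ℝ => ((R + a) ^ d - b) / R ^ d) atTop (𝓝 1) := by
  have h1 : Tendsto (fun R : ℝ => (1 + a / R) ^ d - b / R ^ d) atTop (𝓝 ((1 + 0) ^ d - 0)) :=
    (((tendsto_const_nhds.div_atTop tendsto_id).const_add 1).pow d).sub
      (tendsto_const_nhds.div_atTop (tendsto_pow_atTop hd))
  rw [add_zero, one_pow, sub_zero] at h1
  refine h1.congr' ?_
  filter_upwards [eventually_gt_atTop 0] with R hR
  rw [sub_div, ← div_pow, add_div, div_self hR.ne']

theorem vol_toReal_eq {n : ℕ} {m : ℝ} (hm : 0 < m) (d : ℕ) {A : Set (Euc n)} (hA : MeasurableSet A) :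
    (vol n m d A).toReal =
      ∫ x in A, conformalFactor n m x ^ d ∂Measure.euclideanHausdorffMeasure d := by
  rw [vol, withDensity_apply _ hA, integral_eq_lintegral_of_nonneg_ae
    (ae_of_all _ fun x => pow_nonneg (conformalFactor_pos hm x).le d)
    ((measurable_conformalFactor n m).pow_const d).aestronglyMeasurable]

namespace IsClosedMinimalInSphere

variable {k : ℕ} {Γ : Set (Euc (k + 2))} {m : ℝ}

theorem euclideanHausdorffMeasure_radialCone (hΓ : IsClosedMinimalInSphere (k + 2) Γ) {a b : ℝ}
    (ha : 0 < a) (hab : a < b) :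
    (Measure.euclideanHausdorffMeasure (k + 1) : Measure (Euc (k + 2))) (radialCone Γ a b) =
      ENNReal.ofReal ((b ^ (k + 1) - a ^ (k + 1)) * ((sphereArea (k + 2) Γ).toReal / (k + 1))) := by
  have h := euclideanHausdorffMeasure_radialCone_mul (d := k + 1) Γ 1 (b / a) ha
  rw [mul_one, mul_div_cancel₀ _ ha.ne', hΓ.euclideanHausdorffMeasure_radialCone_one
    ((one_lt_div ha).2 hab), ← ENNReal.ofReal_mul (by positivity)] at h
  rw [h, ← mul_assoc]
  congr 2
  rw [div_pow]
  field_simp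

theorem cone_inter_ball (hm : 0 < m) (hk : 3 ≤ k + 2) (hΓ : IsClosedMinimalInSphere (k + 2) Γ) {R : ℝ}
    (hR : horizonRadius (k + 2) m ≤ R) :
    cone (k + 2) m Γ ∩ ball (k + 2) m (radialDist (k + 2) m R) =
      {x | horizonRadius (k + 2) m ≤ ‖x‖ ∧ ‖x‖⁻¹ • x ∈ Γ} ∩ Metric.closedBall 0 R := by
  have h0 := horizonRadius_pos (n := k + 2) hm
  rw [ball_radialDist hk hm hR]
  ext x
  rw [mem_inter_iff, mem_inter_iff, mem_closedBall_zero_iff]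
  constructor
  · rintro ⟨⟨⟨y, hy, l, hl, rfl⟩, hx⟩, h1, h2⟩
    have hy1 : ‖y‖ = 1 := by simpa using hΓ.subset_sphere hy
    refine ⟨⟨h1, ?_⟩, h2⟩
    rwa [norm_smul, hy1, mul_one, Real.norm_of_nonneg hl.le, smul_smul, inv_mul_cancel₀ hl.ne',
      one_smul]
  · rintro ⟨⟨h1, h2⟩, h3⟩
    have hx : 0 < ‖x‖ := h0.trans_le h1
    exact ⟨⟨⟨_, h2, ‖x‖, hx, by rw [smul_smul, mul_inv_cancel₀ hx.ne', one_smul]⟩, h1⟩, h1, h3⟩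

theorem tendsto_vol_cone (hm : 0 < m) (hk : 3 ≤ k + 2) (hΓ : IsClosedMinimalInSphere (k + 2) Γ) :
    Tendsto (fun R : ℝ => (vol (k + 2) m (k + 1) (cone (k + 2) m Γ ∩
      ball (k + 2) m (radialDist (k + 2) m R))).toReal / R ^ (k + 1)) atTop
      (𝓝 ((sphereArea (k + 2) Γ).toReal / (k + 1))) := by
  set R₀ := horizonRadius (k + 2) m with hR₀
  have h0 : 0 < R₀ := horizonRadius_pos hm
  set X : Set (Euc (k + 2)) := {x | R₀ ≤ ‖x‖ ∧ ‖x‖⁻¹ • x ∈ Γ} with hX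
  have hXc : IsClosed X := isClosed_cone hΓ.isCompact.isClosed h0
  set μ : Measure (Euc (k + 2)) := Measure.euclideanHausdorffMeasure (k + 1) with hμ
  set L := (sphereArea (k + 2) Γ).toReal / (k + 1) with hL
  have hL0 : 0 ≤ L := by positivity
  set ν := μ.restrict X with hν
  -- The closed ball is compared with the half-open shells ending at `R` and at `R + 1`, whose
  -- measures are known and have the same leading order.
  have hνle : ∀ R : ℝ, ν (Metric.closedBall 0 R) ≤ μ (radialCone Γ R₀ (R + 1)) := fun R => by
    rw [hν, Measure.restrict_apply measurableSet_closedBall]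
    refine measure_mono fun x hx => ⟨hx.2.1, ?_, hx.2.2⟩
    have := mem_closedBall_zero_iff.1 hx.1
    linarith
  have hleν : ∀ R : ℝ, μ (radialCone Γ R₀ R) ≤ ν (Metric.closedBall 0 R) := fun R => by
    rw [hν, Measure.restrict_apply measurableSet_closedBall]
    exact measure_mono fun x hx => ⟨mem_closedBall_zero_iff.2 hx.2.1.le, hx.1, hx.2.2⟩
  have hfin : ∀ R : ℝ, ν (Metric.closedBall 0 R) ≠ ⊤ := fun R => by
    refine ne_top_of_le_ne_top ?_ ((measure_mono (Metric.closedBall_subset_closedBall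
      (le_max_left R R₀))).trans (hνle (max R R₀)))
    rw [hμ, hΓ.euclideanHausdorffMeasure_radialCone h0 (by linarith [le_max_right R R₀])]
    exact ENNReal.ofReal_ne_top
  have hlim : Tendsto (fun R : ℝ => ν.real (Metric.closedBall 0 R) / R ^ (k + 1)) atTop (𝓝 L) := by
    have h1 := (tendsto_add_pow_sub_div_pow 0 (R₀ ^ (k + 1)) k.succ_ne_zero).mul_const L
    have h2 := (tendsto_add_pow_sub_div_pow 1 (R₀ ^ (k + 1)) k.succ_ne_zero).mul_const L
    rw [one_mul] at h1 h2
    refine tendsto_of_tendsto_of_tendsto_of_le_of_le' h1 h2 ?_ ?_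
    · filter_upwards [eventually_gt_atTop R₀] with R hR
      have hR0 : 0 < R := h0.trans hR
      rw [div_mul_eq_mul_div, add_zero]
      refine div_le_div_of_nonneg_right ?_ (by positivity)
      refine (ENNReal.ofReal_le_iff_le_toReal (hfin R)).1 ?_
      rw [hL, ← hΓ.euclideanHausdorffMeasure_radialCone h0 hR]
      exact hleν R
    · filter_upwards [eventually_gt_atTop R₀] with R hR
      have hR0 : 0 < R := h0.trans hR
      rw [div_mul_eq_mul_div]
      refine div_le_div_of_nonneg_right ?_ (by positivity)
      refine ENNReal.toReal_le_of_le_ofReal ?_ ?_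
      · refine mul_nonneg (sub_nonneg.2 (pow_le_pow_left₀ h0.le (by linarith) _)) hL0
      · rw [hL, ← hΓ.euclideanHausdorffMeasure_radialCone h0 (by linarith)]
        exact hνle R
  have hψ1 : Tendsto (fun R => radialFactor (k + 2) m R ^ (k + 1)) atTop (𝓝 1) := by
    simpa using (tendsto_radialFactor hk m).pow (k + 1)
  have h := tendsto_setIntegral_closedBall_div_pow k.succ_ne_zero hfin hlim
    (g := fun x => conformalFactor (k + 2) m x ^ (k + 1))
    ((measurable_conformalFactor _ m).pow_const _).aestronglyMeasurable
    (C := radialFactor (k + 2) m R₀ ^ (k + 1))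
    ((ae_restrict_iff' hXc.measurableSet).2 (ae_of_all _ fun x hx => by
      rw [abs_of_nonneg (pow_nonneg (conformalFactor_pos hm x).le _)]
      exact pow_le_pow_left₀ (conformalFactor_pos hm x).le (antitoneOn_radialFactor hk hm h0
        (h0.trans_le hx.1) hx.1) _))
    (fun η hη => ae_forall_gt_of_tendsto hψ1 η hη)
  refine h.congr' ?_
  filter_upwards [eventually_ge_atTop R₀] with R hR
  rw [hΓ.cone_inter_ball hm hk hR, vol_toReal_eq hm _
    (hXc.measurableSet.inter measurableSet_closedBall), hν,
    Measure.restrict_restrict measurableSet_closedBall, inter_comm]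

end IsClosedMinimalInSphere

theorem HasDensityAtInfinity.tendsto {k : ℕ} {m : ℝ} {S Γ : Set (Euc (k + 2))} {Θ : ℝ≥0∞}
    (hm : 0 < m) (hk : 3 ≤ k + 2) (hΓ : IsClosedMinimalInSphere (k + 2) Γ)
    (hS : S ⊆ space (k + 2) m) (hΘ : HasDensityAtInfinity (k + 2) m Γ S Θ) (hfin : Θ ≠ ⊤) :
    (∀ R : ℝ, vol (k + 2) m (k + 1) (S ∩ Metric.closedBall 0 R) ≠ ⊤) ∧
    Tendsto (fun R : ℝ => (vol (k + 2) m (k + 1) (S ∩ Metric.closedBall 0 R)).toReal / R ^ (k + 1))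
      atTop (𝓝 (Θ.toReal * ((sphereArea (k + 2) Γ).toReal / (k + 1)))) := by
  set R₀ := horizonRadius (k + 2) m with hR₀
  have h0 : 0 < R₀ := horizonRadius_pos hm
  have hball : ∀ R, R₀ ≤ R → S ∩ ball (k + 2) m (radialDist (k + 2) m R) =
      S ∩ Metric.closedBall 0 R := fun R hR => by
    rw [ball_radialDist hk hm hR]
    ext x
    rw [mem_inter_iff, mem_inter_iff, mem_closedBall_zero_iff]
    exact and_congr_right fun hx => ⟨fun h => h.2, fun h => ⟨hS hx, h⟩⟩
  have hcone := hΓ.tendsto_vol_cone hm hk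
  have hL0 : 0 < (sphereArea (k + 2) Γ).toReal / ((k : ℝ) + 1) :=
    div_pos (ENNReal.toReal_pos hΓ.sphereArea_pos.ne' hΓ.tendsto_radialCone.1) (by positivity)
  have hdist : Tendsto (radialDist (k + 2) m) atTop atTop := by
    refine tendsto_atTop_mono' atTop ?_ (tendsto_atTop_add_const_right atTop (-R₀) tendsto_id)
    filter_upwards [eventually_ge_atTop R₀] with R hR
    exact sub_le_radialDist hk hm hR
  have hratio := hΘ.comp hdist
  have hcpos : ∀ᶠ R : ℝ in atTop, 0 < (vol (k + 2) m (k + 1) (cone (k + 2) m Γ ∩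
      ball (k + 2) m (radialDist (k + 2) m R))).toReal := by
    filter_upwards [hcone.eventually (lt_mem_nhds hL0), eventually_gt_atTop 0] with R h1 h2
    exact (div_pos_iff_of_pos_right (by positivity)).1 h1
  refine ⟨fun R => ?_, ?_⟩
  -- Infinite volume in one ball would make the quotient infinite for all larger radii, against the
  -- finite limit.
  · obtain ⟨R', h1, h2, h3⟩ := ((hratio.eventually (gt_mem_nhds hfin.lt_top)).and
      (hcpos.and (eventually_ge_atTop (max R R₀)))).exists
    refine ne_top_of_le_ne_top ?_ (measure_mono (inter_subset_inter_right S
      (Metric.closedBall_subset_closedBall ((le_max_left _ _).trans h3))))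
    intro htop
    rw [Function.comp_apply, show k + 2 - 1 = k + 1 from rfl, hball R' ((le_max_right _ _).trans h3),
      htop, ENNReal.top_div_of_ne_top fun h => by simp [h] at h2] at h1
    exact h1.false
  · have h := ((ENNReal.tendsto_toReal hfin).comp hratio).mul hcone
    refine h.congr' ?_
    filter_upwards [hcpos, eventually_ge_atTop R₀] with R h1 h2
    simp only [Function.comp_apply, show k + 2 - 1 = k + 1 from rfl]
    rw [ENNReal.toReal_div, hball R h2]
    field_simp

/-! ### The first variation along radial fields -/

theorem integrableOn_vol_iff {n : ℕ} {m : ℝ} (hm : 0 < m) (d : ℕ) {A : Set (Euc n)}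
    (hA : MeasurableSet A) (g : Euc n → ℝ) : IntegrableOn g A (vol n m d) ↔
      IntegrableOn (fun x => conformalFactor n m x ^ d * g x) A
        (Measure.euclideanHausdorffMeasure d) := by
  rw [IntegrableOn, vol, restrict_withDensity hA, integrable_withDensity_iff_integrable_smul'
    ((measurable_conformalFactor n m).pow_const d).ennreal_ofReal
    (ae_of_all _ fun x => ENNReal.ofReal_lt_top)]
  simp_rw [ENNReal.toReal_ofReal (pow_nonneg (conformalFactor_pos hm _).le d)]
  rfl

theorem setIntegral_vol {n : ℕ} {m : ℝ} (hm : 0 < m) (d : ℕ) {A : Set (Euc n)}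
    (hA : MeasurableSet A) (g : Euc n → ℝ) : ∫ x in A, g x ∂vol n m d =
      ∫ x in A, conformalFactor n m x ^ d * g x ∂Measure.euclideanHausdorffMeasure d := by
  rw [vol, setIntegral_withDensity_eq_setIntegral_toReal_smul
    ((measurable_conformalFactor n m).pow_const d).ennreal_ofReal
    (ae_of_all _ fun x => ENNReal.ofReal_lt_top) _ hA]
  simp_rw [ENNReal.toReal_ofReal (pow_nonneg (conformalFactor_pos hm _).le d)]
  rfl

/-- The first variation density along the multiple `Λ(|x|)` of the position field. -/
def radialVariation {n : ℕ} (m : ℝ) (d : ℕ) (S : Set (Euc n)) (Λ : ℝ → ℝ) (x : Euc n) : ℝ :=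
  d * Λ ‖x‖ * lapse n m ‖x‖ + deriv Λ ‖x‖ * (‖tangentialPart S x‖ ^ 2 / ‖x‖)

namespace IsFreeBoundaryMinimal

variable {k : ℕ} {m : ℝ} {S : Set (Euc (k + 2))}

/-- For `β = Λ(|x|)` the derivative of `ψ` along `x` produces the lapse, and `dβ(x^T) = Λ' |x^T|² /
|x|` because `⟨x, x^T⟩ = |x^T|²`. The support stays away from the horizon, so no boundary term
appears. -/
theorem integral_radialVariation_of_support (hm : 0 < m) (hk : 3 ≤ k + 2)
    (hS : IsFreeBoundaryMinimal (k + 2) m S) {Λ : ℝ → ℝ} (hΛ : ContDiffOn ℝ ∞ Λ (Ioi 0))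
    {a b : ℝ} (ha : horizonRadius (k + 2) m < a) (hΛa : ∀ t ≤ a, Λ t = 0)
    (hΛb : ∀ t, b ≤ t → Λ t = 0) :
    IntegrableOn (radialVariation m (k + 1) S Λ) S (vol (k + 2) m (k + 1)) ∧
    ∫ x in S, radialVariation m (k + 1) S Λ x ∂vol (k + 2) m (k + 1) = 0 := by
  have h0 := horizonRadius_pos (n := k + 2) hm
  have hpos : ∀ x ∈ S, x ≠ 0 := fun x hx => norm_pos_iff.1 (h0.trans_le (hS.subset_space hx))
  have hsupp : tsupport (fun x : Euc (k + 2) => Λ ‖x‖) ⊆ {x | a ≤ ‖x‖} ∩ Metric.closedBall 0 b := by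
    refine closure_minimal (fun x hx => ⟨?_, ?_⟩)
      ((isClosed_le continuous_const continuous_norm).inter Metric.isClosed_closedBall)
    · by_contra h
      exact hx (hΛa _ (not_le.1 h).le)
    · rw [mem_closedBall_zero_iff]
      by_contra h
      exact hx (hΛb _ (not_le.1 h).le)
  have hβ : ContDiff ℝ ∞ (fun x : Euc (k + 2) => Λ ‖x‖) := contDiff_of_contDiffAt_tsupport
    fun x hx => by
      have hx0 : 0 < ‖x‖ := (h0.trans ha).trans_le (hsupp hx).1
      exact (hΛ.contDiffAt (Ioi_mem_nhds hx0)).comp x (contDiffAt_norm ℝ (norm_pos_iff.1 hx0))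
  have h := hS.integral_firstVariation hm hβ
    ((isCompact_closedBall 0 b).of_isClosed_subset (isClosed_tsupport _)
      (hsupp.trans inter_subset_right)) (fun x hx => ha.trans_le (hsupp hx).1)
  have heq : EqOn (firstVariation m (k + 1) S fun x => Λ ‖x‖)
      (fun x => conformalFactor (k + 2) m x ^ (k + 1) * radialVariation m (k + 1) S Λ x) S := by
    intro x hx
    have hx0 := hpos x hx
    have hd : HasFDerivAt (fun x : Euc (k + 2) => Λ ‖x‖) _ x :=
      ((hΛ.contDiffAt (Ioi_mem_nhds (norm_pos_iff.2 hx0))).differentiableAt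
        (by simp)).hasDerivAt.comp_hasFDerivAt x (hasStrictFDerivAt_norm hx0).hasFDerivAt
    simp only [firstVariation, radialVariation]
    rw [hd.fderiv, fderiv_conformalFactor_self hk hm hx0, smul_apply, innerSL_apply_apply,
      inner_smul_left, inner_tangentialPart, smul_eq_mul, conj_trivial]
    ring
  have hSm := hS.isClosed.measurableSet
  rw [integrableOn_vol_iff hm _ hSm, setIntegral_vol hm _ hSm, ← setIntegral_congr_fun hSm heq]
  exact ⟨h.1.congr_fun heq hSm, h.2⟩

/-- The squared cosine of the angle between the position vector and `S`. -/
theorem continuousOn_cosSq (hm : 0 < m) (hS : IsFreeBoundaryMinimal (k + 2) m S) :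
    ContinuousOn (fun x => ‖tangentialPart S x‖ ^ 2 / ‖x‖ ^ 2) S := by
  refine ((hS.continuousOn_tangentialPart hm).norm.pow 2).div (continuousOn_id.norm.pow 2)
    fun x hx => ?_
  have := (horizonRadius_pos hm).trans_le (hS.subset_space hx)
  exact (pow_pos this 2).ne'

/-- The squared cosine is the weight that a radial cutoff produces in the first variation. By the
free boundary condition it equals one on the horizon, and by continuity it is close to one nearby,
which is all that the tube chart asks. -/
theorem tendsto_tubeIntegral_horizon (hm : 0 < m) (hS : IsFreeBoundaryMinimal (k + 2) m S)
    {κ : ℝ → ℝ≥0∞} (hκ : Measurable κ) (hκ0 : ∀ t ∉ Icc (0 : ℝ) 1, κ t = 0)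
    (hκt : ∫⁻ t, κ t ≠ ⊤) {G : Euc (k + 2) → ℝ} (hG : Continuous G) (hG0 : ∀ x, 0 ≤ G x)
    (hGc : HasCompactSupport G) :
    (∫⁻ x in S ∩ horizon (k + 2) m, ENNReal.ofReal (G x) ∂Measure.euclideanHausdorffMeasure k) ≠ ⊤ ∧
    Tendsto (fun ε => tubeIntegral S (fun x => ‖x‖ - horizonRadius (k + 2) m)
      (fun x => ‖tangentialPart S x‖ ^ 2 / ‖x‖ ^ 2) k κ G ε / ENNReal.ofReal ε) (𝓝[>] 0)
      (𝓝 ((∫⁻ t, κ t) * ∫⁻ x in S ∩ horizon (k + 2) m, ENNReal.ofReal (G x)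
        ∂Measure.euclideanHausdorffMeasure k)) := by
  have hSm := hS.isClosed.measurableSet
  have h := tendsto_tubeIntegral (k := k) hSm
    (w := fun x : Euc (k + 2) => ‖x‖ - horizonRadius (k + 2) m) (by fun_prop)
    (W := fun x => ‖tangentialPart S x‖ ^ 2 / ‖x‖ ^ 2)
    ((hS.continuousOn_cosSq hm).aemeasurable hSm) hκ hκ0 hκt hG hG0
    (hGc.isCompact.inter_left hS.isClosed) (fun p hp hp0 K hK => by
      obtain ⟨V, Φ, hpV, hdef, -⟩ := hS.exists_isDefining hm hp.1
      have hpR : ‖p‖ = horizonRadius (k + 2) m := sub_eq_zero.1 hp0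
      have hpt := hS.mem_tangentSpaceAt_of_norm_eq hp.1 hpR
      refine hasTubeChart_boundary rfl (horizonRadius_pos hm) hpR (hdef.hasStrictFDerivAt hpV)
        (hdef.gradient_ne_zero p hpV) ((hdef.mem_iff p hpV).1 hp.1).1
        (hdef.inner_gradient_eq_zero hp.1 hpV hpt) ?_ hK ?_
      · filter_upwards [hdef.isOpen.mem_nhds hpV] with x hx using hdef.mem_iff x hx
      · have hc := (hS.continuousOn_cosSq hm) p hp.1
        have h1 : ‖tangentialPart S p‖ ^ 2 / ‖p‖ ^ 2 = 1 := by
          rw [tangentialPart, Submodule.starProjection_eq_self_iff.2 hpt, div_self]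
          rw [hpR]
          exact (pow_pos (horizonRadius_pos hm) 2).ne'
        have hK0 : (0 : ℝ) < K := by exact_mod_cast zero_lt_one.trans hK
        have hK1 : (1 : ℝ) < K := by exact_mod_cast hK
        have h2 : ∀ᶠ x in 𝓝[S] p, ‖tangentialPart S x‖ ^ 2 / ‖x‖ ^ 2 ∈ Ioo ((K : ℝ)⁻¹) K :=
          hc.eventually (Ioo_mem_nhds (by simp only [h1]; exact inv_lt_one_of_one_lt₀ hK1)
            (by simpa only [h1] using hK1))
        filter_upwards [eventually_nhdsWithin_iff.1 h2] with x hx hxS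
        have := hx hxS
        refine ⟨?_, this.2.le⟩
        have := mul_le_mul_of_nonneg_left this.1.le hK0.le
        rwa [mul_inv_cancel₀ hK0.ne'] at this)
  have hset : {x | x ∈ S ∧ ‖x‖ - horizonRadius (k + 2) m = 0} = S ∩ horizon (k + 2) m := by
    ext x
    exact and_congr_right fun _ => sub_eq_zero
  rwa [hset] at h

theorem euclideanHausdorffMeasure_horizon_ne_top (hm : 0 < m)
    (hS : IsFreeBoundaryMinimal (k + 2) m S) :
    (Measure.euclideanHausdorffMeasure k : Measure (Euc (k + 2))) (S ∩ horizon (k + 2) m) ≠ ⊤ := by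
  set R₀ := horizonRadius (k + 2) m with hR₀
  have hGc : Continuous (fun x : Euc (k + 2) => max 0 (R₀ + 1 - ‖x‖)) := by fun_prop
  -- Only the finiteness half of the tube formula is wanted, so the zero profile will do; `G` equals
  -- one on the horizon.
  have h := (hS.tendsto_tubeIntegral_horizon hm (κ := fun _ => 0) measurable_const (fun _ _ => rfl)
    (by simp) hGc (fun x => le_max_left _ _)
    (HasCompactSupport.intro (isCompact_closedBall 0 (R₀ + 1)) fun x hx => by
      rw [mem_closedBall_zero_iff, not_le] at hx
      exact max_eq_left (by linarith))).1
  have hSm : MeasurableSet (S ∩ horizon (k + 2) m) := hS.isClosed.measurableSet.inter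
    (isClosed_eq continuous_norm continuous_const).measurableSet
  rw [setLIntegral_congr_fun (g := fun _ => 1) hSm fun x hx => by
    have : ‖x‖ = R₀ := hx.2
    simp [this], setLIntegral_one] at h
  exact h

/-- A set of finite `k`-dimensional measure is null in dimension `k + 1`. -/
theorem vol_horizon_eq_zero (hm : 0 < m) (hS : IsFreeBoundaryMinimal (k + 2) m S) :
    vol (k + 2) m (k + 1) (S ∩ horizon (k + 2) m) = 0 := by
  have h := (Measure.euclideanHausdorffMeasure_zero_or_top (Nat.lt_succ_self k)
    (S ∩ horizon (k + 2) m)).resolve_right (hS.euclideanHausdorffMeasure_horizon_ne_top hm)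
  exact withDensity_absolutelyContinuous _ _ h

end IsFreeBoundaryMinimal

/-! ### The boundary term at the horizon -/

/-- A smooth step from zero to one that vanishes up to `1 / 2`. -/
def step (t : ℝ) : ℝ := Real.smoothTransition (2 * t - 1)

theorem contDiff_step : ContDiff ℝ ∞ step :=
  (Real.smoothTransition.contDiff (n := ⊤)).comp ((contDiff_const.mul contDiff_id).sub contDiff_const)

theorem step_of_le {t : ℝ} (h : t ≤ 1 / 2) : step t = 0 :=
  Real.smoothTransition.zero_of_nonpos (by linarith)

theorem step_of_ge {t : ℝ} (h : 1 ≤ t) : step t = 1 :=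
  Real.smoothTransition.one_of_one_le (by linarith)

theorem deriv_step_nonneg (t : ℝ) : 0 ≤ deriv step t :=
  (Real.smoothTransition.monotone.comp fun a b h => by linarith : Monotone step).deriv_nonneg

theorem deriv_step_of_notMem {t : ℝ} (h : t ∉ Icc (0 : ℝ) 1) : deriv step t = 0 := by
  rw [mem_Icc, not_and_or, not_le, not_le] at h
  rcases h with h | h
  · have : step =ᶠ[𝓝 t] fun _ => 0 := by
      filter_upwards [Iio_mem_nhds h] with s hs using step_of_le (by linarith [mem_Iio.1 hs])
    rw [this.deriv_eq, deriv_const]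
  · have : step =ᶠ[𝓝 t] fun _ => 1 := by
      filter_upwards [Ioi_mem_nhds h] with s hs using step_of_ge (le_of_lt hs)
    rw [this.deriv_eq, deriv_const]

theorem continuous_deriv_step : Continuous (deriv step) :=
  contDiff_step.continuous_deriv (by simp)

theorem lintegral_deriv_step : ∫⁻ t, ENNReal.ofReal (deriv step t) = 1 := by
  have hint : Integrable (deriv step) := continuous_deriv_step.integrable_of_hasCompactSupport
    (HasCompactSupport.intro isCompact_Icc fun t ht => deriv_step_of_notMem ht)
  rw [← ofReal_integral_eq_lintegral_ofReal hint (ae_of_all _ deriv_step_nonneg),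
    integral_of_hasDerivAt_of_tendsto (f := step) (m := 0) (n := 1)
      (fun t => (contDiff_step.differentiable (by simp) t).hasDerivAt) hint
      (tendsto_const_nhds.congr' ?_) (tendsto_const_nhds.congr' ?_)]
  · simp
  · filter_upwards [eventually_le_atBot (1 / 2 : ℝ)] with t ht using (step_of_le ht).symm
  · filter_upwards [eventually_ge_atTop (1 : ℝ)] with t ht using (step_of_ge ht).symm

theorem continuousOn_lapse {n : ℕ} {m : ℝ} (hm : 0 < m) : ContinuousOn (lapse n m) (Ioi 0) := by
  have h : ContinuousOn (fun R : ℝ => m / (2 * R ^ (n - 2))) (Ioi 0) :=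
    continuousOn_const.div (by fun_prop) fun R hR => by
      have : (0 : ℝ) < R := hR
      positivity
  refine (continuousOn_const.sub h).div (continuousOn_const.add h) fun R hR => ?_
  have : (0 : ℝ) < R := hR
  positivity

namespace IsFreeBoundaryMinimal

variable {k : ℕ} {m : ℝ} {S : Set (Euc (k + 2))}

theorem integrableOn_of_continuousOn (hS : IsFreeBoundaryMinimal (k + 2) m S)
    (hvol : ∀ R : ℝ, vol (k + 2) m (k + 1) (S ∩ Metric.closedBall 0 R) ≠ ⊤)
    {g : Euc (k + 2) → ℝ} (hg : ContinuousOn g S) {b : ℝ} (hb : ∀ x ∈ S, b < ‖x‖ → g x = 0) :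
    IntegrableOn g S (vol (k + 2) m (k + 1)) := by
  have hSb : IsCompact (S ∩ Metric.closedBall 0 b) :=
    (isCompact_closedBall 0 b).inter_left hS.isClosed
  obtain ⟨C, hC⟩ := hSb.exists_bound_of_continuousOn (hg.mono inter_subset_left)
  have h : IntegrableOn g (S ∩ Metric.closedBall 0 b) (vol (k + 2) m (k + 1)) :=
    ⟨(hg.mono inter_subset_left).aestronglyMeasurable hSb.measurableSet,
      HasFiniteIntegral.restrict_of_bounded C (hvol b).lt_top
        ((ae_restrict_iff' hSb.measurableSet).2 (ae_of_all _ hC))⟩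
  refine h.of_forall_sdiff_eq_zero hS.isClosed.measurableSet fun x hx => hb x hx.1 ?_
  by_contra h'
  exact hx.2 ⟨hx.1, mem_closedBall_zero_iff.2 (not_lt.1 h')⟩

theorem continuousOn_norm_comp (hm : 0 < m) (hS : IsFreeBoundaryMinimal (k + 2) m S) {φ : ℝ → ℝ}
    (hφ : ContinuousOn φ (Ioi 0)) : ContinuousOn (fun x => φ ‖x‖) S :=
  hφ.comp continuous_norm.continuousOn fun _ hx => (horizonRadius_pos hm).trans_le (hS.subset_space hx)

theorem continuousOn_tangentialPart_sq_div (hm : 0 < m) (hS : IsFreeBoundaryMinimal (k + 2) m S) :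
    ContinuousOn (fun x => ‖tangentialPart S x‖ ^ 2 / ‖x‖) S :=
  ((hS.continuousOn_tangentialPart hm).norm.pow 2).div continuousOn_id.norm fun _ hx =>
    ((horizonRadius_pos hm).trans_le (hS.subset_space hx)).ne'

theorem integrableOn_radialVariation (hm : 0 < m) (hS : IsFreeBoundaryMinimal (k + 2) m S)
    (hvol : ∀ R : ℝ, vol (k + 2) m (k + 1) (S ∩ Metric.closedBall 0 R) ≠ ⊤)
    {B : ℝ → ℝ} (hB : ContDiffOn ℝ ∞ B (Ioi 0)) {b : ℝ} (hBb : ∀ t, b ≤ t → B t = 0) :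
    IntegrableOn (radialVariation m (k + 1) S B) S (vol (k + 2) m (k + 1)) := by
  refine hS.integrableOn_of_continuousOn hvol (b := b) ?_ fun x hx hxb => ?_
  · exact (((continuousOn_const.mul (hS.continuousOn_norm_comp hm hB.continuousOn)).mul
      (hS.continuousOn_norm_comp hm (continuousOn_lapse hm)))).add
      ((hS.continuousOn_norm_comp hm (hB.continuousOn_deriv_of_isOpen isOpen_Ioi (by simp))).mul
        (hS.continuousOn_tangentialPart_sq_div hm))
  · have h : B =ᶠ[𝓝 ‖x‖] fun _ => 0 := by
      filter_upwards [Ioi_mem_nhds hxb] with t ht using hBb t (le_of_lt ht)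
    rw [radialVariation, h.deriv_eq, hBb _ hxb.le]
    simp

/-- The derivative of the cutoff is `ε⁻¹ κ(w/ε)` with `w = ‖x‖ - R₀` and the profile `κ = step'` of
total mass one, so the tube formula evaluates the limit on `S ∩ horizon`. -/
theorem tendsto_integral_deriv_step (hm : 0 < m) (hk : 3 ≤ k + 2)
    (hS : IsFreeBoundaryMinimal (k + 2) m S) {B : ℝ → ℝ} (hB : ContinuousOn B (Ioi 0))
    (hB0 : ∀ t, horizonRadius (k + 2) m ≤ t → 0 ≤ B t) {b : ℝ} (hBb : ∀ t, b ≤ t → B t = 0) :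
    Tendsto (fun ε => ∫ x in S, deriv step ((‖x‖ - horizonRadius (k + 2) m) / ε) / ε * B ‖x‖ *
      (‖tangentialPart S x‖ ^ 2 / ‖x‖) ∂vol (k + 2) m (k + 1)) (𝓝[>] 0)
      (𝓝 (B (horizonRadius (k + 2) m) * (horizonRadius (k + 2) m *
        radialFactor (k + 2) m (horizonRadius (k + 2) m) ^ (k + 1) *
        ((Measure.euclideanHausdorffMeasure k : Measure (Euc (k + 2)))
          (S ∩ horizon (k + 2) m)).toReal))) := by
  have hSm := hS.isClosed.measurableSet
  set R₀ := horizonRadius (k + 2) m with hR₀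
  have h0 : 0 < R₀ := horizonRadius_pos hm
  have hSR : ∀ x ∈ S, R₀ ≤ ‖x‖ := fun x hx => hS.subset_space hx
  set φ : ℝ → ℝ := fun t => radialFactor (k + 2) m t ^ (k + 1) * B t * t with hφ
  have hφc : ContinuousOn φ (Ioi 0) :=
    (((continuousOn_radialFactor hk hm).pow _).mul hB).mul continuousOn_id
  have hmax : ∀ x : Euc (k + 2), 0 < max ‖x‖ R₀ := fun x => lt_max_of_lt_right h0
  -- The maximum extends `φ ‖x‖` continuously and with its sign into the ball `‖x‖ < R₀`, and
  -- changes nothing on `S`.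
  set G : Euc (k + 2) → ℝ := fun x => φ (max ‖x‖ R₀) with hG
  have hGc : Continuous G := hφc.comp_continuous (continuous_norm.max continuous_const) hmax
  have hG0 : ∀ x, 0 ≤ G x := fun x => mul_nonneg (mul_nonneg (pow_nonneg
    (radialFactor_pos hm (hmax x).le).le _) (hB0 _ (le_max_right _ _))) (hmax x).le
  have hGs : HasCompactSupport G := HasCompactSupport.intro (isCompact_closedBall 0 b) fun x hx => by
    rw [mem_closedBall_zero_iff, not_le] at hx
    simp only [hG, hφ]
    rw [hBb _ (hx.le.trans (le_max_left _ _)), mul_zero, zero_mul]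
  have hGS : ∀ x ∈ S, G x = φ ‖x‖ := fun x hx => by
    simp only [hG]
    rw [max_eq_left (hSR x hx)]
  obtain ⟨hfin, hlim⟩ := hS.tendsto_tubeIntegral_horizon hm
    (κ := fun t => ENNReal.ofReal (deriv step t)) continuous_deriv_step.measurable.ennreal_ofReal
    (fun t ht => by rw [deriv_step_of_notMem ht, ENNReal.ofReal_zero])
    (by rw [lintegral_deriv_step]; exact ENNReal.one_ne_top) hGc hG0 hGs
  rw [lintegral_deriv_step, one_mul] at hlim
  have hSh : MeasurableSet (S ∩ horizon (k + 2) m) := hSm.inter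
    (isClosed_eq continuous_norm continuous_const).measurableSet
  have hI : ∫⁻ x in S ∩ horizon (k + 2) m, ENNReal.ofReal (G x)
      ∂Measure.euclideanHausdorffMeasure k = ENNReal.ofReal (φ R₀) *
        (Measure.euclideanHausdorffMeasure k : Measure (Euc (k + 2))) (S ∩ horizon (k + 2) m) := by
    rw [setLIntegral_congr_fun (g := fun _ => ENNReal.ofReal (φ R₀)) hSh fun x hx => by
      have hxR : ‖x‖ = R₀ := hx.2
      simp only
      rw [hGS x hx.1, hxR], setLIntegral_const]
  have hφ0 : 0 ≤ φ R₀ := mul_nonneg (mul_nonneg (pow_nonneg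
    (radialFactor_pos hm h0.le).le _) (hB0 _ le_rfl)) h0.le
  have hlim2 := (ENNReal.tendsto_toReal hfin).comp hlim
  rw [hI, ENNReal.toReal_mul, ENNReal.toReal_ofReal hφ0] at hlim2
  have hval : φ R₀ * ((Measure.euclideanHausdorffMeasure k : Measure (Euc (k + 2)))
      (S ∩ horizon (k + 2) m)).toReal = B R₀ * (R₀ * radialFactor (k + 2) m R₀ ^ (k + 1) *
        ((Measure.euclideanHausdorffMeasure k : Measure (Euc (k + 2)))
          (S ∩ horizon (k + 2) m)).toReal) := by
    simp only [hφ]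
    ring
  rw [hval] at hlim2
  refine hlim2.congr' ?_
  filter_upwards [self_mem_nhdsWithin] with ε hε
  have hε : 0 < ε := hε
  have hset : {x | x ∈ S ∧ 0 ≤ ‖x‖ - R₀} = S := by
    ext x
    exact ⟨fun h => h.1, fun h => ⟨h, sub_nonneg.2 (hSR x h)⟩⟩
  have hstepc : ContinuousOn (fun x => deriv step ((‖x‖ - R₀) / ε) / ε * B ‖x‖ *
      (‖tangentialPart S x‖ ^ 2 / ‖x‖)) S :=
    (((continuous_deriv_step.comp ((continuous_norm.sub continuous_const).div_const
      ε)).div_const ε).continuousOn.mul (hS.continuousOn_norm_comp hm hB)).mul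
      (hS.continuousOn_tangentialPart_sq_div hm)
  have hψc : ContinuousOn (fun x => conformalFactor (k + 2) m x ^ (k + 1)) S :=
    (hS.continuousOn_norm_comp hm (continuousOn_radialFactor hk hm)).pow _
  have hprod : ContinuousOn (fun x => conformalFactor (k + 2) m x ^ (k + 1) *
      (deriv step ((‖x‖ - R₀) / ε) / ε * B ‖x‖ * (‖tangentialPart S x‖ ^ 2 / ‖x‖))) S :=
    hψc.mul hstepc
  rw [Function.comp_apply, setIntegral_vol hm _ hSm, tubeIntegral, hset,
    integral_eq_lintegral_of_nonneg_ae
    ((ae_restrict_iff' hSm).2 (ae_of_all _ fun x hx => ?_))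
    (hprod.aestronglyMeasurable hSm), div_eq_mul_inv, mul_comm,
    ← ENNReal.ofReal_inv_of_pos hε, ← lintegral_const_mul' _ _ ENNReal.ofReal_ne_top]
  · congr 1
    refine setLIntegral_congr_fun hSm fun x hx => ?_
    have hx0 : 0 < ‖x‖ := h0.trans_le (hSR x hx)
    rw [hGS x hx, ← ENNReal.ofReal_mul (by positivity), ← ENNReal.ofReal_mul (deriv_step_nonneg _),
      ← ENNReal.ofReal_mul (inv_pos.2 hε).le, conformalFactor_eq]
    congr 1
    simp only [hφ]
    rw [← hR₀]
    field_simp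
  · have hx0 : 0 < ‖x‖ := h0.trans_le (hSR x hx)
    exact mul_nonneg (pow_nonneg (conformalFactor_pos hm x).le _) (mul_nonneg (mul_nonneg
      (div_nonneg (deriv_step_nonneg _) hε.le) (hB0 _ (hSR x hx))) (by positivity))

/-- Cut `B` off near the horizon by `step ((t - R₀)/ε)` and let `ε → 0`. The bulk term converges by
domination, the horizon being null in `S`; the derivative of the cutoff supplies the boundary flux.
-/
theorem integral_radialVariation (hm : 0 < m) (hk : 3 ≤ k + 2)
    (hS : IsFreeBoundaryMinimal (k + 2) m S)
    (hvol : ∀ R : ℝ, vol (k + 2) m (k + 1) (S ∩ Metric.closedBall 0 R) ≠ ⊤)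
    {B : ℝ → ℝ} (hB : ContDiffOn ℝ ∞ B (Ioi 0))
    (hB0 : ∀ t, horizonRadius (k + 2) m ≤ t → 0 ≤ B t) {b : ℝ} (hBb : ∀ t, b ≤ t → B t = 0) :
    ∫ x in S, radialVariation m (k + 1) S B x ∂vol (k + 2) m (k + 1) +
      B (horizonRadius (k + 2) m) * (horizonRadius (k + 2) m *
        radialFactor (k + 2) m (horizonRadius (k + 2) m) ^ (k + 1) *
        ((Measure.euclideanHausdorffMeasure k : Measure (Euc (k + 2)))
          (S ∩ horizon (k + 2) m)).toReal) = 0 := by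
  have hSm := hS.isClosed.measurableSet
  have hJ := hS.tendsto_integral_deriv_step hm hk hB.continuousOn hB0 hBb
  set R₀ := horizonRadius (k + 2) m with hR₀
  have h0 : 0 < R₀ := horizonRadius_pos hm
  have hSR : ∀ x ∈ S, R₀ ≤ ‖x‖ := fun x hx => hS.subset_space hx
  have hint := hS.integrableOn_radialVariation hm hvol hB hBb
  have hstep1 : ∀ t, |step t| ≤ 1 := fun t =>
    abs_le.2 ⟨by linarith [Real.smoothTransition.nonneg (2 * t - 1), show step t = Real.smoothTransition (2 * t - 1) from rfl],
      Real.smoothTransition.le_one _⟩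
  have hstepc : ∀ ε : ℝ, Continuous (fun x : Euc (k + 2) => step ((‖x‖ - R₀) / ε)) := fun ε =>
    contDiff_step.continuous.comp ((continuous_norm.sub continuous_const).div_const ε)
  have hmeas : ∀ ε : ℝ, AEStronglyMeasurable (fun x => step ((‖x‖ - R₀) / ε) *
      radialVariation m (k + 1) S B x) ((vol (k + 2) m (k + 1)).restrict S) := fun ε =>
    (hstepc ε).aestronglyMeasurable.mul hint.1
  have hle : ∀ ε x, ‖step ((‖x‖ - R₀) / ε) * radialVariation m (k + 1) S B x‖ ≤
      ‖radialVariation m (k + 1) S B x‖ := fun ε x => by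
    rw [norm_mul]
    exact mul_le_of_le_one_left (norm_nonneg _) (hstep1 _)
  have hK : Tendsto (fun ε : ℝ => ∫ x in S, step ((‖x‖ - R₀) / ε) * radialVariation m (k + 1) S B x
      ∂vol (k + 2) m (k + 1)) (𝓝[>] 0)
      (𝓝 (∫ x in S, radialVariation m (k + 1) S B x ∂vol (k + 2) m (k + 1))) := by
    refine tendsto_integral_filter_of_dominated_convergence
      (fun x => ‖radialVariation m (k + 1) S B x‖) (Eventually.of_forall hmeas)
      (Eventually.of_forall fun ε => ae_of_all _ (hle ε)) hint.norm ?_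
    have hnull := measure_eq_zero_iff_ae_notMem.1 (hS.vol_horizon_eq_zero hm)
    filter_upwards [ae_restrict_of_ae hnull, ae_restrict_mem hSm] with x hx hxS
    have hxR : 0 < ‖x‖ - R₀ := sub_pos.2 (lt_of_le_of_ne (hSR x hxS) fun h => hx ⟨hxS, h.symm⟩)
    refine tendsto_const_nhds.congr' ?_
    filter_upwards [Ioo_mem_nhdsGT hxR] with ε hε
    rw [step_of_ge ((one_le_div hε.1).2 hε.2.le), one_mul]
  have hsum := hK.add hJ
  refine tendsto_nhds_unique hsum (tendsto_const_nhds.congr' ?_)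
  filter_upwards [self_mem_nhdsWithin] with ε hε
  have hε : 0 < ε := hε
  have hΛ : ContDiffOn ℝ ∞ (fun t => step ((t - R₀) / ε) * B t) (Ioi 0) :=
    (contDiff_step.comp ((contDiff_id.sub contDiff_const).div_const ε)).contDiffOn.mul hB
  -- `step` vanishes up to `1/2`, so the support begins at `R₀ + ε/2`, strictly outside the horizon.
  have h := (hS.integral_radialVariation_of_support hm hk hΛ (a := R₀ + ε / 2) (b := b)
    (by linarith) (fun t ht => by
      rw [step_of_le (by rw [div_le_iff₀ hε]; linarith), zero_mul])
    (fun t ht => by rw [hBb t ht, mul_zero])).2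
  have heq : EqOn (radialVariation m (k + 1) S fun t => step ((t - R₀) / ε) * B t)
      (fun x => step ((‖x‖ - R₀) / ε) * radialVariation m (k + 1) S B x +
        deriv step ((‖x‖ - R₀) / ε) / ε * B ‖x‖ * (‖tangentialPart S x‖ ^ 2 / ‖x‖)) S := by
    intro x hx
    have hx0 : 0 < ‖x‖ := h0.trans_le (hSR x hx)
    have h1 : HasDerivAt (fun t => step ((t - R₀) / ε)) (deriv step ((‖x‖ - R₀) / ε) * (1 / ε)) ‖x‖ :=
      HasDerivAt.comp ‖x‖ (h₂ := step) (contDiff_step.differentiable (by simp) _).hasDerivAt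
        (((hasDerivAt_id ‖x‖).sub_const R₀).div_const ε)
    have h2 : HasDerivAt B (deriv B ‖x‖) ‖x‖ :=
      ((hB.contDiffAt (Ioi_mem_nhds hx0)).differentiableAt (by simp)).hasDerivAt
    have h3 : deriv (fun t => step ((t - R₀) / ε) * B t) ‖x‖ = _ := (h1.mul h2).deriv
    simp only [radialVariation]
    rw [h3]
    ring
  have hint2 : IntegrableOn (fun x => step ((‖x‖ - R₀) / ε) * radialVariation m (k + 1) S B x) S
      (vol (k + 2) m (k + 1)) := hint.norm.mono' (hmeas ε) (ae_of_all _ (hle ε))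
  have hint3 : IntegrableOn (fun x => deriv step ((‖x‖ - R₀) / ε) / ε * B ‖x‖ *
      (‖tangentialPart S x‖ ^ 2 / ‖x‖)) S (vol (k + 2) m (k + 1)) := by
    refine hS.integrableOn_of_continuousOn hvol (b := b) ?_ fun x hx hxb => ?_
    · exact (((continuous_deriv_step.comp ((continuous_norm.sub continuous_const).div_const
        ε)).div_const ε).continuousOn.mul (hS.continuousOn_norm_comp hm hB.continuousOn)).mul
        (hS.continuousOn_tangentialPart_sq_div hm)
    · rw [hBb _ hxb.le, mul_zero, zero_mul]
  rw [setIntegral_congr_fun hSm heq, integral_add hint2 hint3] at h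
  exact h.symm

end IsFreeBoundaryMinimal

/-! ### Smooth approximation of the truncated weight -/

/-- A smooth approximation of the positive part. -/
def smoothPosPart (y : ℝ) : ℝ := y * expNegInvGlue y

theorem contDiff_smoothPosPart : ContDiff ℝ ∞ smoothPosPart :=
  contDiff_id.mul (expNegInvGlue.contDiff (n := ⊤))

theorem smoothPosPart_of_nonpos {y : ℝ} (h : y ≤ 0) : smoothPosPart y = 0 := by
  rw [smoothPosPart, expNegInvGlue.zero_of_nonpos h, mul_zero]

theorem smoothPosPart_nonneg (y : ℝ) : 0 ≤ smoothPosPart y := by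
  rcases le_total y 0 with h | h
  · exact (smoothPosPart_of_nonpos h).ge
  · exact mul_nonneg h (expNegInvGlue.nonneg y)

theorem expNegInvGlue_of_pos {y : ℝ} (h : 0 < y) : expNegInvGlue y = Real.exp (-y⁻¹) :=
  if_neg h.not_ge

theorem smoothPosPart_le {y : ℝ} (h : 0 ≤ y) : smoothPosPart y ≤ y := by
  rcases h.eq_or_lt with rfl | h'
  · exact (smoothPosPart_of_nonpos le_rfl).le
  · rw [smoothPosPart, expNegInvGlue_of_pos h']
    exact mul_le_of_le_one_right h (Real.exp_le_one_iff.2 (neg_nonpos.2 (inv_pos.2 h').le))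

theorem deriv_smoothPosPart_of_nonpos {y : ℝ} (h : y ≤ 0) : deriv smoothPosPart y = 0 :=
  IsLocalMin.deriv_eq_zero (Eventually.of_forall fun z => by
    rw [smoothPosPart_of_nonpos h]
    exact smoothPosPart_nonneg z)

theorem deriv_smoothPosPart_of_pos {y : ℝ} (h : 0 < y) :
    deriv smoothPosPart y = Real.exp (-y⁻¹) * (1 + y⁻¹) := by
  have h1 : HasDerivAt (fun y => y * Real.exp (-y⁻¹)) (Real.exp (-y⁻¹) * (1 + y⁻¹)) y := by
    refine ((hasDerivAt_id y).mul ((hasDerivAt_inv h.ne').neg.exp)).congr_deriv ?_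
    simp only [id, Pi.neg_apply]
    field_simp
  refine (h1.congr_of_eventuallyEq ?_).deriv
  filter_upwards [Ioi_mem_nhds h] with z hz
  rw [smoothPosPart, expNegInvGlue_of_pos hz]

theorem deriv_smoothPosPart_mem_Icc (y : ℝ) : deriv smoothPosPart y ∈ Icc (0 : ℝ) 1 := by
  rcases le_or_gt y 0 with h | h
  · rw [deriv_smoothPosPart_of_nonpos h]
    exact ⟨le_rfl, zero_le_one⟩
  · have hy := inv_pos.2 h
    rw [deriv_smoothPosPart_of_pos h]
    refine ⟨by positivity, ?_⟩
    -- The bound is `1 + y⁻¹ ≤ exp (y⁻¹)`.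
    rw [Real.exp_neg, inv_mul_le_iff₀ (Real.exp_pos _), mul_one, add_comm]
    exact Real.add_one_le_exp _

theorem tendsto_exp_neg_inv_mul (y : ℝ) (h : 0 < y) :
    Tendsto (fun j : ℕ => Real.exp (-((j + 1 : ℝ) * y)⁻¹)) atTop (𝓝 1) ∧
    Tendsto (fun j : ℕ => ((j + 1 : ℝ) * y)⁻¹) atTop (𝓝 0) := by
  have h1 : Tendsto (fun j : ℕ => ((j + 1 : ℝ) * y)⁻¹) atTop (𝓝 0) :=
    tendsto_inv_atTop_zero.comp ((tendsto_atTop_add_const_right _ _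
      tendsto_natCast_atTop_atTop).atTop_mul_const h)
  have h2 := (Real.continuous_exp.tendsto _).comp h1.neg
  rw [neg_zero, Real.exp_zero] at h2
  exact ⟨h2, h1⟩

theorem tendsto_smoothPosPart (y : ℝ) :
    Tendsto (fun j : ℕ => smoothPosPart ((j + 1 : ℝ) * y) / (j + 1)) atTop (𝓝 (max y 0)) := by
  rcases le_or_gt y 0 with h | h
  · rw [max_eq_right h]
    refine tendsto_const_nhds.congr fun j => ?_
    rw [smoothPosPart_of_nonpos (mul_nonpos_of_nonneg_of_nonpos (by positivity) h), zero_div]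
  · rw [max_eq_left h.le]
    have := (tendsto_exp_neg_inv_mul y h).1.const_mul y
    rw [mul_one] at this
    refine this.congr fun j => ?_
    have hj : (0 : ℝ) < j + 1 := by positivity
    rw [smoothPosPart, expNegInvGlue_of_pos (by positivity)]
    field_simp

/-- At `y = 0` every approximation has derivative zero; hence the open ball in
`integral_indicator_eq`. -/
theorem tendsto_deriv_smoothPosPart (y : ℝ) :
    Tendsto (fun j : ℕ => deriv smoothPosPart ((j + 1 : ℝ) * y)) atTop
      (𝓝 (if 0 < y then 1 else 0)) := by
  split_ifs with h
  · have h1 := tendsto_exp_neg_inv_mul y h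
    have h2 := h1.1.mul (h1.2.const_add 1)
    rw [add_zero, mul_one] at h2
    refine h2.congr fun j => ?_
    rw [deriv_smoothPosPart_of_pos (by positivity)]
  · refine tendsto_const_nhds.congr fun j => ?_
    rw [deriv_smoothPosPart_of_nonpos (mul_nonpos_of_nonneg_of_nonpos (by positivity) (not_lt.1 h))]

/-! ### The weight `s^(-d)` and the identity on balls -/

/-- The power `s^(-d)` of the areal radius, as a function of the Euclidean radius. -/
def arealWeight (n d : ℕ) (m R : ℝ) : ℝ := (arealRadius n m R ^ d)⁻¹

section ArealWeight

variable {n d : ℕ} {m R : ℝ}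

theorem contDiffOn_arealRadius (hm : 0 < m) : ContDiffOn ℝ ∞ (arealRadius n m) (Ioi 0) := by
  intro R hR
  have hR : 0 < R := hR
  have h0 : 2 * R ^ (n - 2) ≠ 0 := by positivity
  have h1 : (1 + m / (2 * R ^ (n - 2))) ≠ 0 := by positivity
  have h2 : ContDiffAt ℝ ∞ (fun R : ℝ => 2 * R ^ (n - 2)) R := by fun_prop
  have h3 : ContDiffAt ℝ ∞ (fun R : ℝ => 1 + m / (2 * R ^ (n - 2))) R :=
    contDiffAt_const.add (contDiffAt_const.div h2 h0)
  exact (contDiffAt_id.mul (h3.rpow_const_of_ne h1)).contDiffWithinAt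

theorem arealRadius_pos (hm : 0 < m) (hR : 0 < R) : 0 < arealRadius n m R :=
  mul_pos hR (radialFactor_pos hm hR.le)

theorem arealWeight_pos (hm : 0 < m) (hR : 0 < R) : 0 < arealWeight n d m R :=
  inv_pos.2 (pow_pos (arealRadius_pos hm hR) d)

theorem contDiffOn_arealWeight (hm : 0 < m) : ContDiffOn ℝ ∞ (arealWeight n d m) (Ioi 0) :=
  ((contDiffOn_arealRadius hm).pow d).inv fun _ hR => (pow_pos (arealRadius_pos hm hR) d).ne'

/-- From `s' = f ψ = f s / R`. The factor `d f` matches the one in the divergence of the position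
field, so that the two terms of `radialVariation` combine. -/
theorem hasDerivAt_arealWeight (hn : 3 ≤ n) (hm : 0 < m) (hR : 0 < R) :
    HasDerivAt (arealWeight n d m) (-(d * arealWeight n d m R * lapse n m R / R)) R := by
  have hs := arealRadius_pos (n := n) hm hR
  have hψ := radialFactor_pos (n := n) hm hR.le
  refine (((hasDerivAt_arealRadius hn hm hR).fun_pow d).fun_inv (pow_pos hs d).ne').congr_deriv ?_
  rcases d with _ | d
  · simp
  · rw [arealWeight, Nat.add_sub_cancel]
    have : arealRadius n m R = R * radialFactor n m R := rfl
    rw [this]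
    field_simp
    ring

theorem antitoneOn_arealWeight (hn : 3 ≤ n) (hm : 0 < m) :
    AntitoneOn (arealWeight n d m) (Ici (horizonRadius n m)) := fun R hR R' hR' h => by
  have h0 := horizonRadius_pos (n := n) hm
  exact inv_anti₀ (pow_pos (arealRadius_pos hm (h0.trans_le hR)) d)
    (pow_le_pow_left₀ (arealRadius_pos hm (h0.trans_le hR)).le
      ((strictMonoOn_arealRadius hn hm).monotoneOn hR hR' h) d)

theorem arealWeight_lt (hn : 3 ≤ n) (hm : 0 < m) (hd : d ≠ 0) {R' : ℝ} (hR : horizonRadius n m ≤ R)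
    (h : R < R') : arealWeight n d m R' < arealWeight n d m R := by
  have h0 := horizonRadius_pos (n := n) hm
  have hs := arealRadius_pos (n := n) hm (h0.trans_le hR)
  exact inv_strictAnti₀ (pow_pos hs d) (pow_lt_pow_left₀
    (strictMonoOn_arealRadius hn hm hR (hR.trans h.le) h) hs.le hd)

end ArealWeight

/-- The density of the flux of the static potential through `S`. -/
def fluxDensity {n : ℕ} (m : ℝ) (d : ℕ) (S : Set (Euc n)) (x : Euc n) : ℝ :=
  lapse n m ‖x‖ * arealWeight n d m ‖x‖ * (1 - ‖tangentialPart S x‖ ^ 2 / ‖x‖ ^ 2)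

theorem cosSq_mem_Icc {n : ℕ} (S : Set (Euc n)) (x : Euc n) :
    ‖tangentialPart S x‖ ^ 2 / ‖x‖ ^ 2 ∈ Icc (0 : ℝ) 1 :=
  ⟨by positivity, div_le_one_of_le₀ (pow_le_pow_left₀ (norm_nonneg _) (norm_tangentialPart_le S x) 2)
    (by positivity)⟩

namespace IsFreeBoundaryMinimal

variable {k : ℕ} {m : ℝ} {S : Set (Euc (k + 2))}

/-- Take `Λ = (q - q(R))₊` in `integral_radialVariation`. For `‖x‖ < R` the integrand is `d f (q -
q(R) - q cos²)`, and `q (1 - cos²) f` is the flux density. -/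
theorem integral_indicator_eq (hm : 0 < m) (hk : 3 ≤ k + 2)
    (hS : IsFreeBoundaryMinimal (k + 2) m S)
    (hvol : ∀ R : ℝ, vol (k + 2) m (k + 1) (S ∩ Metric.closedBall 0 R) ≠ ⊤) {R : ℝ}
    (hR : horizonRadius (k + 2) m < R) :
    ∫ x in S, (Metric.ball (0 : Euc (k + 2)) R).indicator (fun x => ((k + 1 : ℕ) : ℝ) *
      (fluxDensity m (k + 1) S x - arealWeight (k + 2) (k + 1) m R * lapse (k + 2) m ‖x‖)) x
        ∂vol (k + 2) m (k + 1) +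
      (arealWeight (k + 2) (k + 1) m (horizonRadius (k + 2) m) - arealWeight (k + 2) (k + 1) m R) *
      (horizonRadius (k + 2) m * radialFactor (k + 2) m (horizonRadius (k + 2) m) ^ (k + 1) *
        ((Measure.euclideanHausdorffMeasure k : Measure (Euc (k + 2)))
          (S ∩ horizon (k + 2) m)).toReal) = 0 := by
  have hSm := hS.isClosed.measurableSet
  set R₀ := horizonRadius (k + 2) m with hR₀
  have h0 : 0 < R₀ := horizonRadius_pos hm
  have hSR : ∀ x ∈ S, R₀ ≤ ‖x‖ := fun x hx => hS.subset_space hx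
  set q := arealWeight (k + 2) (k + 1) m with hq
  set c := R₀ * radialFactor (k + 2) m R₀ ^ (k + 1) *
        ((Measure.euclideanHausdorffMeasure k : Measure (Euc (k + 2)))
          (S ∩ horizon (k + 2) m)).toReal with hc
  have hqanti : AntitoneOn q (Ici R₀) := antitoneOn_arealWeight hk hm
  have hqpos : ∀ {t}, 0 < t → 0 < q t := fun ht => arealWeight_pos hm ht
  -- Smooth approximations of `(q - q(R))₊`, all vanishing beyond `R`.
  let B : ℕ → ℝ → ℝ := fun j t => smoothPosPart ((j + 1 : ℝ) * (q t - q R)) / (j + 1)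
  have hB : ∀ j, ContDiffOn ℝ ∞ (B j) (Ioi 0) := fun j =>
    (contDiff_smoothPosPart.comp_contDiffOn (contDiffOn_const.mul
      ((contDiffOn_arealWeight hm).sub contDiffOn_const))).div_const _
  have hB0 : ∀ j t, R₀ ≤ t → 0 ≤ B j t := fun j t _ =>
    div_nonneg (smoothPosPart_nonneg _) (by positivity)
  have hBR' : ∀ t, R ≤ t → q t - q R ≤ 0 := fun t ht =>
    sub_nonpos.2 (hqanti hR.le (hR.le.trans ht) ht)
  have hBR : ∀ j t, R ≤ t → B j t = 0 := fun j t ht => by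
    simp only [B]
    rw [smoothPosPart_of_nonpos (mul_nonpos_of_nonneg_of_nonpos (by positivity) (hBR' t ht)), zero_div]
  have hBd : ∀ j t, 0 < t → deriv (B j) t = deriv smoothPosPart ((j + 1 : ℝ) * (q t - q R)) *
      -((k + 1 : ℕ) * q t * lapse (k + 2) m t / t) := fun j t ht => by
    have h1 : HasDerivAt (fun t => (j + 1 : ℝ) * (q t - q R)) _ t :=
      ((hasDerivAt_arealWeight (d := k + 1) hk hm ht).sub_const (q R)).const_mul (j + 1 : ℝ)
    have h2 : HasDerivAt (B j) _ t := ((HasDerivAt.comp t (h₂ := smoothPosPart)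
      (contDiff_smoothPosPart.differentiable (by simp) _).hasDerivAt h1).div_const (j + 1 : ℝ))
    rw [h2.deriv]
    have : (j + 1 : ℝ) ≠ 0 := by positivity
    rw [← hq]
    field_simp
  have hid := fun j => hS.integral_radialVariation hm hk hvol (hB j) (hB0 j) (hBR j)
  have hrv : ∀ j, ∀ x ∈ S, radialVariation m (k + 1) S (B j) x = (k + 1 : ℕ) * lapse (k + 2) m ‖x‖ *
      (B j ‖x‖ - deriv smoothPosPart ((j + 1 : ℝ) * (q ‖x‖ - q R)) * (q ‖x‖ *
        (‖tangentialPart S x‖ ^ 2 / ‖x‖ ^ 2))) := fun j x hx => by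
    have hx0 : 0 < ‖x‖ := h0.trans_le (hSR x hx)
    rw [radialVariation, hBd j _ hx0]
    field_simp
    ring
  have hlim : Tendsto (fun j => ∫ x in S, radialVariation m (k + 1) S (B j) x
      ∂vol (k + 2) m (k + 1)) atTop (𝓝 (∫ x in S, (Metric.ball (0 : Euc (k + 2)) R).indicator
        (fun x => ((k + 1 : ℕ) : ℝ) * (fluxDensity m (k + 1) S x - q R * lapse (k + 2) m ‖x‖)) x
        ∂vol (k + 2) m (k + 1))) := by
    -- Each of the two terms is at most `q(R₀)`, since the lapse, the squared cosine and the
    -- derivative of `smoothPosPart` are at most one.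
    refine tendsto_integral_of_dominated_convergence
      ((Metric.closedBall (0 : Euc (k + 2)) R).indicator fun _ => (k + 1 : ℕ) * (2 * q R₀))
      (fun j => (hS.integrableOn_radialVariation hm hvol (hB j) (hBR j)).1) ?_ (fun j => ?_) ?_
    · rw [integrable_indicator_iff measurableSet_closedBall]
      refine integrableOn_const ?_
      rw [Measure.restrict_apply measurableSet_closedBall, inter_comm]
      exact hvol R
    · filter_upwards [ae_restrict_mem hSm] with x hx
      have hx0 : 0 < ‖x‖ := h0.trans_le (hSR x hx)
      rw [hrv j x hx]
      by_cases hxR : x ∈ Metric.closedBall (0 : Euc (k + 2)) R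
      · have hxR' := mem_closedBall_zero_iff.1 hxR
        rw [indicator_of_mem hxR, norm_mul, norm_mul, RCLike.norm_natCast, mul_assoc]
        refine mul_le_mul_of_nonneg_left ?_ (Nat.cast_nonneg _)
        have hf : ‖lapse (k + 2) m ‖x‖‖ ≤ 1 := by
          rw [Real.norm_of_nonneg (lapse_nonneg hk hm (hSR x hx))]
          exact lapse_le_one hm hx0.le
        refine (mul_le_of_le_one_left (norm_nonneg _) hf).trans ?_
        have hqx : q ‖x‖ ≤ q R₀ := hqanti (mem_Ici.2 le_rfl) (hSR x hx) (hSR x hx)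
        have hy : 0 ≤ q ‖x‖ - q R := sub_nonneg.2 (hqanti (hSR x hx) hR.le hxR')
        have hb1 : B j ‖x‖ ≤ q R₀ := by
          have hj : (0 : ℝ) < j + 1 := by positivity
          refine (div_le_iff₀ hj).2 ((smoothPosPart_le (by positivity)).trans ?_)
          rw [mul_comm]
          exact mul_le_mul_of_nonneg_right (by linarith [hqpos (h0.trans hR)]) hj.le
        have hD := deriv_smoothPosPart_mem_Icc ((j + 1 : ℝ) * (q ‖x‖ - q R))
        have hcos := cosSq_mem_Icc S x
        have hP : q ‖x‖ * (‖tangentialPart S x‖ ^ 2 / ‖x‖ ^ 2) ≤ q R₀ :=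
          (mul_le_of_le_one_right (hqpos hx0).le hcos.2).trans hqx
        have hP0 : 0 ≤ q ‖x‖ * (‖tangentialPart S x‖ ^ 2 / ‖x‖ ^ 2) :=
          mul_nonneg (hqpos hx0).le hcos.1
        refine (norm_sub_le _ _).trans ?_
        rw [two_mul, Real.norm_of_nonneg (hB0 j _ (hSR x hx)),
          Real.norm_of_nonneg (mul_nonneg hD.1 hP0)]
        exact add_le_add hb1 ((mul_le_of_le_one_left hP0 hD.2).trans hP)
      · have hxR' := not_le.1 (fun h => hxR (mem_closedBall_zero_iff.2 h))
        rw [indicator_of_notMem hxR, hBR j _ hxR'.le, deriv_smoothPosPart_of_nonpos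
          (mul_nonpos_of_nonneg_of_nonpos (by positivity) (hBR' _ hxR'.le))]
        simp
    · filter_upwards [ae_restrict_mem hSm] with x hx
      have hx0 : 0 < ‖x‖ := h0.trans_le (hSR x hx)
      have h1 := (((tendsto_smoothPosPart (q ‖x‖ - q R)).sub ((tendsto_deriv_smoothPosPart
        (q ‖x‖ - q R)).mul_const (q ‖x‖ * (‖tangentialPart S x‖ ^ 2 / ‖x‖ ^ 2)))).const_mul
        (((k + 1 : ℕ) : ℝ) * lapse (k + 2) m ‖x‖))
      refine (h1.congr fun j => (hrv j x hx).symm).trans_eq ?_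
      congr 1
      by_cases hxR : x ∈ Metric.ball (0 : Euc (k + 2)) R
      · have hlt : 0 < q ‖x‖ - q R :=
          sub_pos.2 (arealWeight_lt hk hm k.succ_ne_zero (hSR x hx) (mem_ball_zero_iff.1 hxR))
        rw [indicator_of_mem hxR, if_pos hlt, max_eq_left hlt.le, fluxDensity]
        ring
      · have hle := hBR' _ (not_lt.1 fun h => hxR (mem_ball_zero_iff.2 h))
        rw [indicator_of_notMem hxR, if_neg hle.not_gt, max_eq_right hle]
        simp
  have hlim2 := hlim.add ((tendsto_smoothPosPart (q R₀ - q R)).mul_const c)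
  rw [max_eq_left (sub_nonneg.2 (hqanti (mem_Ici.2 le_rfl) hR.le hR.le))] at hlim2
  exact tendsto_nhds_unique hlim2 (tendsto_const_nhds.congr fun j => (hid j).symm)

end IsFreeBoundaryMinimal

/-! ### The flux at infinity -/

theorem tendsto_arealWeight_mul_pow {n : ℕ} (hn : 3 ≤ n) {m : ℝ} (hm : 0 < m) (d : ℕ) :
    Tendsto (fun R => arealWeight n d m R * R ^ d) atTop (𝓝 1) := by
  have h := ((tendsto_radialFactor hn m).pow d).inv₀ (by simp)
  rw [one_pow, inv_one] at h
  refine h.congr' ?_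
  filter_upwards [eventually_gt_atTop 0] with R hR
  have := radialFactor_pos (n := n) hm hR.le
  rw [arealWeight, arealRadius, mul_pow]
  field_simp

theorem tendsto_arealWeight {n : ℕ} (hn : 3 ≤ n) {m : ℝ} (hm : 0 < m) {d : ℕ} (hd : d ≠ 0) :
    Tendsto (arealWeight n d m) atTop (𝓝 0) := by
  have h := (tendsto_arealWeight_mul_pow hn hm d).div_atTop (tendsto_pow_atTop hd)
  refine h.congr' ?_
  filter_upwards [eventually_gt_atTop 0] with R hR
  exact mul_div_cancel_right₀ _ (pow_pos hR d).ne'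

/-- The open ball lies between the closed balls of radii `R - 1` and `R`, and `(R - 1)^d / R^d`
tends to one. -/
theorem tendsto_setIntegral_ball_div_pow {n d : ℕ} (hd : d ≠ 0) {ν : Measure (Euc n)} {g : Euc n → ℝ}
    (hg0 : ∀ᵐ x ∂ν, 0 ≤ g x) (hgi : ∀ R : ℝ, IntegrableOn g (Metric.closedBall 0 R) ν) {L : ℝ}
    (hL : Tendsto (fun R : ℝ => (∫ x in Metric.closedBall 0 R, g x ∂ν) / R ^ d) atTop (𝓝 L)) :
    Tendsto (fun R : ℝ => (∫ x in Metric.ball 0 R, g x ∂ν) / R ^ d) atTop (𝓝 L) := by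
  have h1 : Tendsto (fun R : ℝ => (∫ x in Metric.closedBall 0 (R + -1), g x ∂ν) / R ^ d) atTop
      (𝓝 L) := by
    have h := (hL.comp (tendsto_atTop_add_const_right atTop (-1) tendsto_id)).mul
      (tendsto_add_pow_sub_div_pow (-1) 0 hd)
    rw [mul_one] at h
    refine h.congr' ?_
    filter_upwards [eventually_gt_atTop 1] with R hR
    have hR1 : R + -1 ≠ 0 := by linarith
    have hR0 : R ≠ 0 := by linarith
    simp only [Function.comp_apply, id, sub_zero]
    field_simp
  refine tendsto_of_tendsto_of_tendsto_of_le_of_le' h1 hL ?_ ?_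
  · filter_upwards [eventually_gt_atTop 0] with R hR
    refine div_le_div_of_nonneg_right (setIntegral_mono_set ((hgi R).mono_set
      Metric.ball_subset_closedBall) (ae_restrict_of_ae hg0)
      (Metric.closedBall_subset_ball (by linarith)).eventuallyLE) (by positivity)
  · filter_upwards [eventually_gt_atTop 0] with R hR
    exact div_le_div_of_nonneg_right (setIntegral_mono_set (hgi R) (ae_restrict_of_ae hg0)
      Metric.ball_subset_closedBall.eventuallyLE) (by positivity)

namespace IsFreeBoundaryMinimal

variable {k : ℕ} {m : ℝ} {S : Set (Euc (k + 2))}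

/-- The flux density is integrable; its integral is the flux at infinity minus the flux through the
horizon. -/
theorem integral_fluxDensity (hm : 0 < m) (hk : 3 ≤ k + 2) (hS : IsFreeBoundaryMinimal (k + 2) m S)
    (hvol : ∀ R : ℝ, vol (k + 2) m (k + 1) (S ∩ Metric.closedBall 0 R) ≠ ⊤) {L : ℝ}
    (hL : Tendsto (fun R : ℝ => (vol (k + 2) m (k + 1) (S ∩ Metric.closedBall 0 R)).toReal /
      R ^ (k + 1)) atTop (𝓝 L)) :
    IntegrableOn (fluxDensity m (k + 1) S) S (vol (k + 2) m (k + 1)) ∧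
    ∫ x in S, fluxDensity m (k + 1) S x ∂vol (k + 2) m (k + 1) =
      L - arealWeight (k + 2) (k + 1) m (horizonRadius (k + 2) m) *
        (horizonRadius (k + 2) m * radialFactor (k + 2) m (horizonRadius (k + 2) m) ^ (k + 1) *
        ((Measure.euclideanHausdorffMeasure k : Measure (Euc (k + 2)))
          (S ∩ horizon (k + 2) m)).toReal) / ((k + 1 : ℕ) : ℝ) := by
  have hSm := hS.isClosed.measurableSet
  have hid := fun R => hS.integral_indicator_eq hm hk hvol (R := R)
  set R₀ := horizonRadius (k + 2) m with hR₀
  set c := R₀ * radialFactor (k + 2) m R₀ ^ (k + 1) *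
        ((Measure.euclideanHausdorffMeasure k : Measure (Euc (k + 2)))
          (S ∩ horizon (k + 2) m)).toReal
  set q := arealWeight (k + 2) (k + 1) m
  set ν := (vol (k + 2) m (k + 1)).restrict S with hν
  have h0 : 0 < R₀ := horizonRadius_pos hm
  have hSR : ∀ x ∈ S, R₀ ≤ ‖x‖ := fun x hx => hS.subset_space hx
  have hνR : ∀ R : ℝ, ν (Metric.closedBall 0 R) =
      vol (k + 2) m (k + 1) (S ∩ Metric.closedBall 0 R) := fun R => by
    rw [hν, Measure.restrict_apply measurableSet_closedBall, inter_comm]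
  have hνfin : ∀ R : ℝ, ν (Metric.closedBall 0 R) ≠ ⊤ := fun R => by
    rw [hνR]
    exact hvol R
  have hlapse : ∀ᵐ x ∂ν, 0 ≤ lapse (k + 2) m ‖x‖ ∧ lapse (k + 2) m ‖x‖ ≤ 1 := by
    filter_upwards [ae_restrict_mem hSm] with x hx
    exact ⟨lapse_nonneg hk hm (hSR x hx), lapse_le_one hm (norm_nonneg x)⟩
  have hlapse1 : ∀ᵐ x ∂ν, |lapse (k + 2) m ‖x‖| ≤ 1 := by
    filter_upwards [hlapse] with x hx
    rw [abs_of_nonneg hx.1]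
    exact hx.2
  have hlapsem : AEStronglyMeasurable (fun x => lapse (k + 2) m ‖x‖) ν :=
    (hS.continuousOn_norm_comp hm (continuousOn_lapse hm)).aestronglyMeasurable hSm
  have hlapsei : ∀ R : ℝ, IntegrableOn (fun x => lapse (k + 2) m ‖x‖) (Metric.closedBall 0 R) ν :=
    fun R => Measure.integrableOn_of_bounded (hνfin R) hlapsem (ae_restrict_of_ae hlapse1)
  have hflux : ∀ᵐ x ∂ν, 0 ≤ fluxDensity m (k + 1) S x ∧ fluxDensity m (k + 1) S x ≤ q R₀ := by
    filter_upwards [ae_restrict_mem hSm, hlapse] with x hx hl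
    have hcos := cosSq_mem_Icc S x
    have hq := arealWeight_pos (n := k + 2) (d := k + 1) hm (h0.trans_le (hSR x hx))
    have hlq := mul_nonneg hl.1 hq.le
    exact ⟨mul_nonneg hlq (by linarith [hcos.2]),
      (mul_le_of_le_one_right hlq (by linarith [hcos.1])).trans
        ((mul_le_of_le_one_left hq.le hl.2).trans
        (antitoneOn_arealWeight hk hm (mem_Ici.2 le_rfl) (hSR x hx) (hSR x hx)))⟩
  have hfluxm : AEStronglyMeasurable (fluxDensity m (k + 1) S) ν :=
    (((hS.continuousOn_norm_comp hm (continuousOn_lapse hm)).mul (hS.continuousOn_norm_comp hm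
      (contDiffOn_arealWeight hm).continuousOn)).mul
      (continuousOn_const.sub (hS.continuousOn_cosSq hm))).aestronglyMeasurable hSm
  have hfluxi : ∀ R : ℝ, IntegrableOn (fluxDensity m (k + 1) S) (Metric.ball 0 R) ν := fun R =>
    (Measure.integrableOn_of_bounded (hνfin R) hfluxm (ae_restrict_of_ae (by
      filter_upwards [hflux] with x hx
      rw [Real.norm_of_nonneg hx.1]
      exact hx.2) : ∀ᵐ x ∂_, ‖_‖ ≤ q R₀)).mono_set Metric.ball_subset_closedBall
  -- The exact balance on the ball of radius `R`; each term on the left has a known limit.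
  have hbal : ∀ R, R₀ < R → q R * R ^ (k + 1) * ((∫ x in Metric.ball 0 R, lapse (k + 2) m ‖x‖ ∂ν) /
      R ^ (k + 1)) - (q R₀ - q R) * c / ((k + 1 : ℕ) : ℝ) =
      ∫ x in Metric.ball 0 R, fluxDensity m (k + 1) S x ∂ν := fun R hR => by
    have h := hid R hR
    rw [integral_indicator measurableSet_ball, integral_const_mul, integral_sub (hfluxi R)
      (((hlapsei R).mono_set Metric.ball_subset_closedBall).const_mul _), integral_const_mul] at h
    have hR0 : R ≠ 0 := (h0.trans hR).ne'
    have hd : ((k + 1 : ℕ) : ℝ) ≠ 0 := Nat.cast_ne_zero.2 k.succ_ne_zero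
    field_simp
    linarith
  have hcl := tendsto_setIntegral_closedBall_div_pow k.succ_ne_zero hνfin
    (hL.congr fun R => by rw [measureReal_def, hνR]) hlapsem hlapse1
    (fun η hη => ae_forall_gt_of_tendsto (tendsto_lapse hk m) η hη)
  have hop := tendsto_setIntegral_ball_div_pow k.succ_ne_zero (hlapse.mono fun x hx => hx.1) hlapsei hcl
  have hlim := ((tendsto_arealWeight_mul_pow hk hm (k + 1)).mul hop).sub
    ((((tendsto_arealWeight hk hm k.succ_ne_zero).const_sub (q R₀)).mul_const c).div_const
      ((k + 1 : ℕ) : ℝ))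
  rw [one_mul, sub_zero] at hlim
  have hlim2 : Tendsto (fun R => ∫ x in Metric.ball 0 R, fluxDensity m (k + 1) S x ∂ν) atTop
      (𝓝 (L - q R₀ * c / ((k + 1 : ℕ) : ℝ))) := by
    refine hlim.congr' ?_
    filter_upwards [eventually_gt_atTop R₀] with R hR using hbal R hR
  -- The flux density is nonnegative, so convergence of its integrals over exhausting balls gives
  -- integrability and the value of the integral.
  have hcov : AECover ν atTop (fun R : ℝ => Metric.ball (0 : Euc (k + 2)) R) := aecover_ball tendsto_id
  have hnn := hflux.mono fun x hx => hx.1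
  exact ⟨hcov.integrable_of_integral_tendsto_of_nonneg_ae _ hfluxi hnn hlim2,
    hcov.integral_eq_of_tendsto_of_nonneg_ae _ hnn hfluxi hlim2⟩

/-- `staticPotential` is identified with the lapse off the horizon only, and the horizon is null in
`S`. -/
theorem ae_eq_fluxDensity (hm : 0 < m) (hk : 3 ≤ k + 2) (hS : IsFreeBoundaryMinimal (k + 2) m S) :
    fluxDensity m (k + 1) S =ᵐ[(vol (k + 2) m (k + 1)).restrict S]
      fun x => staticPotential (k + 2) m x /
        radialH (k + 2) m (horizonDist (k + 2) m x) ^ (k + 1) * radialNormalSq (k + 2) m S x := by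
  have hnull := measure_eq_zero_iff_ae_notMem.1 (hS.vol_horizon_eq_zero hm)
  filter_upwards [ae_restrict_of_ae hnull, ae_restrict_mem hS.isClosed.measurableSet] with x hx hxS
  have hxs := hS.subset_space hxS
  have hlt : horizonRadius (k + 2) m < ‖x‖ := lt_of_le_of_ne hxs fun h => hx ⟨hxS, h.symm⟩
  rw [staticPotential_eq hk hm hlt, radialH_horizonDist hk hm hxs,
    radialNormalSq_eq hm (norm_pos_iff.1 ((horizonRadius_pos hm).trans hlt)), fluxDensity, arealWeight,
    ← div_eq_mul_inv]

theorem vol_boundary (hS : IsFreeBoundaryMinimal (k + 2) m S) :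
    vol (k + 2) m k (boundary S) =
      ENNReal.ofReal (radialFactor (k + 2) m (horizonRadius (k + 2) m) ^ k) *
      (Measure.euclideanHausdorffMeasure k : Measure (Euc (k + 2))) (S ∩ horizon (k + 2) m) := by
  have hSh : MeasurableSet (S ∩ horizon (k + 2) m) := hS.isClosed.measurableSet.inter
    (isClosed_eq continuous_norm continuous_const).measurableSet
  rw [hS.boundary_eq, vol, withDensity_apply _ hSh, ← setLIntegral_const]
  refine setLIntegral_congr_fun hSh fun x hx => ?_
  have hxR : ‖x‖ = horizonRadius (k + 2) m := hx.2
  rw [conformalFactor_eq, hxR]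

theorem vol_boundary_ne_top (hm : 0 < m) (hS : IsFreeBoundaryMinimal (k + 2) m S) :
    vol (k + 2) m k (boundary S) ≠ ⊤ := by
  rw [hS.vol_boundary]
  exact ENNReal.mul_ne_top ENNReal.ofReal_ne_top (hS.euclideanHausdorffMeasure_horizon_ne_top hm)

/-- With `s₀ = R₀ ψ(R₀)`, the left side is `s₀^(-(k+1)) s₀ area(∂Σ)`, and `s₀^k = 2m`. -/
theorem horizon_flux (hm : 0 < m) (hk : 3 ≤ k + 2) (hS : IsFreeBoundaryMinimal (k + 2) m S) :
    arealWeight (k + 2) (k + 1) m (horizonRadius (k + 2) m) *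
      (horizonRadius (k + 2) m * radialFactor (k + 2) m (horizonRadius (k + 2) m) ^ (k + 1) *
        ((Measure.euclideanHausdorffMeasure k : Measure (Euc (k + 2)))
          (S ∩ horizon (k + 2) m)).toReal) = (vol (k + 2) m k (boundary S)).toReal / (2 * m) := by
  have h0 := horizonRadius_pos (n := k + 2) hm
  have hψ := radialFactor_pos (n := k + 2) hm h0.le
  have hpow : horizonRadius (k + 2) m ^ k * radialFactor (k + 2) m (horizonRadius (k + 2) m) ^ k =
      2 * m := by
    have h := arealRadius_pow hk hm h0.le
    have h2 : m / (2 * (m / 2)) = 1 := by field_simp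
    rw [horizonRadius_pow hk hm, h2, arealRadius, mul_pow] at h
    refine h.trans ?_
    ring
  rw [hS.vol_boundary, ENNReal.toReal_mul, ENNReal.toReal_ofReal (by positivity), ← hpow, arealWeight,
    arealRadius, mul_pow]
  field_simp
  ring

end IsFreeBoundaryMinimal

end Schwarzschild

end

/-! ### The density formula -/

theorem mainTheorem6 (n : ℕ) (hn : 3 ≤ n) (m : ℝ) (hm : 0 < m)
    (S Γ : Set (Schwarzschild.Euc n))
    (hS : Schwarzschild.IsFreeBoundaryMinimal n m S)
    (hΓ : Schwarzschild.IsClosedMinimalInSphere n Γ)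
    (Θ : ℝ≥0∞) (hΘ : Schwarzschild.HasDensityAtInfinity n m Γ S Θ) (hfin : Θ ≠ ⊤) :
    0 < Schwarzschild.sphereArea n Γ ∧ Schwarzschild.sphereArea n Γ ≠ ⊤ ∧
    Schwarzschild.vol n m (n - 2) (Schwarzschild.boundary S) ≠ ⊤ ∧
    IntegrableOn (fun x => Schwarzschild.staticPotential n m x /
        Schwarzschild.radialH n m (Schwarzschild.horizonDist n m x) ^ (n - 1) *
        Schwarzschild.radialNormalSq n m S x) S (Schwarzschild.vol n m (n - 1)) ∧
    Θ.toReal =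
      (Schwarzschild.vol n m (n - 2) (Schwarzschild.boundary S)).toReal /
          (2 * m * (Schwarzschild.sphereArea n Γ).toReal) +
        ((n : ℝ) - 1) / (Schwarzschild.sphereArea n Γ).toReal *
          ∫ x in S, Schwarzschild.staticPotential n m x /
            Schwarzschild.radialH n m (Schwarzschild.horizonDist n m x) ^ (n - 1) *
            Schwarzschild.radialNormalSq n m S x ∂(Schwarzschild.vol n m (n - 1)) := by
  obtain ⟨k, rfl⟩ : ∃ k, n = k + 2 := ⟨n - 2, by omega⟩
  have hA := ENNReal.toReal_pos hΓ.sphereArea_pos.ne' hΓ.tendsto_radialCone.1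
  obtain ⟨hvol, hL⟩ := hΘ.tendsto hm hn hΓ hS.subset_space hfin
  obtain ⟨hint, hval⟩ := hS.integral_fluxDensity hm hn hvol hL
  have hae := hS.ae_eq_fluxDensity hm hn
  refine ⟨hΓ.sphereArea_pos, hΓ.tendsto_radialCone.1, hS.vol_boundary_ne_top hm, hint.congr hae, ?_⟩
  rw [hS.horizon_flux hm hn, integral_congr_ae hae] at hval
  simp only [show k + 2 - 1 = k + 1 from rfl, show k + 2 - 2 = k from rfl]
  rw [hval]
  push_cast
  have hk : (k : ℝ) + 1 ≠ 0 := by positivity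
  have hk2 : (k : ℝ) + 2 - 1 = k + 1 := by ring
  rw [hk2]
  field_simp
  ring
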